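/- **Setting.** For real $\lambda,\mu,\beta$ let $Z_{\lambda,\mu,\beta}=(X,Y)$ be the non-smooth vector field on $\mathbb R^2$ with switching line $\Sigma=\{y=0\}$ that equals $$X(x,y)=\bigl(1,\,-(x-\lambda)\bigr)\ \ (y\ge 0),\qquad Y(x,y)=\Bigl(\tfrac{\mu}{2}x+\tfrac{\mu-2}{2}(y+\beta),\ \tfrac{\mu-2}{2}x+\tfrac{\mu}{2}(y+\beta)\Bigr)\ \ (y\le 0).$$ Put $f(x,y)=y$. The sewing, escaping and sliding regions of $\Sigma$ are where $X.f\cdot Y.f>0$; $X.f>0>Y.f$; $X.f<0<Y.f$. On the last two Filippov's field is $$Z^\Sigma=\frac{(Y.f)X-(X.f)Y}{Y.f-X.f},$$ and its zeros are the pseudo equilibria. A $\Sigma$-attractor (resp. $\Sigma$-repeller) is an attracting (resp. repelling) zero of $Z^\Sigma$ in the sliding (resp. escaping) region; a $\Sigma$-saddle is an attracting zero in the escaping region or a repelling zero in the sliding region. A canard cycle is a closed curve composed of arcs of at least two of $X$, $Y$, $Z^\Sigma$ (or of a single arc of $Z^\Sigma$), passing between $X$ and $Y$ at sewing points, and between $X$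 or $Y$ and $Z^\Sigma$ at fold points or regular points of the sliding and escaping regions (in that last case each component of its intersection with $\Sigma$ that carries an arc of $Z^\Sigma$ contains a visible fold, unless the cycle is $\Sigma$); it is of kind I if it meets $\Sigma$ only at sewing points. A $\Sigma$-graph of kind I is a closed path composed of equilibria off $\Sigma$ and trajectories joining them, which meets $\Sigma$, but only at sewing points. $X$ has an invisible fold at $d=\lambda$ on $\Sigma$. $Y$ has a hyperbolic saddle $S=(0,-\beta)$, and $Y.f$ vanishes on $\Sigma$ exactly at $\tau=\mu\beta/(2-\mu)$. If $\beta>0$, the unstable and the stable separatrix of $S$ meet $\Sigma$ at $h=-\beta$ and $j=\beta$. The *configuration* of $Z$ is the line $\Sigma$, up to orientation preserving homeomorphisms, with its distinguished subsets: the three regions, the visible and the invisible folds of $X$ and of $Y$, the equilibria on $\Sigma$, the points where the unstable and the stable separatrices of a saddle of $Y$ in $y<0$ meet $\Sigma$, the end point of the arc of $X$ (in $y\ge0$) starting at such an unstable point, and the starting point of the arc of $X$ ending at such a stable point. The *topological behaviour* of $Z$ is the inventory (number of each type) of its critical elements: saddles off $\Sigma$ ($X$-saddles in $y>0$, $Y$-saddles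 in $y<0$), saddles on $\Sigma$, $\Sigma$-attractors, $\Sigma$-repellers, $\Sigma$-saddles, points of tangency of both $X$ and $Y$ with $\Sigma$ that attract (resp. repel) all nearby trajectories, canard cycles (attracting of kind I, repelling of kind I, all others), and $\Sigma$-graphs of kind I (attracting the nearby trajectories inside them, or not). Attraction and repulsion of points of double tangency, cycles and graphs are meant through successive intersections with $\Sigma$: nearby trajectories on $\Sigma$ cross $\Sigma$ infinitely often, always at sewing points, and these crossings tend to the object (for repulsion: after reversing time). **Theorem 3.** There is $\varepsilon_0>0$ such that for every $\mu$ with $-\varepsilon_0<\mu<0$ the following holds for the family $Z_{\lambda,\mu,\beta}$, $(\lambda,\beta)\in(-1,1)^2$. Exactly $19$ configurations and exactly $7$ topological behaviours occur. The configuration classes are the following $19$ non-empty strata, which partition the parameter square: * $\beta<0$: (1) $\lambda<\tau$, (2) $\lambda=\tau$, (3) $\lambda>\tau$; * $\beta=0$: (4) $\lambda<0$, (5) $\lambda=0$, (6) $\lambda>0$; * $\beta>0$: (7) $\lambda<-\beta$, (8) $\lambda=-\beta$, (9) $-\beta<\lambda<\frac{(\mu-1)\beta}{2-\mu}$, (10)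 $\lambda=\frac{(\mu-1)\beta}{2-\mu}$, (11) $\frac{(\mu-1)\beta}{2-\mu}<\lambda<\tau$, (12) $\lambda=\tau$, (13) $\tau<\lambda<0$, (14) $\lambda=0$, (15) $0<\lambda<\frac{\beta}{2-\mu}$, (16) $\lambda=\frac{\beta}{2-\mu}$, (17) $\frac{\beta}{2-\mu}<\lambda<\beta$, (18) $\lambda=\beta$, (19) $\lambda>\beta$. The topological behaviour is the same on two strata exactly when they lie in the same one of the following seven groups, and on each group the critical elements are exactly those listed, one of each: * (1)–(3): none; * (4)–(6): a saddle on $\Sigma$; * (7)–(11): a saddle off $\Sigma$ and a $\Sigma$-attractor; * (12): a saddle off $\Sigma$ and an attracting point of double tangency; * (13): a saddle off $\Sigma$, a $\Sigma$-repeller and an attracting canard cycle of kind I; * (14): a saddle off $\Sigma$, a $\Sigma$-repeller and a $\Sigma$-graph of kind I that attracts the nearby trajectories inside it; * (15)–(19): a saddle off $\Sigma$ and a $\Sigma$-repeller. Moreover, for all $(\lambda,\beta)\in(-1,1)^2$, the sliding region is $\{\lambda<x<\tau\}$, the escaping region is $\{\tau<x<\lambda\}$, and the sewing region is the complement in $\Sigma$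 of the closed segment with end points $\lambda$ and $\tau$. If $\beta\le 0$, then $Z^\Sigma$ points to the right on the sliding and escaping regions. If $\beta>0$ and $\lambda\neq\tau$, the unique pseudo equilibrium is at $$x=\frac{1}{2\mu}\Bigl((2-\mu)(1+\beta)+\lambda\mu-\sqrt{\bigl((2-\mu)(1+\beta)+\lambda\mu\bigr)^2-4\beta\mu\bigl(\mu+\lambda(2-\mu)\bigr)}\Bigr).$$ -/

import Mathlib

open Set Filter Topology

noncomputable section

/-- A non-smooth vector field `Z = (X, Y)` on the plane with switching line
`Σ = {y = 0}`: `X` acts on `y ≥ 0` and `Y` acts on `y ≤ 0`.  A point `(x, 0)` of `Σ` is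
identified with the real number `x`. -/
structure NSVF where
  X : ℝ × ℝ → ℝ × ℝ
  Y : ℝ × ℝ → ℝ × ℝ

/-- The family with an invisible fold of `X` at `(lam, 0)` and a saddle of `Y` at `(0, -β)`. -/
def foldSaddle (lam μ β : ℝ) : NSVF where
  X := fun p => (1, -(p.1 - lam))
  Y := fun p =>
    (μ / 2 * p.1 + (μ - 2) / 2 * (p.2 + β), (μ - 2) / 2 * p.1 + μ / 2 * (p.2 + β))

namespace NSVF

/-- The same field with time reversed. -/
def reverse (Z : NSVF) : NSVF := ⟨fun p => -Z.X p, fun p => -Z.Y p⟩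

/-- The switching line `y = 0`. -/
def line : Set (ℝ × ℝ) := {p | p.2 = 0}

/-! ### Lie derivatives of `f (x, y) = y`, regions of the switching line, folds -/

/-- `X.f` on `Σ`. -/
def Xf (Z : NSVF) (x : ℝ) : ℝ := (Z.X (x, 0)).2

/-- `Y.f` on `Σ`. -/
def Yf (Z : NSVF) (x : ℝ) : ℝ := (Z.Y (x, 0)).2

/-- `X².f = X.(X.f)` on `Σ`. -/
def Xff (Z : NSVF) (x : ℝ) : ℝ := fderiv ℝ (fun p => (Z.X p).2) (x, 0) (Z.X (x, 0))

/-- `Y².f = Y.(Y.f)` on `Σ`. -/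
def Yff (Z : NSVF) (x : ℝ) : ℝ := fderiv ℝ (fun p => (Z.Y p).2) (x, 0) (Z.Y (x, 0))

def Sewing (Z : NSVF) (x : ℝ) : Prop := 0 < Z.Xf x * Z.Yf x

def Escaping (Z : NSVF) (x : ℝ) : Prop := 0 < Z.Xf x ∧ Z.Yf x < 0

def Sliding (Z : NSVF) (x : ℝ) : Prop := Z.Xf x < 0 ∧ 0 < Z.Yf x

def VisibleFoldX (Z : NSVF) (x : ℝ) : Prop := Z.Xf x = 0 ∧ 0 < Z.Xff x

def InvisibleFoldX (Z : NSVF) (x : ℝ) : Prop := Z.Xf x = 0 ∧ Z.Xff x < 0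

/-- `Y` acts below `Σ`, so a fold is visible when the orbit bends downwards. -/
def VisibleFoldY (Z : NSVF) (x : ℝ) : Prop := Z.Yf x = 0 ∧ Z.Yff x < 0

def InvisibleFoldY (Z : NSVF) (x : ℝ) : Prop := Z.Yf x = 0 ∧ 0 < Z.Yff x

def VisibleFold (Z : NSVF) (x : ℝ) : Prop := Z.VisibleFoldX x ∨ Z.VisibleFoldY x

def FoldX (Z : NSVF) (x : ℝ) : Prop := Z.VisibleFoldX x ∨ Z.InvisibleFoldX x

def FoldY (Z : NSVF) (x : ℝ) : Prop := Z.VisibleFoldY x ∨ Z.InvisibleFoldY x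

/-! ### The Filippov field on the sliding and escaping regions -/

/-- The (horizontal component of the) vector `m - q`, where `q = (x, 0)` and `m` is the point of
`Σ` on the straight line through `q + X q` and `q + Y q`; it is used only where `x` is a sliding
or an escaping point. -/
def slide (Z : NSVF) (x : ℝ) : ℝ :=
  (Z.Yf x * (Z.X (x, 0)).1 - Z.Xf x * (Z.Y (x, 0)).1) / (Z.Yf x - Z.Xf x)

/-- Pseudo equilibria. -/
def PseudoEq (Z : NSVF) (x : ℝ) : Prop := (Z.Sliding x ∨ Z.Escaping x) ∧ Z.slide x = 0

/-- A regular point of the sliding or escaping region. -/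
def RegularSlide (Z : NSVF) (x : ℝ) : Prop := (Z.Sliding x ∨ Z.Escaping x) ∧ Z.slide x ≠ 0

/-- `x` is an attracting zero of the one-dimensional field `g`. -/
def AttractsLine (g : ℝ → ℝ) (x : ℝ) : Prop :=
  g x = 0 ∧ ∃ δ > 0, (∀ z ∈ Ioo (x - δ) x, 0 < g z) ∧ ∀ z ∈ Ioo x (x + δ), g z < 0

/-- `x` is a repelling zero of the one-dimensional field `g`. -/
def RepelsLine (g : ℝ → ℝ) (x : ℝ) : Prop :=
  g x = 0 ∧ ∃ δ > 0, (∀ z ∈ Ioo (x - δ) x, g z < 0) ∧ ∀ z ∈ Ioo x (x + δ), 0 < g z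

def SigmaAttractor (Z : NSVF) (x : ℝ) : Prop := Z.Sliding x ∧ AttractsLine Z.slide x

def SigmaRepeller (Z : NSVF) (x : ℝ) : Prop := Z.Escaping x ∧ RepelsLine Z.slide x

def SigmaSaddle (Z : NSVF) (x : ℝ) : Prop :=
  (Z.Escaping x ∧ AttractsLine Z.slide x) ∨ (Z.Sliding x ∧ RepelsLine Z.slide x)

/-! ### Equilibria -/

/-- `p` is a hyperbolic saddle of the planar vector field `V`. -/
def IsSaddle (V : ℝ × ℝ → ℝ × ℝ) (p : ℝ × ℝ) : Prop :=
  V p = 0 ∧ ∃ a < 0, ∃ b > 0,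
    Module.End.HasEigenvalue (fderiv ℝ V p : (ℝ × ℝ) →ₗ[ℝ] (ℝ × ℝ)) a ∧
    Module.End.HasEigenvalue (fderiv ℝ V p : (ℝ × ℝ) →ₗ[ℝ] (ℝ × ℝ)) b

/-- Equilibria of `Z` off `Σ`. -/
def Equilibrium (Z : NSVF) (p : ℝ × ℝ) : Prop :=
  (0 < p.2 ∧ Z.X p = 0) ∨ (p.2 < 0 ∧ Z.Y p = 0)

/-- Saddles of `Z` off `Σ`. -/
def RealSaddle (Z : NSVF) (p : ℝ × ℝ) : Prop :=
  (0 < p.2 ∧ IsSaddle Z.X p) ∨ (p.2 < 0 ∧ IsSaddle Z.Y p)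

/-- Saddles of one of the two fields that lie on `Σ`. -/
def BoundarySaddle (Z : NSVF) (p : ℝ × ℝ) : Prop :=
  p.2 = 0 ∧ (IsSaddle Z.X p ∨ IsSaddle Z.Y p)

/-! ### Arcs -/

inductive ArcKind
  | ofX
  | ofY
  | ofSlide

/-- The curve `γ` solves, at time `t`, the equation of the given kind: `X` in `y > 0`, `Y` in
`y < 0`, or the Filippov field at a regular point of the sliding or escaping region. -/
def SolvesAt (Z : NSVF) (γ : ℝ → ℝ × ℝ) (t : ℝ) : ArcKind → Prop
  | .ofX => 0 < (γ t).2 ∧ HasDerivAt γ (Z.X (γ t)) t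
  | .ofY => (γ t).2 < 0 ∧ HasDerivAt γ (Z.Y (γ t)) t
  | .ofSlide => (γ t).2 = 0 ∧ Z.RegularSlide (γ t).1 ∧ HasDerivAt γ (Z.slide (γ t).1, 0) t

/-- `C` is an arc of the given kind that leads from `(x, 0)` to `(z, 0)` in finite positive
time. -/
def IsArc (Z : NSVF) (k : ArcKind) (x z : ℝ) (C : Set (ℝ × ℝ)) : Prop :=
  ∃ T > 0, ∃ γ : ℝ → ℝ × ℝ, ContinuousOn γ (Icc 0 T) ∧ γ 0 = (x, 0) ∧ γ T = (z, 0) ∧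
    C = γ '' Icc 0 T ∧ ∀ t ∈ Ioo 0 T, Z.SolvesAt γ t k

/-- An orbit of `Y` in `y < 0` leads from the point `v` (as `t → -∞`) to `(x, 0)`. -/
def UnstableHit (Z : NSVF) (v : ℝ × ℝ) (x : ℝ) : Prop :=
  ∃ γ : ℝ → ℝ × ℝ, ContinuousOn γ (Iic 0) ∧ γ 0 = (x, 0) ∧ Tendsto γ atBot (𝓝 v) ∧
    ∀ t < 0, Z.SolvesAt γ t .ofY

/-- An orbit of `Y` in `y < 0` leads from `(x, 0)` to the point `v` (as `t → ∞`). -/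
def StableHit (Z : NSVF) (v : ℝ × ℝ) (x : ℝ) : Prop :=
  ∃ γ : ℝ → ℝ × ℝ, ContinuousOn γ (Ici 0) ∧ γ 0 = (x, 0) ∧ Tendsto γ atTop (𝓝 v) ∧
    ∀ t > 0, Z.SolvesAt γ t .ofY

/-! ### Canard cycles -/

/-- Two consecutive arcs of kinds `a`, `b` may be joined at `(x, 0)`: arcs of `X` and `Y` at a
sewing point, arcs of `X` or `Y` and arcs of the Filippov field at a fold point or at a regular
point of the sliding or escaping region; an arc of `X` (or `Y`) may touch `Σ` at a fold of that
field. -/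
def Joins (Z : NSVF) (x : ℝ) : ArcKind → ArcKind → Prop
  | .ofX, .ofY => Z.Sewing x
  | .ofY, .ofX => Z.Sewing x
  | .ofX, .ofX => Z.FoldX x
  | .ofY, .ofY => Z.FoldY x
  | _, _ => Z.FoldX x ∨ Z.FoldY x ∨ Z.RegularSlide x

/-- Canard cycles: closed curves composed of `n + 1` arcs (indices are cyclic), with arcs of at
least two of the fields `X`, `Y`, `Z^Σ`, or a single arc of `Z^Σ`; unless the cycle is `Σ` itself,
the components of its intersection with `Σ` that carry arcs of `Z^Σ` contain visible folds. -/
def CanardCycle (Z : NSVF) (Γ : Set (ℝ × ℝ)) : Prop :=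
  ∃ (n : ℕ) (k : Fin (n + 1) → ArcKind) (x : Fin (n + 1) → ℝ) (C : Fin (n + 1) → Set (ℝ × ℝ)),
    Γ = ⋃ i, C i ∧
    (∀ i, Z.IsArc (k i) (x i) (x (i + 1)) (C i)) ∧
    (∀ i, Z.Joins (x (i + 1)) (k i) (k (i + 1))) ∧
    ((∃ i j, k i ≠ k j) ∨ (n = 0 ∧ k 0 = .ofSlide)) ∧
    (Γ ≠ line → ∀ i, k i = .ofSlide →
      ∃ z, Z.VisibleFold z ∧ (z, 0) ∈ connectedComponentIn (Γ ∩ line) (x i, 0))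

/-- Canard cycles of kind I: they meet `Σ` only in sewing points. -/
def CanardCycleI (Z : NSVF) (Γ : Set (ℝ × ℝ)) : Prop :=
  Z.CanardCycle Γ ∧ ∀ x : ℝ, (x, (0 : ℝ)) ∈ Γ → Z.Sewing x

/-! ### Stability, by means of successive crossings of the switching line -/

/-- The sequence of successive intersections with `Σ` of a forward trajectory of `Z` that crosses
`Σ` infinitely often, always at sewing points. -/
def CrossingOrbit (Z : NSVF) (x : ℕ → ℝ) : Prop :=
  ∀ n, Z.Sewing (x n) ∧ ∃ C, Z.IsArc .ofX (x n) (x (n + 1)) C ∨ Z.IsArc .ofY (x n) (x (n + 1)) C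

/-- The trajectory of the point `(z, 0)` crosses `Σ` infinitely often, always at sewing points,
and tends to the set `A`. -/
def AttractedTo (Z : NSVF) (A : Set (ℝ × ℝ)) (z : ℝ) : Prop :=
  (∃ x, Z.CrossingOrbit x ∧ x 0 = z) ∧
  ∀ x, Z.CrossingOrbit x → x 0 = z →
    Tendsto (fun n => Metric.infDist (x n, (0 : ℝ)) A) atTop (𝓝 0)

/-- A tangency point of both `X` and `Y` (not generic) that attracts all nearby
trajectories. -/
def TangentialAttractor (Z : NSVF) (q : ℝ) : Prop :=
  Z.Xf q = 0 ∧ Z.Yf q = 0 ∧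
    ∃ δ > 0, ∀ z, z ≠ q → |z - q| < δ → Z.AttractedTo {(q, 0)} z

/-- A canard cycle of kind I that attracts all nearby trajectories, on both sides. -/
def AttractingCycleI (Z : NSVF) (Γ : Set (ℝ × ℝ)) : Prop :=
  Z.CanardCycleI Γ ∧ ∃ U, IsOpen U ∧ Γ ⊆ U ∧ ∀ z : ℝ, (z, (0 : ℝ)) ∈ U → Z.AttractedTo Γ z

def RepellingCycleI (Z : NSVF) (Γ : Set (ℝ × ℝ)) : Prop :=
  Z.CanardCycleI Γ ∧
    ∃ U, IsOpen U ∧ Γ ⊆ U ∧ ∀ z : ℝ, (z, (0 : ℝ)) ∈ U → Z.reverse.AttractedTo Γ z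

/-! ### Graphs of kind I -/

/-- `γ` is a trajectory of `Z` defined for all times, meeting `Σ` only at sewing points. -/
def CrossingTrajectory (Z : NSVF) (γ : ℝ → ℝ × ℝ) : Prop :=
  ∀ t, (0 < (γ t).2 → HasDerivAt γ (Z.X (γ t)) t) ∧
    ((γ t).2 < 0 → HasDerivAt γ (Z.Y (γ t)) t) ∧
    ((γ t).2 = 0 →
      (0 < Z.Xf (γ t).1 ∧ 0 < Z.Yf (γ t).1 ∧
        HasDerivWithinAt γ (Z.Y (γ t)) (Iic t) t ∧ HasDerivWithinAt γ (Z.X (γ t)) (Ici t) t) ∨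
      (Z.Xf (γ t).1 < 0 ∧ Z.Yf (γ t).1 < 0 ∧
        HasDerivWithinAt γ (Z.X (γ t)) (Iic t) t ∧ HasDerivWithinAt γ (Z.Y (γ t)) (Ici t) t))

/-- `Σ`-graphs of kind I: closed paths composed of equilibria off `Σ` (tangential singularities
and pseudo equilibria are not sewing points) and of trajectories that join them cyclically, and
that meet `Σ`, but only in sewing points. -/
def GraphI (Z : NSVF) (Δ : Set (ℝ × ℝ)) : Prop :=
  (Δ ∩ line).Nonempty ∧
  ∃ (n : ℕ) (v : Fin (n + 1) → ℝ × ℝ) (γ : Fin (n + 1) → ℝ → ℝ × ℝ),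
    Δ = ⋃ i, ({v i} ∪ range (γ i)) ∧
    ∀ i, Z.Equilibrium (v i) ∧ Z.CrossingTrajectory (γ i) ∧
      Tendsto (γ i) atBot (𝓝 (v i)) ∧ Tendsto (γ i) atTop (𝓝 (v (i + 1)))

/-- `p` lies inside the closed curve `Δ`. -/
def Inside (Δ : Set (ℝ × ℝ)) (p : ℝ × ℝ) : Prop :=
  p ∉ Δ ∧ Bornology.IsBounded (connectedComponentIn Δᶜ p)

/-- A `Σ`-graph of kind I that attracts the nearby trajectories inside it. -/
def AttractingGraphI (Z : NSVF) (Δ : Set (ℝ × ℝ)) : Prop :=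
  Z.GraphI Δ ∧ ∃ U, IsOpen U ∧ Δ ⊆ U ∧
    ∀ z : ℝ, (z, (0 : ℝ)) ∈ U → Inside Δ (z, 0) → Z.AttractedTo Δ z

/-! ### Topological behaviours: the inventory of critical elements -/

inductive Critical
  | saddle
  | boundarySaddle
  | sigmaAttractor
  | sigmaRepeller
  | sigmaSaddle
  | tangentialAttractor
  | tangentialRepeller
  | attractingCycleI
  | repellingCycleI
  | otherCycle
  | attractingGraphI
  | otherGraphI
deriving DecidableEq

/-- The topological behaviour of `Z`: how many critical elements of each type it has. -/
def behaviour (Z : NSVF) : Critical → ℕ∞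
  | .saddle => {p | Z.RealSaddle p}.encard
  | .boundarySaddle => {p | Z.BoundarySaddle p}.encard
  | .sigmaAttractor => {x | Z.SigmaAttractor x}.encard
  | .sigmaRepeller => {x | Z.SigmaRepeller x}.encard
  | .sigmaSaddle => {x | Z.SigmaSaddle x}.encard
  | .tangentialAttractor => {x | Z.TangentialAttractor x}.encard
  | .tangentialRepeller => {x | Z.reverse.TangentialAttractor x}.encard
  | .attractingCycleI => {Γ | Z.AttractingCycleI Γ}.encard
  | .repellingCycleI => {Γ | Z.RepellingCycleI Γ}.encard
  | .otherCycle => {Γ | Z.CanardCycle Γ ∧ ¬ Z.AttractingCycleI Γ ∧ ¬ Z.RepellingCycleI Γ}.encard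
  | .attractingGraphI => {Δ | Z.AttractingGraphI Δ}.encard
  | .otherGraphI => {Δ | Z.GraphI Δ ∧ ¬ Z.AttractingGraphI Δ}.encard

/-! ### Configurations: the switching line with its distinguished subsets -/

inductive Mark
  | sewing
  | escaping
  | sliding
  | visibleFoldX
  | invisibleFoldX
  | visibleFoldY
  | invisibleFoldY
  | equilibrium
  | unstable
  | stable
  | unstableNext
  | stablePrev

/-- Where the unstable separatrices of the saddles of `Y` in `y < 0` first meet `Σ`. -/
def unstableSet (Z : NSVF) : Set ℝ := {x | ∃ v, v.2 < 0 ∧ IsSaddle Z.Y v ∧ Z.UnstableHit v x}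

/-- Where the stable separatrices of the saddles of `Y` in `y < 0` last meet `Σ`. -/
def stableSet (Z : NSVF) : Set ℝ := {x | ∃ v, v.2 < 0 ∧ IsSaddle Z.Y v ∧ Z.StableHit v x}

/-- The distinguished subsets of `Σ`: its regions, the folds, the equilibria on `Σ`, the points
where separatrices of the saddle meet `Σ`, and the other end points of the arcs of `X` that
continue these separatrices. -/
def marks (Z : NSVF) : Mark → Set ℝ
  | .sewing => {x | Z.Sewing x}
  | .escaping => {x | Z.Escaping x}
  | .sliding => {x | Z.Sliding x}
  | .visibleFoldX => {x | Z.VisibleFoldX x}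
  | .invisibleFoldX => {x | Z.InvisibleFoldX x}
  | .visibleFoldY => {x | Z.VisibleFoldY x}
  | .invisibleFoldY => {x | Z.InvisibleFoldY x}
  | .equilibrium => {x | Z.X (x, 0) = 0 ∨ Z.Y (x, 0) = 0}
  | .unstable => Z.unstableSet
  | .stable => Z.stableSet
  | .unstableNext => {z | ∃ x ∈ Z.unstableSet, ∃ C, Z.IsArc .ofX x z C}
  | .stablePrev => {z | ∃ x ∈ Z.stableSet, ∃ C, Z.IsArc .ofX z x C}

/-- Two fields have the same configuration when an orientation preserving homeomorphism of `Σ`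
carries the distinguished subsets of the one to those of the other. -/
instance configurationSetoid : Setoid NSVF where
  r Z W := ∃ φ : ℝ ≃o ℝ, ∀ m, φ '' Z.marks m = W.marks m
  iseqv :=
    { refl := fun Z => ⟨OrderIso.refl ℝ, fun m => by simp⟩
      symm := by
        rintro Z W ⟨φ, h⟩
        refine ⟨φ.symm, fun m => ?_⟩
        rw [← h m, ← Set.image_comp]
        simp
      trans := by
        rintro Z W V ⟨φ, h⟩ ⟨ψ, k⟩
        refine ⟨φ.trans ψ, fun m => ?_⟩
        rw [← k m, ← h m, ← Set.image_comp]
        rfl }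

/-- The configuration of `Z`. -/
def configuration (Z : NSVF) : Quotient configurationSetoid := Quotient.mk _ Z

end NSVF

/-! ### The bifurcation diagram -/

/-- The abscissa of the tangency point of `Y` with `Σ`. -/
def tangency (μ β : ℝ) : ℝ := μ * β / (2 - μ)

/-- The 19 strata of the `(lam, β)`-plane.  The strata `i = 6, …, 18` are separated by `-β` and
`β` (the separatrix points `h` and `j`), the midpoint of `h` and the tangency point of `Y`, that
tangency point, `0` (the midpoint of `h` and `j`), and the midpoint of the tangency point and
`j`. -/
def stratum (μ lam β : ℝ) : Fin 19 → Prop :=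
  ![β < 0 ∧ lam < tangency μ β,
    β < 0 ∧ lam = tangency μ β,
    β < 0 ∧ tangency μ β < lam,
    β = 0 ∧ lam < 0,
    β = 0 ∧ lam = 0,
    β = 0 ∧ 0 < lam,
    0 < β ∧ lam < -β,
    0 < β ∧ lam = -β,
    0 < β ∧ -β < lam ∧ lam < (μ - 1) * β / (2 - μ),
    0 < β ∧ lam = (μ - 1) * β / (2 - μ),
    0 < β ∧ (μ - 1) * β / (2 - μ) < lam ∧ lam < tangency μ β,
    0 < β ∧ lam = tangency μ β,
    0 < β ∧ tangency μ β < lam ∧ lam < 0,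
    0 < β ∧ lam = 0,
    0 < β ∧ 0 < lam ∧ lam < β / (2 - μ),
    0 < β ∧ lam = β / (2 - μ),
    0 < β ∧ β / (2 - μ) < lam ∧ lam < β,
    0 < β ∧ lam = β,
    0 < β ∧ β < lam]

/-- Which of the 7 topological behaviours occurs on which stratum. -/
def behaviourIndex : Fin 19 → Fin 7 :=
  ![0, 0, 0, 1, 1, 1, 2, 2, 2, 2, 2, 3, 4, 5, 6, 6, 6, 6, 6]

/-- The critical elements of the 7 topological behaviours (one of each listed type). -/
def criticalElements : Fin 7 → List NSVF.Critical :=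
  ![[],
    [.boundarySaddle],
    [.saddle, .sigmaAttractor],
    [.saddle, .tangentialAttractor],
    [.saddle, .sigmaRepeller, .attractingCycleI],
    [.saddle, .sigmaRepeller, .attractingGraphI],
    [.saddle, .sigmaRepeller]]

/-- The abscissa of the pseudo equilibrium. -/
def pseudoRoot (lam μ β : ℝ) : ℝ :=
  ((2 - μ) * (1 + β) + lam * μ -
    √(((2 - μ) * (1 + β) + lam * μ) ^ 2 - 4 * β * μ * (μ + lam * (2 - μ)))) / (2 * μ)

/-- The parameter square. -/
def parameters : Set (ℝ × ℝ) := Ioo (-1) 1 ×ˢ Ioo (-1) 1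

end

noncomputable section
namespace FoldSaddle

variable {lam μ β lam' β' : ℝ}

/-! Both fields can be integrated explicitly. An arc of the upper field is a parabola and acts on
the switching line as the reflection `x ↦ 2 * lam - x` about the fold (`isArcX_iff`). The lower
field is linear and diagonal in the coordinates `x ± (y + β)`, with eigenvalues `μ - 1` and `1`. For
`β > 0` this gives a first integral whose restriction to the line is `height x = (β + x) * (β - x) ^
(1 - μ)`. It vanishes at the separatrix points `-β` and `β`, rises up to the tangency point τ and
falls from there to `β`. An arc of the lower field joins a point of `(τ, β)` to the point of `(-β,
τ)` at the same height (`isArcY_iff`). For `β ≤ 0` the lower field has no arc that returns to the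
line (`not_isArcY`), and all remaining arcs lead to the right, so nothing recurs.

For `β > 0`, recurrence is therefore a comparison of `height (lam + s)` with `height (lam - s)`. The
derivative in `s` of the difference of logarithms has the sign of `gapNum`, which is affine in `s ^
2`. For `-β < lam ≤ τ` the right end point is always the higher one; for `lam ≥ 0` it is always the
lower one; in between the difference is first negative, then positive, and its single zero gives the
cycle (`exists_cycle_radius`). At `lam = τ` the cycle has shrunk to the double tangency, and at `lam
= 0` it has grown into the homoclinic loop of the saddle. `IsBasin` treats the three limit objects
together: the comparison of heights makes the return sequence monotone towards `L`, and its limit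
solves the height equation, hence is `L` (`IsBasin.tendsto_even`). In reversed time, points beyond
`L` move further away, so nothing repels. `canardCycle_eq` and `graphI_eq` show that there are no
further cycles or graphs.

For `β > 0` and `lam ≠ τ` the pseudo equilibrium is the larger root of a concave quadratic whose
signs at `lam` and τ differ (`slideNum_sign`). It attracts on the sliding side and repels on the
escaping side.

For `β > 0` a configuration amounts to the relative order of the six points `lam`, τ, `-β`, `β`, `2
* lam + β`, `2 * lam - β`. Every comparison of two of them is forced or compares `lam` with one of
six thresholds, and an order preserving bijection of finite sets extends to an order isomorphism of
the line. The six thresholds cut out 13 strata; the sign of `β` and the order of `lam` and τ give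
the other six. The behaviours are read off stratum by stratum. -/

theorem mul_neg_iff_of_pos_left {a b : ℝ} (ha : 0 < a) : a * b < 0 ↔ b < 0 := by
  rw [mul_neg_iff]
  constructor
  · rintro (h | h) <;> linarith [h.1, h.2]
  · exact fun h => Or.inl ⟨ha, h⟩

/-! ### Lie derivatives, folds and regions -/

theorem Xf_eq (x : ℝ) : (foldSaddle lam μ β).Xf x = lam - x := by
  simp [NSVF.Xf, foldSaddle]

theorem Yf_eq (hμ : μ < 0) (x : ℝ) :
    (foldSaddle lam μ β).Yf x = (2 - μ) / 2 * (tangency μ β - x) := by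
  have : (2 - μ) ≠ 0 := by linarith
  simp only [NSVF.Yf, foldSaddle, tangency]
  field_simp
  ring

theorem Xff_eq (x : ℝ) : (foldSaddle lam μ β).Xff x = -1 := by
  have h : HasFDerivAt (fun p : ℝ × ℝ => -(p.1 - lam))
      (-(ContinuousLinearMap.fst ℝ ℝ ℝ)) (x, 0) :=
    ((hasFDerivAt_fst (𝕜 := ℝ)).sub_const lam).neg
  simp only [NSVF.Xff, foldSaddle]
  rw [h.fderiv]
  simp

/-- The linear part of the lower field. -/
def linearPart (μ : ℝ) : ℝ × ℝ →L[ℝ] ℝ × ℝ :=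
  ((μ / 2) • ContinuousLinearMap.fst ℝ ℝ ℝ + ((μ - 2) / 2) • ContinuousLinearMap.snd ℝ ℝ ℝ).prod
    (((μ - 2) / 2) • ContinuousLinearMap.fst ℝ ℝ ℝ + (μ / 2) • ContinuousLinearMap.snd ℝ ℝ ℝ)

theorem linearPart_apply (p : ℝ × ℝ) : linearPart μ p =
    (μ / 2 * p.1 + (μ - 2) / 2 * p.2, (μ - 2) / 2 * p.1 + μ / 2 * p.2) := by
  simp [linearPart]

theorem Y_eq_linearPart :
    (foldSaddle lam μ β).Y = fun p => linearPart μ (p + (0, β)) := by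
  funext p
  simp [foldSaddle, linearPart_apply]

theorem hasFDerivAt_Y (p : ℝ × ℝ) :
    HasFDerivAt (foldSaddle lam μ β).Y (linearPart μ) p := by
  rw [Y_eq_linearPart]
  exact (linearPart μ).hasFDerivAt.comp p ((hasFDerivAt_id p).add_const _)

theorem Yff_eq (x : ℝ) : (foldSaddle lam μ β).Yff x =
    (μ - 2) / 2 * (μ / 2 * x + (μ - 2) / 2 * β) + μ / 2 * ((μ - 2) / 2 * x + μ / 2 * β) := by
  have h : HasFDerivAt (fun p : ℝ × ℝ => ((foldSaddle lam μ β).Y p).2)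
      ((ContinuousLinearMap.snd ℝ ℝ ℝ).comp (linearPart μ)) (x, 0) :=
    (hasFDerivAt_snd (𝕜 := ℝ)).comp _ (hasFDerivAt_Y (lam := lam) (β := β) (x, 0))
  simp only [NSVF.Yff]
  rw [h.fderiv]
  simp [linearPart_apply, foldSaddle]

theorem Yff_tangency (hμ : μ < 0) :
    (foldSaddle lam μ β).Yff (tangency μ β) = (1 - μ) * β := by
  have : (2 - μ) ≠ 0 := by linarith
  rw [Yff_eq, tangency]
  field_simp
  ring

theorem Yf_eq_zero_iff (hμ : μ < 0) {x : ℝ} :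
    (foldSaddle lam μ β).Yf x = 0 ↔ x = tangency μ β := by
  rw [Yf_eq hμ]
  constructor
  · intro h
    rcases mul_eq_zero.1 h with h | h <;> linarith
  · rintro rfl; simp

theorem Yf_pos_iff (hμ : μ < 0) {x : ℝ} :
    0 < (foldSaddle lam μ β).Yf x ↔ x < tangency μ β := by
  rw [Yf_eq hμ, mul_pos_iff_of_pos_left (by linarith), sub_pos]

theorem Yf_neg_iff (hμ : μ < 0) {x : ℝ} :
    (foldSaddle lam μ β).Yf x < 0 ↔ tangency μ β < x := by
  have : 0 < (2 - μ) / 2 := by linarith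
  rw [Yf_eq hμ, mul_neg_iff_of_pos_left this, sub_neg]

theorem Xf_pos_iff {x : ℝ} : 0 < (foldSaddle lam μ β).Xf x ↔ x < lam := by
  rw [Xf_eq, sub_pos]

theorem Xf_neg_iff {x : ℝ} : (foldSaddle lam μ β).Xf x < 0 ↔ lam < x := by
  rw [Xf_eq, sub_neg]

theorem Xf_eq_zero_iff {x : ℝ} : (foldSaddle lam μ β).Xf x = 0 ↔ x = lam := by
  rw [Xf_eq, sub_eq_zero, eq_comm]

theorem sliding_iff (hμ : μ < 0) {x : ℝ} :
    (foldSaddle lam μ β).Sliding x ↔ lam < x ∧ x < tangency μ β := by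
  rw [NSVF.Sliding, Yf_pos_iff hμ, Xf_neg_iff]

theorem escaping_iff (hμ : μ < 0) {x : ℝ} :
    (foldSaddle lam μ β).Escaping x ↔ x < lam ∧ tangency μ β < x := by
  rw [NSVF.Escaping, Yf_neg_iff hμ, Xf_pos_iff]

theorem sewing_iff (hμ : μ < 0) {x : ℝ} :
    (foldSaddle lam μ β).Sewing x ↔
      (x < lam ∧ x < tangency μ β) ∨ (lam < x ∧ tangency μ β < x) := by
  rw [NSVF.Sewing, mul_pos_iff, Yf_pos_iff hμ, Yf_neg_iff hμ, Xf_pos_iff, Xf_neg_iff]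

theorem setOf_sliding (hμ : μ < 0) :
    {x | (foldSaddle lam μ β).Sliding x} = Ioo lam (tangency μ β) := by
  ext x; simp [sliding_iff hμ]

theorem setOf_escaping (hμ : μ < 0) :
    {x | (foldSaddle lam μ β).Escaping x} = Ioo (tangency μ β) lam := by
  ext x; simp [escaping_iff hμ, and_comm]

theorem setOf_sewing (hμ : μ < 0) :
    {x | (foldSaddle lam μ β).Sewing x} = (uIcc lam (tangency μ β))ᶜ := by
  ext x
  simp only [sewing_iff hμ, mem_ofPred_eq, mem_compl_iff, mem_uIcc]
  grind

theorem not_visibleFoldX (x : ℝ) : ¬ (foldSaddle lam μ β).VisibleFoldX x := by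
  rintro ⟨-, h⟩
  rw [Xff_eq] at h
  linarith

theorem invisibleFoldX_iff {x : ℝ} : (foldSaddle lam μ β).InvisibleFoldX x ↔ x = lam := by
  rw [NSVF.InvisibleFoldX, Xff_eq, Xf_eq_zero_iff]
  simp

theorem visibleFoldY_iff (hμ : μ < 0) {x : ℝ} :
    (foldSaddle lam μ β).VisibleFoldY x ↔ β < 0 ∧ x = tangency μ β := by
  rw [NSVF.VisibleFoldY, Yf_eq_zero_iff hμ, and_comm]
  refine and_congr_left ?_
  rintro rfl
  rw [Yff_tangency hμ, mul_neg_iff_of_pos_left (by linarith)]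

theorem invisibleFoldY_iff (hμ : μ < 0) {x : ℝ} :
    (foldSaddle lam μ β).InvisibleFoldY x ↔ 0 < β ∧ x = tangency μ β := by
  rw [NSVF.InvisibleFoldY, Yf_eq_zero_iff hμ, and_comm]
  refine and_congr_left ?_
  rintro rfl
  rw [Yff_tangency hμ, mul_pos_iff_of_pos_left (by linarith)]

theorem eq_of_foldX {x : ℝ} (h : (foldSaddle lam μ β).FoldX x) : x = lam :=
  Xf_eq_zero_iff.1 (h.elim And.left And.left)

theorem eq_of_foldY (hμ : μ < 0) {x : ℝ} (h : (foldSaddle lam μ β).FoldY x) :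
    x = tangency μ β :=
  (Yf_eq_zero_iff hμ).1 (h.elim And.left And.left)

theorem tangency_zero : tangency μ 0 = 0 := by simp [tangency]

theorem tangency_neg (hμ : μ < 0) (hβ : 0 < β) : tangency μ β < 0 :=
  div_neg_of_neg_of_pos (by nlinarith) (by linarith)

theorem tangency_nonneg (hμ : μ < 0) (hβ : β ≤ 0) : 0 ≤ tangency μ β :=
  div_nonneg (by nlinarith) (by linarith)

theorem two_sub_mul_tangency (hμ : μ < 0) : (2 - μ) * tangency μ β = μ * β := by
  have : (2 - μ) ≠ 0 := by linarith
  rw [tangency]; field_simp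

theorem neg_lt_tangency (hμ : μ < 0) (hβ : 0 < β) : -β < tangency μ β := by
  have := two_sub_mul_tangency (β := β) hμ
  nlinarith

/-! ### The Filippov field -/

/-- The numerator of the Filippov field. -/
def slideNum (lam μ β x : ℝ) : ℝ :=
  μ / 2 * x ^ 2 - ((2 - μ) * (1 + β) + lam * μ) / 2 * x + β * (μ + lam * (2 - μ)) / 2

theorem slide_eq (x : ℝ) : (foldSaddle lam μ β).slide x =
    slideNum lam μ β x / ((foldSaddle lam μ β).Yf x - (foldSaddle lam μ β).Xf x) := by
  rw [NSVF.slide]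
  congr 1
  simp only [NSVF.Xf, NSVF.Yf, foldSaddle, slideNum]
  ring

/-- The horizontal component of the lower field is expanded about the tangency point, where it
equals `-2 * (1 - μ) / (2 - μ) * β`. In this form one summand vanishes at the tangency point and the
other at `lam`. -/
theorem slideNum_eq (hμ : μ < 0) (x : ℝ) : slideNum lam μ β x =
    (2 - μ) / 2 * (tangency μ β - x) - (lam - x) *
      (μ / 2 * (x - tangency μ β) - 2 * (1 - μ) / (2 - μ) * β) := by
  have : (2 - μ) ≠ 0 := by linarith
  rw [slideNum, tangency]
  field_simp
  ring

theorem slide_pos (hμ : μ < 0) (hβ : β ≤ 0) (hlam : lam < 1) {x : ℝ}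
    (hx : (foldSaddle lam μ β).Sliding x ∨ (foldSaddle lam μ β).Escaping x) :
    0 < (foldSaddle lam μ β).slide x := by
  have hc : 2 * (1 - μ) / (2 - μ) * β ≤ 0 :=
    mul_nonpos_of_nonneg_of_nonpos (div_nonneg (by linarith) (by linarith)) hβ
  have ht := tangency_nonneg hμ hβ
  rw [slide_eq, slideNum_eq hμ]
  rcases hx with h | h
  · have h' := h
    rw [sliding_iff hμ] at h
    refine div_pos ?_ (by linarith [h'.1, h'.2])
    have h1 : 0 < (2 - μ) / 2 * (tangency μ β - x) := mul_pos (by linarith) (by linarith)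
    have h2 : 0 ≤ μ / 2 * (x - tangency μ β) :=
      mul_nonneg_of_nonpos_of_nonpos (by linarith) (by linarith)
    have h3 := mul_nonneg (sub_nonneg.2 h.1.le) (sub_nonneg.2 (hc.trans h2))
    linarith
  · have h' := h
    rw [escaping_iff hμ] at h
    refine div_pos_of_neg_of_neg ?_ (by linarith [h'.1, h'.2])
    have h3 := mul_nonneg (sub_nonneg.2 h.1.le) (neg_nonneg.2 hc)
    -- This is where `lam < 1` is needed: since `x` lies to the right of the nonnegative tangency
    -- point, `lam - x < 1`, so the second factor exceeds `(2 - μ) / 2 + μ / 2 = 1`.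
    have h4 : 0 < (x - tangency μ β) * ((2 - μ) / 2 + (lam - x) * (μ / 2)) := by
      refine mul_pos (by linarith) ?_
      nlinarith
    nlinarith

/-- A concave parabola is positive exactly between its roots, so `lo` separates them and the larger
one comes before `hi`. As `2 * a < 0`, it is the minus sign before the square root that gives the
larger root. -/
theorem quadratic_sign {a b c lo hi : ℝ} (ha : a < 0) (hlh : lo < hi)
    (hlo : 0 < a * lo ^ 2 - b * lo + c) (hhi : a * hi ^ 2 - b * hi + c < 0) :
    ∃ r' r, r' < lo ∧ lo < r ∧ r < hi ∧ r = (b - √(b ^ 2 - 4 * a * c)) / (2 * a) ∧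
      ∀ x, a * x ^ 2 - b * x + c = a * (x - r') * (x - r) := by
  have hd : 0 < b ^ 2 - 4 * a * c := by nlinarith [sq_nonneg (2 * a * lo - b)]
  have hs := Real.sqrt_pos.2 hd
  have hs2 := Real.sq_sqrt hd.le
  set s := √(b ^ 2 - 4 * a * c)
  have key : ∀ x, a * x ^ 2 - b * x + c = a * (x - (b + s) / (2 * a)) * (x - (b - s) / (2 * a)) := by
    intro x
    have : a ≠ 0 := ha.ne
    field_simp
    nlinarith
  have hr : (b + s) / (2 * a) < (b - s) / (2 * a) :=
    div_lt_div_of_neg_of_lt (by linarith) (by linarith)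
  set r' := (b + s) / (2 * a)
  set r := (b - s) / (2 * a)
  rw [key] at hlo hhi
  have h1 : r' < lo ∧ lo < r := by
    constructor <;> by_contra! h
    · have := mul_nonneg (sub_nonneg.2 h) (sub_nonneg.2 (h.trans hr.le))
      nlinarith
    · have := mul_nonneg (sub_nonneg.2 h) (sub_nonneg.2 (hr.le.trans h))
      nlinarith
  refine ⟨r', r, h1.1, h1.2, ?_, rfl, key⟩
  by_contra! h
  have := mul_nonneg (sub_nonneg.2 h) (sub_nonneg.2 (h1.1.le.trans hlh.le))
  nlinarith

/-- The position of the pseudo equilibrium and the sign of the Filippov field around it. -/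
theorem slideNum_sign (hμ : μ < 0) (hβ : 0 < β) (hne : lam ≠ tangency μ β) :
    min lam (tangency μ β) < pseudoRoot lam μ β ∧ pseudoRoot lam μ β < max lam (tangency μ β) ∧
    (∀ x, min lam (tangency μ β) < x → x < pseudoRoot lam μ β → 0 < slideNum lam μ β x) ∧
    (∀ x, pseudoRoot lam μ β < x → slideNum lam μ β x < 0) ∧
    slideNum lam μ β (pseudoRoot lam μ β) = 0 := by
  have hc : 0 < 2 * (1 - μ) / (2 - μ) * β :=
    mul_pos (div_pos (by linarith) (by linarith)) hβ
  have h2 : 0 < (2 - μ) / 2 := by linarith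
  -- At each of `lam` and the tangency point only one summand of `slideNum_eq` survives, and its
  -- sign is that of `tangency μ β - lam` or of `(lam - tangency μ β) * β`.
  have main : 0 < slideNum lam μ β (min lam (tangency μ β)) ∧
      slideNum lam μ β (max lam (tangency μ β)) < 0 := by
    rcases hne.lt_or_gt with h | h
    · rw [min_eq_left h.le, max_eq_right h.le]
      constructor
      · rw [slideNum_eq hμ]
        have := mul_pos h2 (sub_pos.2 h)
        linarith
      · rw [slideNum_eq hμ]
        have := mul_pos hc (sub_pos.2 h)
        linarith
    · rw [min_eq_right h.le, max_eq_left h.le]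
      constructor
      · rw [slideNum_eq hμ]
        have := mul_pos hc (sub_pos.2 h)
        linarith
      · rw [slideNum_eq hμ]
        have := mul_pos h2 (sub_pos.2 h)
        linarith
  obtain ⟨r', r, h1, h2, h3, h4, h5⟩ := quadratic_sign (a := μ / 2)
    (b := ((2 - μ) * (1 + β) + lam * μ) / 2) (c := β * (μ + lam * (2 - μ)) / 2)
    (by linarith) (min_lt_max.2 hne) main.1 main.2
  have hr : r = pseudoRoot lam μ β := by
    rw [h4, pseudoRoot]
    have e : (((2 - μ) * (1 + β) + lam * μ) / 2) ^ 2 - 4 * (μ / 2) * (β * (μ + lam * (2 - μ)) / 2) =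
      (((2 - μ) * (1 + β) + lam * μ) ^ 2 - 4 * β * μ * (μ + lam * (2 - μ))) / 2 ^ 2 := by ring
    rw [e, Real.sqrt_div' _ (by positivity), Real.sqrt_sq (by norm_num)]
    have := hμ.ne
    field_simp
  rw [← hr]
  refine ⟨h2, h3, fun x hx hx' => ?_, fun x hx => ?_, ?_⟩
  · rw [slideNum, h5]
    have := mul_pos (sub_pos.2 (h1.trans hx)) (sub_pos.2 hx')
    nlinarith
  · rw [slideNum, h5]
    have := mul_pos (sub_pos.2 ((h1.trans h2).trans hx)) (sub_pos.2 hx)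
    nlinarith
  · rw [slideNum, h5]; ring

theorem slide_eq_zero_iff {x : ℝ}
    (hx : (foldSaddle lam μ β).Sliding x ∨ (foldSaddle lam μ β).Escaping x) :
    (foldSaddle lam μ β).slide x = 0 ↔ slideNum lam μ β x = 0 := by
  rw [slide_eq, div_eq_zero_iff, or_iff_left]
  rcases hx with h | h <;> linarith [h.1, h.2]

theorem slideNum_eq_zero (hμ : μ < 0) (hβ : 0 < β) (hne : lam ≠ tangency μ β) {x : ℝ}
    (hx : min lam (tangency μ β) < x) (h : slideNum lam μ β x = 0) : x = pseudoRoot lam μ β := by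
  obtain ⟨-, -, h3, h4, -⟩ := slideNum_sign hμ hβ hne
  rcases lt_trichotomy x (pseudoRoot lam μ β) with h' | h' | h'
  · linarith [h3 x hx h']
  · exact h'
  · linarith [h4 x h']

theorem slide_region_iff (hμ : μ < 0) {x : ℝ} :
    (foldSaddle lam μ β).Sliding x ∨ (foldSaddle lam μ β).Escaping x ↔
      min lam (tangency μ β) < x ∧ x < max lam (tangency μ β) := by
  rw [sliding_iff hμ, escaping_iff hμ]
  grind

theorem setOf_pseudoEq (hμ : μ < 0) (hβ : 0 < β) (hne : lam ≠ tangency μ β) :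
    {x | (foldSaddle lam μ β).PseudoEq x} = {pseudoRoot lam μ β} := by
  obtain ⟨h1, h2, -, -, h5⟩ := slideNum_sign hμ hβ hne
  ext x
  simp only [NSVF.PseudoEq, mem_ofPred_eq, mem_singleton_iff]
  constructor
  · rintro ⟨hx, h⟩
    rw [slide_eq_zero_iff hx] at h
    exact slideNum_eq_zero hμ hβ hne ((slide_region_iff hμ).1 hx).1 h
  · rintro rfl
    have := (slide_region_iff hμ).2 ⟨h1, h2⟩
    exact ⟨this, (slide_eq_zero_iff this).2 h5⟩

theorem pseudoEq_pseudoRoot (hμ : μ < 0) (hβ : 0 < β) (hne : lam ≠ tangency μ β) :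
    (foldSaddle lam μ β).PseudoEq (pseudoRoot lam μ β) := by
  have := setOf_pseudoEq hμ hβ hne
  rw [Set.ext_iff] at this
  exact (this _).2 rfl

theorem eq_pseudoRoot (hμ : μ < 0) (hβ : 0 < β) (hne : lam ≠ tangency μ β) {x : ℝ}
    (hx : (foldSaddle lam μ β).PseudoEq x) : x = pseudoRoot lam μ β := by
  have := setOf_pseudoEq hμ hβ hne
  rw [Set.ext_iff] at this
  exact (this _).1 hx

/-- The numerator always changes from positive to negative at the root. The denominator `Y.f - X.f`
is positive on the sliding region and negative on the escaping region, whence an attractor here and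
a repeller in `repelsLine_pseudoRoot`. -/
theorem attractsLine_pseudoRoot (hμ : μ < 0) (hβ : 0 < β) (h : lam < tangency μ β) :
    NSVF.AttractsLine (foldSaddle lam μ β).slide (pseudoRoot lam μ β) := by
  obtain ⟨h1, h2, h3, h4, h5⟩ := slideNum_sign hμ hβ h.ne
  rw [min_eq_left h.le] at *
  rw [max_eq_right h.le] at *
  refine ⟨(pseudoEq_pseudoRoot hμ hβ h.ne).2, min (pseudoRoot lam μ β - lam)
    (tangency μ β - pseudoRoot lam μ β), lt_min (by linarith) (by linarith), ?_, ?_⟩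
  · intro z hz
    have ha := min_le_left (pseudoRoot lam μ β - lam) (tangency μ β - pseudoRoot lam μ β)
    have hs := (sliding_iff (lam := lam) (β := β) hμ).2 ⟨by linarith [hz.1], hz.2.trans h2⟩
    rw [slide_eq]
    exact div_pos (h3 z (by linarith [hz.1]) hz.2) (by linarith [hs.1, hs.2])
  · intro z hz
    have ha := min_le_right (pseudoRoot lam μ β - lam) (tangency μ β - pseudoRoot lam μ β)
    have hs := (sliding_iff (lam := lam) (β := β) hμ).2 ⟨h1.trans hz.1, by linarith [hz.2]⟩
    rw [slide_eq]
    exact div_neg_of_neg_of_pos (h4 z hz.1) (by linarith [hs.1, hs.2])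

theorem repelsLine_pseudoRoot (hμ : μ < 0) (hβ : 0 < β) (h : tangency μ β < lam) :
    NSVF.RepelsLine (foldSaddle lam μ β).slide (pseudoRoot lam μ β) := by
  obtain ⟨h1, h2, h3, h4, h5⟩ := slideNum_sign hμ hβ h.ne'
  rw [min_eq_right h.le] at *
  rw [max_eq_left h.le] at *
  refine ⟨(pseudoEq_pseudoRoot hμ hβ h.ne').2, min (pseudoRoot lam μ β - tangency μ β)
    (lam - pseudoRoot lam μ β), lt_min (by linarith) (by linarith), ?_, ?_⟩
  · intro z hz
    have ha := min_le_left (pseudoRoot lam μ β - tangency μ β) (lam - pseudoRoot lam μ β)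
    have hs := (escaping_iff (lam := lam) (β := β) hμ).2 ⟨hz.2.trans h2, by linarith [hz.1]⟩
    rw [slide_eq]
    exact div_neg_of_pos_of_neg (h3 z (by linarith [hz.1]) hz.2) (by linarith [hs.1, hs.2])
  · intro z hz
    have ha := min_le_right (pseudoRoot lam μ β - tangency μ β) (lam - pseudoRoot lam μ β)
    have hs := (escaping_iff (lam := lam) (β := β) hμ).2 ⟨by linarith [hz.2], h1.trans hz.1⟩
    rw [slide_eq]
    exact div_pos_of_neg_of_neg (h4 z hz.1) (by linarith [hs.1, hs.2])

theorem not_attractsLine_of_repelsLine {g : ℝ → ℝ} {x : ℝ} (h : NSVF.RepelsLine g x) :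
    ¬ NSVF.AttractsLine g x := by
  rintro ⟨-, δ, hδ, h1, -⟩
  obtain ⟨-, ε, hε, h2, -⟩ := h
  have hm : 0 < min δ ε := lt_min hδ hε
  have := h1 (x - min δ ε / 2) ⟨by linarith [min_le_left δ ε], by linarith⟩
  have := h2 (x - min δ ε / 2) ⟨by linarith [min_le_right δ ε], by linarith⟩
  linarith

theorem setOf_sigmaAttractor_of_lt (hμ : μ < 0) (hβ : 0 < β) (h : lam < tangency μ β) :
    {x | (foldSaddle lam μ β).SigmaAttractor x} = {pseudoRoot lam μ β} := by
  ext x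
  constructor
  · rintro ⟨h1, h2⟩
    exact eq_pseudoRoot hμ hβ h.ne ⟨Or.inl h1, h2.1⟩
  · rintro rfl
    refine ⟨?_, attractsLine_pseudoRoot hμ hβ h⟩
    rcases (pseudoEq_pseudoRoot hμ hβ h.ne).1 with h' | h'
    · exact h'
    · rw [escaping_iff hμ] at h'; linarith

theorem setOf_sigmaAttractor_of_ge (hμ : μ < 0) (h : tangency μ β ≤ lam) :
    {x | (foldSaddle lam μ β).SigmaAttractor x} = ∅ := by
  refine eq_empty_of_forall_notMem fun x ⟨h1, _⟩ => ?_
  rw [sliding_iff hμ] at h1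
  linarith

theorem setOf_sigmaRepeller_of_gt (hμ : μ < 0) (hβ : 0 < β) (h : tangency μ β < lam) :
    {x | (foldSaddle lam μ β).SigmaRepeller x} = {pseudoRoot lam μ β} := by
  ext x
  constructor
  · rintro ⟨h1, h2⟩
    exact eq_pseudoRoot hμ hβ h.ne' ⟨Or.inr h1, h2.1⟩
  · rintro rfl
    refine ⟨?_, repelsLine_pseudoRoot hμ hβ h⟩
    rcases (pseudoEq_pseudoRoot hμ hβ h.ne').1 with h' | h'
    · rw [sliding_iff hμ] at h'; linarith
    · exact h'

theorem setOf_sigmaRepeller_of_le (hμ : μ < 0) (h : lam ≤ tangency μ β) :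
    {x | (foldSaddle lam μ β).SigmaRepeller x} = ∅ := by
  refine eq_empty_of_forall_notMem fun x ⟨h1, _⟩ => ?_
  rw [escaping_iff hμ] at h1
  linarith

theorem setOf_sigmaSaddle (hμ : μ < 0) (hβ : 0 < β) :
    {x | (foldSaddle lam μ β).SigmaSaddle x} = ∅ := by
  refine eq_empty_of_forall_notMem fun x hx => ?_
  rcases hx with ⟨h1, h2⟩ | ⟨h1, h2⟩
  · have h1' := (escaping_iff hμ).1 h1
    have h : tangency μ β < lam := by linarith
    have := eq_pseudoRoot hμ hβ h.ne' ⟨Or.inr h1, h2.1⟩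
    subst this
    exact not_attractsLine_of_repelsLine (repelsLine_pseudoRoot hμ hβ h) h2
  · have h1' := (sliding_iff hμ).1 h1
    have h : lam < tangency μ β := by linarith
    have := eq_pseudoRoot hμ hβ h.ne ⟨Or.inl h1, h2.1⟩
    subst this
    exact not_attractsLine_of_repelsLine h2 (attractsLine_pseudoRoot hμ hβ h)

theorem not_pseudoEq (hμ : μ < 0) (hβ : β ≤ 0) (hlam : lam < 1) (x : ℝ) :
    ¬ (foldSaddle lam μ β).PseudoEq x := fun h => (slide_pos hμ hβ hlam h.1).ne' h.2

theorem setOf_sigmaAttractor_of_nonpos (hμ : μ < 0) (hβ : β ≤ 0) (hlam : lam < 1) :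
    {x | (foldSaddle lam μ β).SigmaAttractor x} = ∅ :=
  eq_empty_of_forall_notMem fun x ⟨h1, h2⟩ => not_pseudoEq hμ hβ hlam x ⟨Or.inl h1, h2.1⟩

theorem setOf_sigmaRepeller_of_nonpos (hμ : μ < 0) (hβ : β ≤ 0) (hlam : lam < 1) :
    {x | (foldSaddle lam μ β).SigmaRepeller x} = ∅ :=
  eq_empty_of_forall_notMem fun x ⟨h1, h2⟩ => not_pseudoEq hμ hβ hlam x ⟨Or.inr h1, h2.1⟩

theorem setOf_sigmaSaddle_of_nonpos (hμ : μ < 0) (hβ : β ≤ 0) (hlam : lam < 1) :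
    {x | (foldSaddle lam μ β).SigmaSaddle x} = ∅ := by
  refine eq_empty_of_forall_notMem fun x hx => not_pseudoEq hμ hβ hlam x ?_
  rcases hx with ⟨h1, h2⟩ | ⟨h1, h2⟩
  · exact ⟨Or.inr h1, h2.1⟩
  · exact ⟨Or.inl h1, h2.1⟩

/-! ### Equilibria -/

theorem X_ne_zero (p : ℝ × ℝ) : (foldSaddle lam μ β).X p ≠ 0 := by
  intro h
  have := congrArg Prod.fst h
  simp [foldSaddle] at this

theorem Y_eq_zero_iff (hμ : μ < 0) {p : ℝ × ℝ} :
    (foldSaddle lam μ β).Y p = 0 ↔ p = (0, -β) := by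
  constructor
  · intro h
    have h1 : μ / 2 * p.1 + (μ - 2) / 2 * (p.2 + β) = 0 := congrArg Prod.fst h
    have h2 : (μ - 2) / 2 * p.1 + μ / 2 * (p.2 + β) = 0 := congrArg Prod.snd h
    have h3 : (1 - μ) * (p.1 + (p.2 + β)) = 0 := by linarith
    have h4 : p.1 = p.2 + β := by linarith
    have h5 := (mul_eq_zero.1 h3).resolve_left (by linarith)
    ext <;> simp <;> linarith
  · rintro rfl
    simp [foldSaddle]

theorem isSaddle_Y_iff (hμ : μ < 0) {p : ℝ × ℝ} :
    NSVF.IsSaddle (foldSaddle lam μ β).Y p ↔ p = (0, -β) := by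
  constructor
  · exact fun h => (Y_eq_zero_iff hμ).1 h.1
  · intro h
    refine ⟨(Y_eq_zero_iff hμ).2 h, μ - 1, by linarith, 1, one_pos, ?_, ?_⟩ <;>
      rw [(hasFDerivAt_Y p).fderiv]
    -- The matrix is symmetric with equal diagonal entries, so the two diagonals are its
    -- eigendirections.
    · refine Module.End.hasEigenvalue_of_hasEigenvector (x := ((1, 1) : ℝ × ℝ))
        ⟨Module.End.mem_eigenspace_iff.2 ?_, by simp⟩
      rw [ContinuousLinearMap.coe_coe, linearPart_apply]
      ext <;> simp <;> ring
    · refine Module.End.hasEigenvalue_of_hasEigenvector (x := ((1, -1) : ℝ × ℝ))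
        ⟨Module.End.mem_eigenspace_iff.2 ?_, by simp⟩
      rw [ContinuousLinearMap.coe_coe, linearPart_apply]
      ext <;> simp <;> ring

theorem equilibrium_iff (hμ : μ < 0) {p : ℝ × ℝ} :
    (foldSaddle lam μ β).Equilibrium p ↔ 0 < β ∧ p = (0, -β) := by
  simp only [NSVF.Equilibrium, X_ne_zero, and_false, false_or, Y_eq_zero_iff hμ]
  constructor
  · rintro ⟨h, rfl⟩
    exact ⟨by simpa using h, rfl⟩
  · rintro ⟨h, rfl⟩
    exact ⟨by simpa using h, rfl⟩

theorem realSaddle_iff (hμ : μ < 0) {p : ℝ × ℝ} :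
    (foldSaddle lam μ β).RealSaddle p ↔ 0 < β ∧ p = (0, -β) := by
  simp only [NSVF.RealSaddle, isSaddle_Y_iff hμ]
  simp only [NSVF.IsSaddle, X_ne_zero, false_and, and_false, false_or]
  constructor
  · rintro ⟨h, rfl⟩
    exact ⟨by simpa using h, rfl⟩
  · rintro ⟨h, rfl⟩
    exact ⟨by simpa using h, rfl⟩

theorem boundarySaddle_iff (hμ : μ < 0) {p : ℝ × ℝ} :
    (foldSaddle lam μ β).BoundarySaddle p ↔ β = 0 ∧ p = 0 := by
  simp only [NSVF.BoundarySaddle, isSaddle_Y_iff hμ]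
  simp only [NSVF.IsSaddle, X_ne_zero, false_and, false_or]
  constructor
  · rintro ⟨h, rfl⟩
    have : β = 0 := by simpa using h
    subst this
    simp
  · rintro ⟨rfl, rfl⟩
    exact ⟨rfl, by simp [Prod.ext_iff]⟩

/-! ### Explicit solutions -/

/-- The solution of the lower field with coordinates `u`, `v` along the stable and the unstable
direction of the saddle at time `0`. -/
def flowY (μ β u v t : ℝ) : ℝ × ℝ :=
  ((u * Real.exp ((μ - 1) * t) + v * Real.exp t) / 2,
    (u * Real.exp ((μ - 1) * t) - v * Real.exp t) / 2 - β)

/-- The solution of the upper field that starts at `p`. -/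
def flowX (lam : ℝ) (p : ℝ × ℝ) (t : ℝ) : ℝ × ℝ :=
  (p.1 + t, p.2 + (lam - p.1) * t - t ^ 2 / 2)

theorem hasDerivAt_fst_comp {γ : ℝ → ℝ × ℝ} {w : ℝ × ℝ} {s : ℝ} (h : HasDerivAt γ w s) :
    HasDerivAt (fun s => (γ s).1) w.1 s :=
  ((ContinuousLinearMap.fst ℝ ℝ ℝ).hasFDerivAt (x := γ s)).comp_hasDerivAt s h

theorem hasDerivAt_snd_comp {γ : ℝ → ℝ × ℝ} {w : ℝ × ℝ} {s : ℝ} (h : HasDerivAt γ w s) :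
    HasDerivAt (fun s => (γ s).2) w.2 s :=
  ((ContinuousLinearMap.snd ℝ ℝ ℝ).hasFDerivAt (x := γ s)).comp_hasDerivAt s h

theorem hasDerivAt_flowY (u v t : ℝ) :
    HasDerivAt (flowY μ β u v) ((foldSaddle lam μ β).Y (flowY μ β u v t)) t := by
  have h1 : HasDerivAt (fun t => u * Real.exp ((μ - 1) * t))
      (u * (Real.exp ((μ - 1) * t) * ((μ - 1) * 1))) t :=
    (((hasDerivAt_id t).const_mul (μ - 1)).exp).const_mul u
  have h2 : HasDerivAt (fun t => v * Real.exp t) (v * Real.exp t) t :=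
    (Real.hasDerivAt_exp t).const_mul v
  have h := ((h1.add h2).div_const 2).prodMk (((h1.sub h2).div_const 2).sub_const β)
  refine h.congr_deriv ?_
  simp only [foldSaddle, flowY]
  ext <;> simp <;> ring

theorem hasDerivAt_flowX (p : ℝ × ℝ) (t : ℝ) :
    HasDerivAt (flowX lam p) ((foldSaddle lam μ β).X (flowX lam p t)) t := by
  have h1 : HasDerivAt (fun t => p.1 + t) 1 t := (hasDerivAt_id t).const_add p.1
  have h2 : HasDerivAt (fun t => p.2 + (lam - p.1) * t - t ^ 2 / 2)
      ((lam - p.1) * 1 - (2 * t) / 2) t := by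
    have h3 : HasDerivAt (fun t : ℝ => t ^ 2) (2 * t) t := by
      simpa using hasDerivAt_pow 2 t
    exact (((hasDerivAt_id t).const_mul (lam - p.1)).const_add p.2).sub (h3.div_const 2)
  refine (h1.prodMk h2).congr_deriv ?_
  simp only [foldSaddle, flowX]
  ext <;> simp <;> ring

theorem continuous_flowY (u v : ℝ) : Continuous (flowY μ β u v) :=
  continuous_iff_continuousAt.2 fun t => (hasDerivAt_flowY (lam := 0) u v t).continuousAt

theorem continuous_flowX (p : ℝ × ℝ) : Continuous (flowX lam p) :=
  continuous_iff_continuousAt.2 fun t => (hasDerivAt_flowX (μ := 0) (β := 0) p t).continuousAt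

theorem eq_of_hasDerivAt_zero {f : ℝ → ℝ} {a b : ℝ} (hab : a ≤ b) (hc : ContinuousOn f (Icc a b))
    (hd : ∀ s ∈ Ioo a b, HasDerivAt f 0 s) : f b = f a := by
  rcases hab.eq_or_lt with rfl | hab
  · rfl
  obtain ⟨c, hc, h⟩ := exists_hasDerivAt_eq_slope f (fun _ => 0) hab hc hd
  rw [eq_comm, div_eq_zero_iff] at h
  rcases h with h | h <;> linarith

theorem eq_mul_exp_of_hasDerivAt {f : ℝ → ℝ} {a b c : ℝ} (hab : a ≤ b)
    (hc : ContinuousOn f (Icc a b)) (hd : ∀ s ∈ Ioo a b, HasDerivAt f (c * f s) s) :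
    f b = f a * Real.exp (c * (b - a)) := by
  have h := eq_of_hasDerivAt_zero (f := fun s => f s * Real.exp (-(c * (s - a)))) hab
    (hc.mul (by fun_prop)) fun s hs => by
      have h1 : HasDerivAt (fun s => -(c * (s - a))) (-(c * 1)) s :=
        (((hasDerivAt_id s).sub_const a).const_mul c).neg
      refine ((hd s hs).mul h1.exp).congr_deriv ?_
      ring
  simp only [sub_self, mul_zero, neg_zero, Real.exp_zero, mul_one] at h
  rw [← h, mul_assoc, ← Real.exp_add]
  simp

/-- The sums and differences `x ± (y + β)` decouple the system into two scalar equations `f' = c *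
f`. Derivatives are assumed only in the open interval, so that arcs may start and end on the
switching line. -/
theorem eq_flowY {γ : ℝ → ℝ × ℝ} {a b : ℝ} (hab : a ≤ b) (hc : ContinuousOn γ (Icc a b))
    (hd : ∀ s ∈ Ioo a b, HasDerivAt γ ((foldSaddle lam μ β).Y (γ s)) s) :
    γ b = flowY μ β ((γ a).1 + ((γ a).2 + β)) ((γ a).1 - ((γ a).2 + β)) (b - a) := by
  have hc1 : ContinuousOn (fun s => (γ s).1) (Icc a b) := continuous_fst.comp_continuousOn hc
  have hc2 : ContinuousOn (fun s => (γ s).2) (Icc a b) := continuous_snd.comp_continuousOn hc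
  have h1 := eq_mul_exp_of_hasDerivAt (c := μ - 1) (f := fun s => (γ s).1 + ((γ s).2 + β)) hab
    (hc1.add (hc2.add continuousOn_const)) fun s hs => by
      refine ((hasDerivAt_fst_comp (hd s hs)).add ((hasDerivAt_snd_comp (hd s hs)).add_const β)).congr_deriv ?_
      simp only [foldSaddle]; ring
  have h2 := eq_mul_exp_of_hasDerivAt (c := 1) (f := fun s => (γ s).1 - ((γ s).2 + β)) hab
    (hc1.sub (hc2.add continuousOn_const)) fun s hs => by
      refine ((hasDerivAt_fst_comp (hd s hs)).sub ((hasDerivAt_snd_comp (hd s hs)).add_const β)).congr_deriv ?_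
      simp only [foldSaddle]; ring
  rw [one_mul] at h2
  simp only [flowY]
  rw [← h1, ← h2]
  ext <;> simp

/-- Along a solution both `x - t` and `y + (x - lam) ^ 2 / 2` are constant. -/
theorem eq_flowX {γ : ℝ → ℝ × ℝ} {a b : ℝ} (hab : a ≤ b) (hc : ContinuousOn γ (Icc a b))
    (hd : ∀ s ∈ Ioo a b, HasDerivAt γ ((foldSaddle lam μ β).X (γ s)) s) :
    γ b = flowX lam (γ a) (b - a) := by
  have hc1 : ContinuousOn (fun s => (γ s).1) (Icc a b) := continuous_fst.comp_continuousOn hc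
  have hc2 : ContinuousOn (fun s => (γ s).2) (Icc a b) := continuous_snd.comp_continuousOn hc
  have h1 := eq_of_hasDerivAt_zero (f := fun s => (γ s).1 - s) hab
    (hc1.sub continuousOn_id) fun s hs => by
      refine ((hasDerivAt_fst_comp (hd s hs)).sub (hasDerivAt_id s)).congr_deriv ?_
      simp [foldSaddle]
  have h2 := eq_of_hasDerivAt_zero (f := fun s => (γ s).2 + ((γ s).1 - lam) ^ 2 / 2) hab
    (hc2.add (((hc1.sub continuousOn_const).pow 2).div_const 2)) fun s hs => by
      refine ((hasDerivAt_snd_comp (hd s hs)).add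
        ((((hasDerivAt_fst_comp (hd s hs)).sub_const lam).pow 2).div_const 2)).congr_deriv ?_
      simp [foldSaddle]
  have h3 : (γ b).1 = (γ a).1 + (b - a) := by linarith
  simp only [flowX]
  ext
  · exact h3
  · rw [h3] at h2
    simp only
    linarith

/-! ### Arcs of the upper field -/

/-- The arc of the upper field that starts at `(x, 0)`. -/
def arcX (lam x : ℝ) : Set (ℝ × ℝ) := flowX lam (x, 0) '' Icc 0 (2 * (lam - x))

/-- The parabola returns to height `0` when `T * (2 * (lam - x) - T) = 0`. So the duration is `2 *
(lam - x)`, which must be positive, and moving right with unit speed for that long is the reflection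
about the fold. -/
theorem isArcX_iff {x z : ℝ} {C : Set (ℝ × ℝ)} :
    (foldSaddle lam μ β).IsArc .ofX x z C ↔ x < lam ∧ z = 2 * lam - x ∧ C = arcX lam x := by
  constructor
  · rintro ⟨T, hT, γ, hc, h0, hT', rfl, hs⟩
    have key : ∀ t ∈ Icc 0 T, γ t = flowX lam (x, 0) t := by
      intro t ht
      have := eq_flowX (lam := lam) (μ := μ) (β := β) ht.1 (hc.mono (Icc_subset_Icc_right ht.2))
        fun s h => (hs s ⟨h.1, h.2.trans_le ht.2⟩).2
      rwa [h0, sub_zero] at this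
    have h1 := key T ⟨hT.le, le_rfl⟩
    rw [hT'] at h1
    simp only [flowX, Prod.mk.injEq] at h1
    have h2 : T * (2 * (lam - x) - T) = 0 := by linarith [h1.2]
    have h3 := (mul_eq_zero.1 h2).resolve_left hT.ne'
    refine ⟨by linarith, by linarith, ?_⟩
    rw [arcX, show 2 * (lam - x) = T by linarith]
    exact image_congr key
  · rintro ⟨h, rfl, rfl⟩
    refine ⟨2 * (lam - x), by linarith, flowX lam (x, 0), (continuous_flowX _).continuousOn,
      ?_, ?_, rfl, fun t ht => ⟨?_, hasDerivAt_flowX _ _⟩⟩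
    · simp [flowX]
    · simp only [flowX, Prod.mk.injEq]
      constructor <;> ring
    · have : 0 < t * (2 * (lam - x) - t) := mul_pos ht.1 (by linarith [ht.2])
      simp only [flowX]
      linarith

/-! ### The first integral of the lower field on the switching line -/

/-- The first integral of the lower field, restricted to the switching line. -/
def height (μ β x : ℝ) : ℝ := (β + x) * (β - x) ^ (1 - μ)

theorem continuous_height (hμ : μ < 0) : Continuous (height μ β) := by
  unfold height
  refine (by fun_prop : Continuous fun x : ℝ => β + x).mul ?_
  exact (by fun_prop : Continuous fun x : ℝ => β - x).rpow_const fun _ => Or.inr (by linarith)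

theorem hasDerivAt_height {x : ℝ} (hx : x < β) :
    HasDerivAt (height μ β) ((β - x) ^ (-μ) * (μ * β - (2 - μ) * x)) x := by
  have hx' : 0 < β - x := by linarith
  have h1 : HasDerivAt (fun x => β + x) 1 x := (hasDerivAt_id x).const_add β
  have h2 : HasDerivAt (fun x => β - x) (-1) x := (hasDerivAt_id x).const_sub β
  have h3 := h1.mul (h2.rpow_const (p := 1 - μ) (Or.inl hx'.ne'))
  refine h3.congr_deriv ?_
  rw [show 1 - μ - 1 = -μ by ring, show 1 - μ = -μ + 1 by ring, Real.rpow_add_one hx'.ne']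
  ring

/-- The derivative is `(2 - μ) * (β - x) ^ (-μ)` times `tangency μ β - x`: the first integral has
its critical point exactly where the lower field is tangent to the line. -/
theorem height_strictMonoOn (hμ : μ < 0) (hβ : 0 < β) :
    StrictMonoOn (height μ β) (Iic (tangency μ β)) := by
  have ht := tangency_neg hμ hβ
  refine strictMonoOn_of_deriv_pos (convex_Iic _) (continuous_height hμ).continuousOn ?_
  intro x hx
  rw [interior_Iic, mem_Iio] at hx
  rw [(hasDerivAt_height (by linarith)).deriv]
  refine mul_pos (Real.rpow_pos_of_pos (by linarith) _) ?_
  rw [← two_sub_mul_tangency hμ]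
  nlinarith

theorem height_strictAntiOn (hμ : μ < 0) :
    StrictAntiOn (height μ β) (Icc (tangency μ β) β) := by
  refine strictAntiOn_of_deriv_neg (convex_Icc _ _) (continuous_height hμ).continuousOn ?_
  intro x hx
  rw [interior_Icc] at hx
  rw [(hasDerivAt_height hx.2).deriv]
  refine mul_neg_of_pos_of_neg (Real.rpow_pos_of_pos (by linarith [hx.2]) _) ?_
  rw [← two_sub_mul_tangency hμ]
  nlinarith [hx.1]

theorem height_self (hμ : μ < 0) : height μ β β = 0 := by
  rw [height, sub_self, Real.zero_rpow (by linarith), mul_zero]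

theorem height_neg_self : height μ β (-β) = 0 := by simp [height]

theorem height_pos {x : ℝ} (h1 : -β < x) (h2 : x < β) : 0 < height μ β x :=
  mul_pos (by linarith) (Real.rpow_pos_of_pos (by linarith) _)

theorem exists_height_eq (hμ : μ < 0) (hβ : 0 < β) {x : ℝ} (h1 : tangency μ β < x) (h2 : x < β) :
    ∃ z, -β < z ∧ z < tangency μ β ∧ height μ β x = height μ β z := by
  have hn := neg_lt_tangency hμ hβ
  have h3 : height μ β x ∈ Ioo (height μ β (-β)) (height μ β (tangency μ β)) := by
    refine ⟨?_, height_strictAntiOn hμ ⟨le_rfl, by linarith⟩ ⟨h1.le, h2.le⟩ h1⟩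
    rw [height_neg_self]
    exact height_pos (by linarith) h2
  obtain ⟨z, hz, h⟩ := intermediate_value_Ioo hn.le (continuous_height hμ).continuousOn h3
  exact ⟨z, hz.1, hz.2, h.symm⟩

/-! ### Arcs of the lower field -/

/-- The arc of the lower field from `(x, 0)` to `(z, 0)`. -/
def arcY (μ β x z : ℝ) : Set (ℝ × ℝ) :=
  flowY μ β (x + β) (x - β) '' Icc 0 (Real.log ((β - z) / (β - x)))

/-- A strictly convex function that takes the value `d` at `0` and at `T` is below `d` in between.
This decides on which side of the line a solution of the lower field stays. -/
theorem exp_combination_lt {a b c d T t : ℝ} (hc : c ≠ 0) (ha : 0 ≤ a) (hb : 0 ≤ b)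
    (hab : 0 < a + b) (h0 : a + b = d)
    (hT : a * Real.exp (c * T) + b * Real.exp T = d) (ht : t ∈ Ioo 0 T) :
    a * Real.exp (c * t) + b * Real.exp t < d := by
  have hT0 : 0 < T := ht.1.trans ht.2
  have h1 : t / T * T = t := div_mul_cancel₀ _ hT0.ne'
  have hr : 0 < t / T := div_pos ht.1 hT0
  have hr' : 0 < 1 - t / T := sub_pos.2 ((div_lt_one hT0).2 ht.2)
  have e1 := strictConvexOn_exp.2 (mem_univ (0 : ℝ)) (mem_univ (c * T))
    (mul_ne_zero hc hT0.ne').symm hr' hr (by ring)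
  have e2 := strictConvexOn_exp.2 (mem_univ (0 : ℝ)) (mem_univ T) hT0.ne hr' hr (by ring)
  simp only [smul_eq_mul, mul_zero, zero_add, Real.exp_zero, mul_one] at e1 e2
  rw [show t / T * (c * T) = c * t by rw [← h1]; field_simp] at e1
  rw [h1] at e2
  have hd : (1 - t / T) * (a + b) + t / T * (a * Real.exp (c * T) + b * Real.exp T) = d := by
    rw [h0, hT]; ring
  rcases ha.eq_or_lt with rfl | ha'
  · nlinarith
  · nlinarith [mul_lt_mul_of_pos_left e1 ha', mul_le_mul_of_nonneg_left e2.le hb]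

theorem arcY_data {T x z : ℝ} {C : Set (ℝ × ℝ)} {γ : ℝ → ℝ × ℝ} (hT : 0 < T)
    (hc : ContinuousOn γ (Icc 0 T)) (h0 : γ 0 = (x, 0)) (hT' : γ T = (z, 0))
    (hC : C = γ '' Icc 0 T) (hs : ∀ t ∈ Ioo 0 T, (foldSaddle lam μ β).SolvesAt γ t .ofY) :
    z + β = (x + β) * Real.exp ((μ - 1) * T) ∧ z - β = (x - β) * Real.exp T ∧
    C = flowY μ β (x + β) (x - β) '' Icc 0 T ∧
    ∀ t ∈ Ioo 0 T, (x + β) * Real.exp ((μ - 1) * t) - (x - β) * Real.exp t < 2 * β := by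
  have key : ∀ t ∈ Icc 0 T, γ t = flowY μ β (x + β) (x - β) t := by
    intro t ht
    have := eq_flowY (lam := lam) (μ := μ) (β := β) ht.1 (hc.mono (Icc_subset_Icc_right ht.2))
      fun s h => (hs s ⟨h.1, h.2.trans_le ht.2⟩).2
    rwa [h0, sub_zero, zero_add] at this
  have h1 := key T ⟨hT.le, le_rfl⟩
  rw [hT'] at h1
  simp only [flowY, Prod.mk.injEq] at h1
  refine ⟨by linarith, by linarith, hC.trans (image_congr key), fun t ht => ?_⟩
  have h2 := (hs t ht).1
  rw [key t ⟨ht.1.le, ht.2.le⟩, flowY] at h2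
  simp only at h2
  linarith

/-- The flow contracts `x + β` and expands `x - β`. If `x + β > 0` or `x - β < 0`, the two end point
equations order `x` and `z` in opposite ways. In the remaining case `x + β ≤ 0 ≤ x - β` the solution
rests on the line (`β = 0`) or is kept above it by convexity (`β < 0`). -/
theorem not_isArcY (hμ : μ < 0) (hβ : β ≤ 0) {x z : ℝ} {C : Set (ℝ × ℝ)} :
    ¬ (foldSaddle lam μ β).IsArc .ofY x z C := by
  rintro ⟨T, hT, γ, hc, h0, hT', hC, hs⟩
  obtain ⟨h1, h2, -, h4⟩ := arcY_data hT hc h0 hT' hC hs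
  have hE : 1 < Real.exp T := Real.one_lt_exp_iff.2 hT
  have hE' : Real.exp ((μ - 1) * T) < 1 := Real.exp_lt_one_iff.2 (by nlinarith)
  rcases lt_or_ge 0 (x + β) with h | h
  · nlinarith
  rcases lt_or_ge (x - β) 0 with h' | h'
  · nlinarith
  have h5 := h4 (T / 2) ⟨by linarith, by linarith⟩
  rcases hβ.eq_or_lt with rfl | hβ
  · have : x = 0 := by linarith
    subst this
    simp at h5
  · have := exp_combination_lt (a := -(x + β)) (b := x - β) (c := μ - 1) (d := -(2 * β)) (T := T)
      (t := T / 2) (by linarith) (by linarith) h' (by linarith) (by ring) (by linarith)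
      ⟨by linarith, by linarith⟩
    linarith

/-- An arc multiplies `β + x` by `exp ((μ - 1) * T)` and `β - x` by `exp T`. Eliminating `T` gives
equality of heights; conversely the second factor determines `T`, equal heights give the first
relation, and convexity keeps the solution below the line. -/
theorem isArcY_iff (hμ : μ < 0) (hβ : 0 < β) {x z : ℝ} {C : Set (ℝ × ℝ)} :
    (foldSaddle lam μ β).IsArc .ofY x z C ↔ tangency μ β < x ∧ x < β ∧ -β < z ∧
      z < tangency μ β ∧ height μ β x = height μ β z ∧ C = arcY μ β x z := by
  have htan := two_sub_mul_tangency (β := β) hμ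
  constructor
  · rintro ⟨T, hT, γ, hc, h0, hT', hC, hs⟩
    obtain ⟨h1, h2, h3, -⟩ := arcY_data hT hc h0 hT' hC hs
    have hE : 1 < Real.exp T := Real.one_lt_exp_iff.2 hT
    have hE' : Real.exp ((μ - 1) * T) < 1 := Real.exp_lt_one_iff.2 (by nlinarith)
    have hE0 := Real.exp_pos ((μ - 1) * T)
    have hx1 : x < β := by
      by_contra! h
      nlinarith
    have hx2 : -β < x := by
      by_contra! h
      nlinarith
    have hz1 : z < β := by nlinarith
    have hz2 : -β < z := by nlinarith
    -- Both end point equations compute `z - x`. The tangent line bound on the two exponentials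
    -- turns this into `(1 - μ) * (x + β) > β - x`, which says that `x` is beyond the tangency
    -- point.
    have hx3 : tangency μ β < x := by
      have e1 := Real.add_one_lt_exp (x := (μ - 1) * T) (mul_ne_zero (by linarith) hT.ne')
      have e2 := Real.add_one_lt_exp (x := T) hT.ne'
      have : 0 < T * ((1 - μ) * (x + β) - (β - x)) := by
        nlinarith [mul_lt_mul_of_pos_left e1 (show 0 < x + β by linarith),
          mul_lt_mul_of_pos_left e2 (show 0 < β - x by linarith)]
      have := (mul_pos_iff_of_pos_left hT).1 this
      nlinarith
    -- The same estimate in reversed time, starting from `z`.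
    have hz3 : z < tangency μ β := by
      have e1 := Real.add_one_lt_exp (x := -((μ - 1) * T))
        (neg_ne_zero.2 (mul_ne_zero (by linarith) hT.ne'))
      have e2 := Real.add_one_lt_exp (x := -T) (neg_ne_zero.2 hT.ne')
      have h1' : x + β = (z + β) * Real.exp (-((μ - 1) * T)) := by
        rw [h1, mul_assoc, ← Real.exp_add]; simp
      have h2' : x - β = (z - β) * Real.exp (-T) := by
        rw [h2, mul_assoc, ← Real.exp_add]; simp
      have : 0 < T * ((β - z) - (1 - μ) * (z + β)) := by
        nlinarith [mul_lt_mul_of_pos_left e1 (show 0 < z + β by linarith),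
          mul_lt_mul_of_pos_left e2 (show 0 < β - z by linarith)]
      have := (mul_pos_iff_of_pos_left hT).1 this
      nlinarith
    refine ⟨hx3, hx1, hz2, hz3, ?_, ?_⟩
    · rw [height, height, show β - z = (β - x) * Real.exp T by linarith,
        show β + z = (x + β) * Real.exp ((μ - 1) * T) by linarith,
        Real.mul_rpow (by linarith) (Real.exp_pos _).le, ← Real.exp_mul]
      have : Real.exp ((μ - 1) * T) * Real.exp (T * (1 - μ)) = 1 := by
        rw [← Real.exp_add, Real.exp_eq_one_iff]; ring
      linear_combination -((β + x) * (β - x) ^ (1 - μ)) * this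
    · rw [h3, arcY]
      congr 2
      rw [show β - z = Real.exp T * (β - x) by linarith,
        mul_div_cancel_right₀ _ (by linarith), Real.log_exp]
  · rintro ⟨h1, h2, h3, h4, h5, rfl⟩
    set T := Real.log ((β - z) / (β - x)) with hTdef
    have hxp : 0 < β - x := by linarith
    have hzp : 0 < β - z := by linarith
    have hT : 0 < T := Real.log_pos ((one_lt_div hxp).2 (by linarith))
    have hE : Real.exp T = (β - z) / (β - x) := Real.exp_log (div_pos hzp hxp)
    have e1 : z - β = (x - β) * Real.exp T := by
      rw [hE]; field_simp; ring
    have e2 : z + β = (x + β) * Real.exp ((μ - 1) * T) := by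
      rw [height, height, show β - z = (β - x) * Real.exp T by linarith,
        Real.mul_rpow (by linarith) (Real.exp_pos _).le, ← Real.exp_mul] at h5
      have hp := Real.rpow_pos_of_pos hxp (1 - μ)
      have h6 : (β + x) = (β + z) * Real.exp (T * (1 - μ)) := by
        apply mul_right_cancel₀ hp.ne'
        rw [h5]; ring
      rw [add_comm x, h6, mul_assoc, ← Real.exp_add, show T * (1 - μ) + (μ - 1) * T = 0 by ring]
      simp [add_comm]
    refine ⟨T, hT, flowY μ β (x + β) (x - β), (continuous_flowY _ _).continuousOn,
      ?_, ?_, rfl, fun t ht => ⟨?_, hasDerivAt_flowY _ _ _⟩⟩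
    · simp only [flowY, mul_zero, Real.exp_zero]
      ext <;> simp
    · simp only [flowY, ← e1, ← e2]
      ext <;> simp
    · have := exp_combination_lt (a := x + β) (b := β - x) (c := μ - 1) (d := 2 * β) (T := T)
        (t := t) (by linarith) (by linarith [neg_lt_tangency hμ hβ]) hxp.le (by linarith)
        (by ring) (by linarith) ht
      simp only [flowY]
      linarith

/-! ### General facts on arcs -/

theorem mem_arc_iff {Z : NSVF} {k : NSVF.ArcKind} (hk : k = .ofX ∨ k = .ofY) {x z w : ℝ}
    {C : Set (ℝ × ℝ)} (h : Z.IsArc k x z C) : (w, (0 : ℝ)) ∈ C ↔ w = x ∨ w = z := by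
  obtain ⟨T, hT, γ, hc, h0, hT', rfl, hs⟩ := h
  constructor
  · rintro ⟨t, ht, h⟩
    rcases ht.1.eq_or_lt with rfl | h1
    · rw [h0] at h; simp at h; exact Or.inl h.symm
    rcases ht.2.eq_or_lt with rfl | h2
    · rw [hT'] at h; simp at h; exact Or.inr h.symm
    exfalso
    have h3 := hs t ⟨h1, h2⟩
    rcases hk with rfl | rfl
    · have := h3.1; rw [h] at this; simp at this
    · have := h3.1; rw [h] at this; simp at this
  · rintro (rfl | rfl)
    · exact ⟨0, ⟨le_rfl, hT.le⟩, h0⟩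
    · exact ⟨T, ⟨hT.le, le_rfl⟩, hT'⟩

theorem isCompact_of_isArc {Z : NSVF} {k : NSVF.ArcKind} {x z : ℝ} {C : Set (ℝ × ℝ)}
    (h : Z.IsArc k x z C) : IsCompact C := by
  obtain ⟨T, hT, γ, hc, h0, hT', rfl, hs⟩ := h
  exact isCompact_Icc.image_of_continuousOn hc

theorem isArc_reverse {Z : NSVF} {k : NSVF.ArcKind} (hk : k = .ofX ∨ k = .ofY) {x z : ℝ}
    {C : Set (ℝ × ℝ)} (h : Z.reverse.IsArc k x z C) : Z.IsArc k z x C := by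
  obtain ⟨T, hT, γ, hc, h0, hT', rfl, hs⟩ := h
  refine ⟨T, hT, fun t => γ (T - t), ?_, by simpa using hT', by simpa using h0, ?_, ?_⟩
  · exact hc.comp (by fun_prop) fun t ht => ⟨by linarith [ht.2], by linarith [ht.1]⟩
  · ext p
    constructor
    · rintro ⟨t, ht, rfl⟩
      exact ⟨T - t, ⟨by linarith [ht.2], by linarith [ht.1]⟩, by simp⟩
    · rintro ⟨t, ht, rfl⟩
      exact ⟨T - t, ⟨by linarith [ht.2], by linarith [ht.1]⟩, by simp⟩
  · intro t ht
    have h1 : HasDerivAt (fun t => T - t) (-1) t := (hasDerivAt_id t).const_sub T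
    have h2 := hs (T - t) ⟨by linarith [ht.2], by linarith [ht.1]⟩
    rcases hk with rfl | rfl
    · refine ⟨h2.1, ?_⟩
      refine (HasDerivAt.scomp t h2.2 h1).congr_deriv ?_
      simp [NSVF.reverse]
    · refine ⟨h2.1, ?_⟩
      refine (HasDerivAt.scomp t h2.2 h1).congr_deriv ?_
      simp [NSVF.reverse]

/-! ### Separatrices -/

theorem flowY_isSolution_of_nonneg {γ : ℝ → ℝ × ℝ} {a : ℝ} (hc : ContinuousOn γ (Ici a))
    (hs : ∀ t > a, HasDerivAt γ ((foldSaddle lam μ β).Y (γ t)) t) {t : ℝ} (ht : a ≤ t) :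
    γ t = flowY μ β ((γ a).1 + ((γ a).2 + β)) ((γ a).1 - ((γ a).2 + β)) (t - a) :=
  eq_flowY ht (hc.mono Icc_subset_Ici_self) fun s h => hs s h.1

theorem flowY_isSolution_of_nonpos {γ : ℝ → ℝ × ℝ} {a : ℝ} (hc : ContinuousOn γ (Iic a))
    (hs : ∀ t < a, HasDerivAt γ ((foldSaddle lam μ β).Y (γ t)) t) {t : ℝ} (ht : t ≤ a) :
    γ t = flowY μ β ((γ a).1 + ((γ a).2 + β)) ((γ a).1 - ((γ a).2 + β)) (t - a) := by
  have h := eq_flowY ht (hc.mono Icc_subset_Iic_self) fun s h => hs s h.2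
  rw [flowY] at h
  have h1 := congrArg Prod.fst h
  have h2 := congrArg Prod.snd h
  simp only at h1 h2
  -- `eq_flowY` only runs forward, from `t` to `a`; its two scalar relations are inverted to express
  -- `γ t` by `γ a`.
  have h3 : (γ a).1 + ((γ a).2 + β) =
    ((γ t).1 + ((γ t).2 + β)) * Real.exp ((μ - 1) * (a - t)) := by linarith
  have h4 : (γ a).1 - ((γ a).2 + β) =
    ((γ t).1 - ((γ t).2 + β)) * Real.exp (a - t) := by linarith
  rw [flowY, h3, h4, mul_assoc, mul_assoc, ← Real.exp_add, ← Real.exp_add,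
    show (μ - 1) * (a - t) + (μ - 1) * (t - a) = 0 by ring, show a - t + (t - a) = 0 by ring]
  ext <;> simp

/-- A solution of the lower field that tends to the saddle as `t → ∞` lies on the stable
separatrix. -/
theorem eq_zero_of_tendsto_atTop {γ : ℝ → ℝ × ℝ} {u v a : ℝ}
    (h : ∀ t ≥ a, γ t = flowY μ β u v (t - a)) (hl : Tendsto γ atTop (𝓝 (0, -β))) : v = 0 := by
  have h1 : Tendsto (fun t => ((γ t).1 - ((γ t).2 + β)) * Real.exp (-(t - a))) atTop (𝓝 0) := by
    have e1 : Tendsto (fun t => (γ t).1 - ((γ t).2 + β)) atTop (𝓝 (0 - (-β + β))) :=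
      ((continuous_fst.tendsto _).comp hl).sub
        (((continuous_snd.tendsto _).comp hl).add tendsto_const_nhds)
    have e2 : Tendsto (fun t => Real.exp (-(t - a))) atTop (𝓝 0) :=
      Real.tendsto_exp_neg_atTop_nhds_zero.comp (tendsto_atTop_add_const_right _ (-a) tendsto_id)
    simpa using e1.mul e2
  have h2 : Tendsto (fun t => ((γ t).1 - ((γ t).2 + β)) * Real.exp (-(t - a))) atTop (𝓝 v) := by
    refine tendsto_const_nhds.congr' ?_
    filter_upwards [eventually_ge_atTop a] with t ht
    rw [h t ht, flowY]
    have : Real.exp (t - a) * Real.exp (-(t - a)) = 1 := by rw [← Real.exp_add]; simp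
    simp only
    linear_combination -v * this
  exact tendsto_nhds_unique h2 h1

/-- Multiplying `x + (y + β)` by `exp ((1 - μ) * (t - a))` recovers the constant `u`, while
convergence to the saddle forces the product to `0` as `t → -∞`. -/
theorem eq_zero_of_tendsto_atBot (hμ : μ < 0) {γ : ℝ → ℝ × ℝ} {u v a : ℝ}
    (h : ∀ t ≤ a, γ t = flowY μ β u v (t - a)) (hl : Tendsto γ atBot (𝓝 (0, -β))) : u = 0 := by
  have h1 : Tendsto (fun t => ((γ t).1 + ((γ t).2 + β)) * Real.exp ((1 - μ) * (t - a))) atBot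
      (𝓝 0) := by
    have e1 : Tendsto (fun t => (γ t).1 + ((γ t).2 + β)) atBot (𝓝 (0 + (-β + β))) :=
      ((continuous_fst.tendsto _).comp hl).add
        (((continuous_snd.tendsto _).comp hl).add tendsto_const_nhds)
    have e2 : Tendsto (fun t => Real.exp ((1 - μ) * (t - a))) atBot (𝓝 0) :=
      Real.tendsto_exp_atBot.comp ((tendsto_atBot_add_const_right _ (-a)
        tendsto_id).const_mul_atBot (by linarith))
    simpa using e1.mul e2
  have h2 : Tendsto (fun t => ((γ t).1 + ((γ t).2 + β)) * Real.exp ((1 - μ) * (t - a))) atBot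
      (𝓝 u) := by
    refine tendsto_const_nhds.congr' ?_
    filter_upwards [eventually_le_atBot a] with t ht
    rw [h t ht, flowY]
    have : Real.exp ((μ - 1) * (t - a)) * Real.exp ((1 - μ) * (t - a)) = 1 := by
      rw [← Real.exp_add, Real.exp_eq_one_iff]; ring
    simp only
    linear_combination -u * this
  exact tendsto_nhds_unique h2 h1

theorem tendsto_flowY_atBot (v : ℝ) : Tendsto (flowY μ β 0 v) atBot (𝓝 (0, -β)) := by
  have h : Tendsto (fun t => v * Real.exp t) atBot (𝓝 (v * 0)) :=
    tendsto_const_nhds.mul Real.tendsto_exp_atBot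
  have h2 := ((tendsto_const_nhds (x := (0 : ℝ))).add h).div_const 2
  have h3 := (((tendsto_const_nhds (x := (0 : ℝ))).sub h).div_const 2).sub_const β
  convert h2.prodMk_nhds h3 using 2
  · simp [flowY]
  · simp

theorem tendsto_flowY_atTop (hμ : μ < 0) (u : ℝ) : Tendsto (flowY μ β u 0) atTop (𝓝 (0, -β)) := by
  have h : Tendsto (fun t => u * Real.exp ((μ - 1) * t)) atTop (𝓝 (u * 0)) :=
    tendsto_const_nhds.mul
      (Real.tendsto_exp_atBot.comp (tendsto_id.const_mul_atTop_of_neg (by linarith)))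
  have h2 := (h.add (tendsto_const_nhds (x := (0 : ℝ)))).div_const 2
  have h3 := ((h.sub (tendsto_const_nhds (x := (0 : ℝ)))).div_const 2).sub_const β
  convert h2.prodMk_nhds h3 using 2
  · simp [flowY]
  · simp

theorem unstableHit_iff (hμ : μ < 0) (hβ : 0 < β) {x : ℝ} :
    (foldSaddle lam μ β).UnstableHit (0, -β) x ↔ x = -β := by
  constructor
  · rintro ⟨γ, hc, h0, hl, hs⟩
    have := eq_zero_of_tendsto_atBot hμ
      (fun t ht => flowY_isSolution_of_nonpos hc (fun t ht => (hs t ht).2) ht) hl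
    rw [h0] at this
    simp at this
    linarith
  · rintro rfl
    refine ⟨flowY μ β 0 (-(2 * β)), (continuous_flowY _ _).continuousOn, ?_,
      tendsto_flowY_atBot _, fun t ht => ⟨?_, hasDerivAt_flowY _ _ _⟩⟩
    · simp only [flowY, Real.exp_zero]
      ext <;> simp
      ring
    · have : Real.exp t < 1 := Real.exp_lt_one_iff.2 ht
      simp only [flowY]
      nlinarith

theorem stableHit_iff (hμ : μ < 0) (hβ : 0 < β) {x : ℝ} :
    (foldSaddle lam μ β).StableHit (0, -β) x ↔ x = β := by
  constructor
  · rintro ⟨γ, hc, h0, hl, hs⟩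
    have := eq_zero_of_tendsto_atTop
      (fun t ht => flowY_isSolution_of_nonneg hc (fun t ht => (hs t ht).2) ht) hl
    rw [h0] at this
    simp at this
    linarith
  · rintro rfl
    refine ⟨flowY μ x (2 * x) 0, (continuous_flowY _ _).continuousOn, ?_,
      tendsto_flowY_atTop hμ _, fun t ht => ⟨?_, hasDerivAt_flowY _ _ _⟩⟩
    · simp only [flowY, mul_zero, Real.exp_zero]
      ext <;> simp
    · have : Real.exp ((μ - 1) * t) < 1 := Real.exp_lt_one_iff.2 (by nlinarith [show (0 : ℝ) < t from ht])
      simp only [flowY]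
      nlinarith

/-! ### Comparison of the first integral at the end points of an arc of the upper field -/

/-- The difference of the logarithms of the first integral at `lam + s` and `lam - s`, where
`a = β + lam` and `b = β - lam`. -/
def logGap (μ a b s : ℝ) : ℝ :=
  Real.log (a + s) + (1 - μ) * Real.log (b - s) - (Real.log (a - s) + (1 - μ) * Real.log (b + s))

/-- The numerator of the derivative of `logGap`. -/
def gapNum (μ a b s : ℝ) : ℝ := a * (b ^ 2 - s ^ 2) - (1 - μ) * b * (a ^ 2 - s ^ 2)

theorem hasDerivAt_logGap {a b s : ℝ} (h0 : 0 ≤ s) (ha : s < a) (hb : s < b) :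
    HasDerivAt (logGap μ a b) (2 / ((a ^ 2 - s ^ 2) * (b ^ 2 - s ^ 2)) * gapNum μ a b s) s := by
  have h1 : a + s ≠ 0 := by linarith
  have h2 : b - s ≠ 0 := by linarith
  have h3 : a - s ≠ 0 := by linarith
  have h4 : b + s ≠ 0 := by linarith
  have e1 := ((hasDerivAt_id s).const_add a).log h1
  have e2 := (((hasDerivAt_id s).const_sub b).log h2).const_mul (1 - μ)
  have e3 := ((hasDerivAt_id s).const_sub a).log h3
  have e4 := (((hasDerivAt_id s).const_add b).log h4).const_mul (1 - μ)
  refine ((e1.add e2).sub (e3.add e4)).congr_deriv ?_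
  simp only [gapNum, id]
  rw [show a ^ 2 - s ^ 2 = (a + s) * (a - s) by ring,
    show b ^ 2 - s ^ 2 = (b + s) * (b - s) by ring]
  field_simp
  ring

theorem logGap_zero {a b : ℝ} : logGap μ a b 0 = 0 := by simp [logGap]

theorem gap_denom_pos {a s : ℝ} (h0 : 0 ≤ s) (ha : s < a) : 0 < a ^ 2 - s ^ 2 := by nlinarith

theorem logGap_strictMonoOn {a b c d : ℝ} (h0 : 0 ≤ c) (ha : d < a) (hb : d < b)
    (h : ∀ s ∈ Ioo c d, 0 < gapNum μ a b s) : StrictMonoOn (logGap μ a b) (Icc c d) := by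
  refine strictMonoOn_of_deriv_pos (convex_Icc _ _) ?_ ?_
  · exact fun s hs => (hasDerivAt_logGap (h0.trans hs.1) (hs.2.trans_lt ha)
      (hs.2.trans_lt hb)).continuousAt.continuousWithinAt
  · intro s hs
    rw [interior_Icc] at hs
    have h0' := h0.trans hs.1.le
    rw [(hasDerivAt_logGap h0' (hs.2.trans ha) (hs.2.trans hb)).deriv]
    exact mul_pos (div_pos two_pos (mul_pos (gap_denom_pos h0' (hs.2.trans ha))
      (gap_denom_pos h0' (hs.2.trans hb)))) (h s hs)

theorem logGap_strictAntiOn {a b c d : ℝ} (h0 : 0 ≤ c) (ha : d < a) (hb : d < b)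
    (h : ∀ s ∈ Ioo c d, gapNum μ a b s < 0) : StrictAntiOn (logGap μ a b) (Icc c d) := by
  refine strictAntiOn_of_deriv_neg (convex_Icc _ _) ?_ ?_
  · exact fun s hs => (hasDerivAt_logGap (h0.trans hs.1) (hs.2.trans_lt ha)
      (hs.2.trans_lt hb)).continuousAt.continuousWithinAt
  · intro s hs
    rw [interior_Icc] at hs
    have h0' := h0.trans hs.1.le
    rw [(hasDerivAt_logGap h0' (hs.2.trans ha) (hs.2.trans hb)).deriv]
    exact mul_neg_of_pos_of_neg (div_pos two_pos (mul_pos (gap_denom_pos h0' (hs.2.trans ha))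
      (gap_denom_pos h0' (hs.2.trans hb)))) (h s hs)

theorem logGap_pos {a b s : ℝ} (h0 : 0 < s) (ha : s < a) (hb : s < b)
    (h : ∀ r ∈ Ioo 0 s, 0 < gapNum μ a b r) : 0 < logGap μ a b s := by
  rw [← logGap_zero (μ := μ) (a := a) (b := b)]
  exact logGap_strictMonoOn le_rfl ha hb h ⟨le_rfl, h0.le⟩ ⟨h0.le, le_rfl⟩ h0

theorem logGap_neg {a b s : ℝ} (h0 : 0 < s) (ha : s < a) (hb : s < b)
    (h : ∀ r ∈ Ioo 0 s, gapNum μ a b r < 0) : logGap μ a b s < 0 := by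
  rw [← logGap_zero (μ := μ) (a := a) (b := b)]
  exact logGap_strictAntiOn le_rfl ha hb h ⟨le_rfl, h0.le⟩ ⟨h0.le, le_rfl⟩ h0

theorem log_height {x : ℝ} (h1 : -β < x) (h2 : x < β) :
    Real.log (height μ β x) = Real.log (β + x) + (1 - μ) * Real.log (β - x) := by
  have h2' : 0 < β - x := by linarith
  rw [height, Real.log_mul (by linarith) (Real.rpow_pos_of_pos h2' _).ne', Real.log_rpow h2']

theorem logGap_eq {s : ℝ} (h0 : 0 ≤ s) (ha : s < β + lam) (hb : s < β - lam) :
    logGap μ (β + lam) (β - lam) s =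
      Real.log (height μ β (lam + s)) - Real.log (height μ β (lam - s)) := by
  rw [log_height (by linarith) (by linarith), log_height (by linarith) (by linarith), logGap,
    show β + (lam + s) = β + lam + s by ring, show β - (lam + s) = β - lam - s by ring,
    show β + (lam - s) = β + lam - s by ring, show β - (lam - s) = β - lam + s by ring]

theorem logGap_pos_iff {s : ℝ} (h0 : 0 ≤ s) (ha : s < β + lam) (hb : s < β - lam) :
    0 < logGap μ (β + lam) (β - lam) s ↔ height μ β (lam - s) < height μ β (lam + s) := by
  rw [logGap_eq h0 ha hb, sub_pos, Real.log_lt_log_iff] <;>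
    exact height_pos (by linarith) (by linarith)

theorem logGap_neg_iff {s : ℝ} (h0 : 0 ≤ s) (ha : s < β + lam) (hb : s < β - lam) :
    logGap μ (β + lam) (β - lam) s < 0 ↔ height μ β (lam + s) < height μ β (lam - s) := by
  rw [logGap_eq h0 ha hb, sub_neg, Real.log_lt_log_iff] <;>
    exact height_pos (by linarith) (by linarith)

theorem height_nonpos {x : ℝ} (h : x ≤ -β) (hβ : 0 < β) : height μ β x ≤ 0 :=
  mul_nonpos_of_nonpos_of_nonneg (by linarith) (Real.rpow_nonneg (by linarith) _)

/-- With `a = β + lam` and `b = β - lam`, `gapNum` is `a * b * (b - (1 - μ) * a) + r ^ 2 * ((1 - μ)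
* b - a)`, and `(1 - μ) * a ≤ b` is equivalent to `lam ≤ tangency μ β`. Once `lam - s ≤ -β`, the
left height is nonpositive and the claim is immediate. -/
theorem height_lt_of_le_tangency (hμ : μ < 0) (hβ : 0 < β) (hlam : lam ≤ tangency μ β)
    (hlam' : -β < lam) {s : ℝ} (h0 : 0 < s) (hb : s < β - lam) :
    height μ β (lam - s) < height μ β (lam + s) := by
  have ht := tangency_neg hμ hβ
  rcases lt_or_ge s (β + lam) with ha | ha
  · refine (logGap_pos_iff h0.le ha hb).1 (logGap_pos h0 ha hb fun r hr => ?_)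
    have htan := two_sub_mul_tangency (β := β) hμ
    have h1 : (1 - μ) * (β + lam) ≤ β - lam := by nlinarith
    rw [gapNum]
    have ha0 : 0 < β + lam := by linarith
    have hb0 : 0 < β - lam := by linarith
    have h2 : 0 < (1 - μ) * (β - lam) - (β + lam) := by nlinarith
    have h3 : 0 ≤ (β + lam) * (β - lam) * ((β - lam) - (1 - μ) * (β + lam)) :=
      mul_nonneg (mul_pos ha0 hb0).le (by linarith)
    have h4 : 0 < r ^ 2 * ((1 - μ) * (β - lam) - (β + lam)) := mul_pos (pow_pos hr.1 2) h2
    linarith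
  · exact (height_nonpos (by linarith) hβ).trans_lt (height_pos (by linarith) (by linarith))

/-- For `lam ≥ 0` one has `a ≥ b`, and `b * (a ^ 2 - r ^ 2) - a * (b ^ 2 - r ^ 2) = (a - b) * (a * b
+ r ^ 2)`. This already gives a weak inequality at `μ = 0`; the factor `1 - μ > 1` makes it strict.
-/
theorem height_lt_of_nonneg (hμ : μ < 0) (hlam : 0 ≤ lam) {s : ℝ}
    (h0 : 0 < s) (hb : s < β - lam) : height μ β (lam + s) < height μ β (lam - s) := by
  have ha : s < β + lam := by linarith
  refine (logGap_neg_iff h0.le ha hb).1 (logGap_neg h0 ha hb fun r hr => ?_)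
  rw [gapNum]
  have hb0 : 0 < β - lam := by linarith
  have hr0 := hr.1
  have hrb : r < β - lam := hr.2.trans hb
  have hra : r < β + lam := by linarith
  have h1 : (β + lam) * ((β - lam) ^ 2 - r ^ 2) ≤ (β - lam) * ((β + lam) ^ 2 - r ^ 2) := by
    have : 0 ≤ 2 * lam * ((β + lam) * (β - lam) + r ^ 2) := by
      have : 0 < (β + lam) * (β - lam) := mul_pos (by linarith) hb0
      positivity
    linarith
  have h2 : 0 < (-μ) * ((β - lam) * ((β + lam) ^ 2 - r ^ 2)) :=
    mul_pos (by linarith) (mul_pos hb0 (gap_denom_pos hr0.le hra))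
  linarith

/-- The coefficient of `s ^ 2` is `(1 - μ) * b - a > 0`. Hence `gapNum` changes sign at most once,
from negative to positive, which is why there is only one cycle. -/
theorem gapNum_strictMono {a b : ℝ} (hμ : μ < 0) (ha : 0 < a) (hab : a < b) {r s : ℝ}
    (hr : 0 ≤ r) (hrs : r < s) : gapNum μ a b r < gapNum μ a b s := by
  rw [gapNum, gapNum]
  have h1 : 0 < (1 - μ) * b - a := by nlinarith
  have h2 : r ^ 2 < s ^ 2 := by nlinarith
  nlinarith

/-- For `lam` between the tangency point and `0` the end points of exactly one arc of the upper
field are at the same height, and the heights compare in opposite ways on both sides. -/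
theorem exists_cycle_radius (hμ : μ < 0) (hβ : 0 < β) (h1 : tangency μ β < lam) (h2 : lam < 0) :
    ∃ r, 0 < r ∧ r < β + lam ∧ height μ β (lam + r) = height μ β (lam - r) ∧
      lam - r < tangency μ β ∧
      (∀ s, 0 < s → s < r → height μ β (lam + s) < height μ β (lam - s)) ∧
      ∀ s, r < s → s < β - lam → height μ β (lam - s) < height μ β (lam + s) := by
  have hn := neg_lt_tangency hμ hβ
  have ha : 0 < β + lam := by linarith
  have hc : Continuous fun s => height μ β (lam + s) - height μ β (lam - s) :=
    ((continuous_height hμ).comp (by fun_prop)).sub ((continuous_height hμ).comp (by fun_prop))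
  have hA : ∀ s, 0 < s → s ≤ lam - tangency μ β → s < β + lam →
      height μ β (lam + s) < height μ β (lam - s) := fun s hs hs' hs'' =>
    height_strictAntiOn hμ ⟨by linarith, by linarith⟩ ⟨by linarith, by linarith⟩ (by linarith)
  -- With this radius both end points are on the decreasing branch of `height`, so the difference of
  -- heights starts out negative; at radius `β + lam` the left end point is `-β`, of height `0`, and
  -- the difference is positive.
  set m := min (lam - tangency μ β) ((β + lam) / 2)
  have hm0 : 0 < m := lt_min (by linarith) (by linarith)
  have hm1 : m ≤ lam - tangency μ β := min_le_left _ _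
  have hm2 : m ≤ (β + lam) / 2 := min_le_right _ _
  have hz : (0 : ℝ) ∈ Ioo (height μ β (lam + m) - height μ β (lam - m))
      (height μ β (lam + (β + lam)) - height μ β (lam - (β + lam))) := by
    refine ⟨sub_neg.2 (hA m hm0 hm1 (by linarith)), sub_pos.2 ?_⟩
    rw [show lam - (β + lam) = -β by ring, height_neg_self]
    exact height_pos (by linarith) (by linarith)
  obtain ⟨r, hr, hr'⟩ := intermediate_value_Ioo (by linarith : m ≤ β + lam) hc.continuousOn hz
  have hr0 : 0 < r := hm0.trans hr.1
  have hrb : r < β - lam := by linarith [hr.2]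
  have hr' : height μ β (lam + r) = height μ β (lam - r) := sub_eq_zero.1 hr'
  have hg0 : logGap μ (β + lam) (β - lam) r = 0 := by
    rw [logGap_eq hr0.le hr.2 hrb, hr', sub_self]
  have hmono := fun {p q : ℝ} => gapNum_strictMono (r := p) (s := q) hμ ha
    (by linarith : β + lam < β - lam)
  -- Otherwise the increasing `gapNum` would be negative on all of `(0, r)`, and `logGap` would be
  -- negative at `r` instead of zero.
  have hpos : 0 < gapNum μ (β + lam) (β - lam) r := by
    by_contra! h
    have := logGap_neg hr0 hr.2 hrb fun s hs => (hmono hs.1.le hs.2).trans_le h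
    linarith
  refine ⟨r, hr0, hr.2, hr', ?_, fun s hs hs' => ?_, fun s hs hs' => ?_⟩
  · by_contra! h
    have := hA r hr0 (by linarith) hr.2
    linarith
  · have hsa : s < β + lam := by linarith [hr.2]
    have hsb : s < β - lam := by linarith
    refine (logGap_neg_iff hs.le hsa hsb).1 ?_
    rcases le_or_gt (gapNum μ (β + lam) (β - lam) s) 0 with h | h
    · exact logGap_neg hs hsa hsb fun q hq => (hmono hq.1.le hq.2).trans_le h
    · rw [← hg0]
      exact logGap_strictMonoOn hs.le hr.2 hrb (fun q hq => h.trans (hmono hs.le hq.1))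
        ⟨le_rfl, hs'.le⟩ ⟨hs'.le, le_rfl⟩ hs'
  · rcases lt_or_ge s (β + lam) with hsa | hsa
    · refine (logGap_pos_iff (by linarith) hsa hs').1 ?_
      rw [← hg0]
      exact logGap_strictMonoOn hr0.le hsa hs' (fun q hq => hpos.trans (hmono hr0.le hq.1))
        ⟨le_rfl, hs.le⟩ ⟨hs.le, le_rfl⟩ hs
    · exact (height_nonpos (by linarith) hβ).trans_lt (height_pos (by linarith) (by linarith))

/-! ### Canard cycles -/

theorem isCompact_of_canardCycle {Z : NSVF} {Γ : Set (ℝ × ℝ)} (h : Z.CanardCycle Γ) :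
    IsCompact Γ := by
  obtain ⟨n, k, x, C, rfl, hC, -⟩ := h
  exact isCompact_iUnion fun i => isCompact_of_isArc (hC i)

/-- A finite union of arcs run in finite time is compact. So the exemption of `Σ` from the visible
fold condition never applies. -/
theorem canardCycle_ne_line {Z : NSVF} {Γ : Set (ℝ × ℝ)} (h : Z.CanardCycle Γ) :
    Γ ≠ NSVF.line := by
  rintro rfl
  have h1 := (isCompact_of_canardCycle h).image continuous_fst
  have h2 : Prod.fst '' NSVF.line = (univ : Set ℝ) :=
    eq_univ_of_forall fun x => ⟨(x, 0), rfl, rfl⟩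
  rw [h2] at h1
  exact noncompact_univ ℝ h1

theorem lt_of_isArc (hμ : μ < 0) (hβ : β ≤ 0) (hlam : lam < 1) {k : NSVF.ArcKind} {x z : ℝ}
    {C : Set (ℝ × ℝ)} (h : (foldSaddle lam μ β).IsArc k x z C) : x < z := by
  cases k with
  | ofX => obtain ⟨h1, h2, -⟩ := isArcX_iff.1 h; linarith
  | ofY => exact absurd h (not_isArcY hμ hβ)
  | ofSlide =>
    obtain ⟨T, hT, γ, hc, h0, hT', -, hs⟩ := h
    have hm : StrictMonoOn (fun t => (γ t).1) (Icc 0 T) := by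
      refine strictMonoOn_of_deriv_pos (convex_Icc _ _) (continuous_fst.comp_continuousOn hc) ?_
      intro t ht
      rw [interior_Icc] at ht
      obtain ⟨-, h2, h3⟩ := hs t ht
      rw [(hasDerivAt_fst_comp h3).deriv]
      exact slide_pos hμ hβ hlam h2.1
    have := hm ⟨le_rfl, hT.le⟩ ⟨hT.le, le_rfl⟩ hT
    simpa [h0, hT'] using this

/-- Every available arc leads strictly to the right, so the rightmost starting point of a cyclic
chain has no successor. -/
theorem not_canardCycle_of_nonpos (hμ : μ < 0) (hβ : β ≤ 0) (hlam : lam < 1) {Γ : Set (ℝ × ℝ)} :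
    ¬ (foldSaddle lam μ β).CanardCycle Γ := by
  rintro ⟨n, k, x, C, -, hC, -⟩
  obtain ⟨i, hi⟩ := Finite.exists_max x
  exact (lt_of_isArc hμ hβ hlam (hC i)).not_ge (hi (i + 1))

/-- The half-width of the arc of the upper field in a cycle of kind I. -/
def IsCycleRadius (lam μ β r : ℝ) : Prop :=
  0 < r ∧ r < β + lam ∧ r < β - lam ∧ height μ β (lam + r) = height μ β (lam - r)

theorem IsCycleRadius.lam_mem (hμ : μ < 0) (hβ : 0 < β) {r : ℝ} (h : IsCycleRadius lam μ β r) :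
    tangency μ β < lam ∧ lam < 0 := by
  obtain ⟨h0, ha, hb, he⟩ := h
  constructor <;> by_contra! hc
  · exact (height_lt_of_le_tangency hμ hβ hc (by linarith) h0 hb).ne' he
  · exact (height_lt_of_nonneg hμ hc h0 hb).ne he

theorem IsCycleRadius.eq (hμ : μ < 0) (hβ : 0 < β) {r s : ℝ} (hr : IsCycleRadius lam μ β r)
    (hs : IsCycleRadius lam μ β s) : r = s := by
  obtain ⟨h1, h2⟩ := hr.lam_mem hμ hβ
  obtain ⟨q, -, -, -, -, h3, h4⟩ := exists_cycle_radius hμ hβ h1 h2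
  have key : ∀ p, IsCycleRadius lam μ β p → p = q := by
    rintro p ⟨p0, pa, pb, pe⟩
    rcases lt_trichotomy p q with h | h | h
    · exact absurd pe (h3 p p0 h).ne
    · exact h
    · exact absurd pe (h4 p h pb).ne'
  rw [key r hr, key s hs]

/-- The closed curve that consists of an arc of each field. -/
def cycleSet (lam μ β r : ℝ) : Set (ℝ × ℝ) :=
  arcY μ β (lam + r) (lam - r) ∪ arcX lam (lam - r)

/-- For `β > 0` there is no visible fold, hence no arc of the Filippov field. Two arcs of the same
field cannot be joined, since each ends strictly past the fold at which the joint would have to lie.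
So the kinds alternate, and the chain is a periodic orbit of an increasing return map: it can only
be a fixed point, possibly run through several times. -/
theorem canardCycle_eq (hμ : μ < 0) (hβ : 0 < β) {Γ : Set (ℝ × ℝ)}
    (h : (foldSaddle lam μ β).CanardCycle Γ) :
    ∃ r, IsCycleRadius lam μ β r ∧ Γ = cycleSet lam μ β r := by
  have hne := canardCycle_ne_line h
  obtain ⟨n, k, x, C, hΓ, hC, hJ, -, hV⟩ := h
  have hS : ∀ i, k i ≠ .ofSlide := by
    intro i hi
    obtain ⟨z, hz, -⟩ := hV hne i hi
    rcases hz with hz | hz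
    · exact not_visibleFoldX z hz
    · linarith [((visibleFoldY_iff hμ).1 hz).1]
  have hX : ∀ i, k i = .ofX → x i < lam ∧ x (i + 1) = 2 * lam - x i ∧ C i = arcX lam (x i) :=
    fun i hi => isArcX_iff.1 (hi ▸ hC i)
  have hY : ∀ i, k i = .ofY → _ := fun i hi => (isArcY_iff hμ hβ).1 (hi ▸ hC i)
  have hXY : ∀ i, k i = .ofX → k (i + 1) = .ofY := by
    intro i hi
    have h1 := hJ i
    cases h2 : k (i + 1) with
    | ofX =>
      rw [hi, h2] at h1
      have := eq_of_foldX h1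
      obtain ⟨h3, h4, -⟩ := hX i hi
      linarith
    | ofY => rfl
    | ofSlide => exact absurd h2 (hS _)
  have hYX : ∀ i, k i = .ofY → k (i + 1) = .ofX := by
    intro i hi
    have h1 := hJ i
    cases h2 : k (i + 1) with
    | ofY =>
      rw [hi, h2] at h1
      have := eq_of_foldY hμ h1
      obtain ⟨-, -, -, h3, -⟩ := hY i hi
      linarith
    | ofX => rfl
    | ofSlide => exact absurd h2 (hS _)
  have hpredX : ∀ i, k i = .ofX → k (i - 1) = .ofY := by
    intro i hi
    cases h2 : k (i - 1) with
    | ofX => have := hXY _ h2; rw [sub_add_cancel, hi] at this; cases this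
    | ofY => rfl
    | ofSlide => exact absurd h2 (hS _)
  have hpredY : ∀ i, k i = .ofY → k (i - 1) = .ofX := by
    intro i hi
    cases h2 : k (i - 1) with
    | ofY => have := hYX _ h2; rw [sub_add_cancel, hi] at this; cases this
    | ofX => rfl
    | ofSlide => exact absurd h2 (hS _)
  have hne : ∃ i, k i = .ofY := by
    cases h2 : k 0 with
    | ofY => exact ⟨0, h2⟩
    | ofX => exact ⟨_, hXY 0 h2⟩
    | ofSlide => exact absurd h2 (hS _)
  -- The lower field reverses the order of starting points and so does the reflection, so the return
  -- map preserves it.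
  have hmono : ∀ i j, k i = .ofY → k j = .ofY → x i ≤ x j → x (i + 1 + 1) ≤ x (j + 1 + 1) := by
    intro i j hi hj hij
    obtain ⟨a1, a2, a3, a4, a5, -⟩ := hY i hi
    obtain ⟨b1, b2, b3, b4, b5, -⟩ := hY j hj
    rw [(hX _ (hYX i hi)).2.1, (hX _ (hYX j hj)).2.1]
    have h1 := (height_strictAntiOn hμ).antitoneOn ⟨a1.le, a2.le⟩ ⟨b1.le, b2.le⟩ hij
    rw [a5, b5, (height_strictMonoOn hμ hβ).le_iff_le b4.le a4.le] at h1
    linarith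
  have hfix : ∀ i, k i = .ofY → x (i + 1 + 1) = x i →
      IsCycleRadius lam μ β (x i - lam) ∧ x (i + 1) = 2 * lam - x i := by
    intro i hi hf
    obtain ⟨a1, a2, a3, a4, a5, -⟩ := hY i hi
    obtain ⟨b1, b2, -⟩ := hX _ (hYX i hi)
    have h1 : x (i + 1) = 2 * lam - x i := by linarith
    refine ⟨⟨by linarith, by linarith, by linarith, ?_⟩, h1⟩
    rw [add_sub_cancel, show lam - (x i - lam) = x (i + 1) by linarith, a5]
  obtain ⟨i, hi, hmax⟩ := Set.exists_max_image {i | k i = .ofY} x (toFinite _) hne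
  obtain ⟨j, hj, hmin⟩ := Set.exists_min_image {i | k i = .ofY} x (toFinite _) hne
  have hback : ∀ i, k i = .ofY → k (i - 1 - 1) = .ofY ∧ i - 1 - 1 + 1 + 1 = i := fun i hi =>
    ⟨hpredX _ (hpredY _ hi), by rw [sub_add_cancel, sub_add_cancel]⟩
  -- The maximal starting point is the return of some starting point that is at most as large;
  -- monotonicity then gives that its own return is at least as large, and maximality gives
  -- equality. The minimal one is treated likewise.
  have hfi : x (i + 1 + 1) = x i := by
    refine le_antisymm (hmax _ (hXY _ (hYX _ hi))) ?_
    obtain ⟨h1, h2⟩ := hback i hi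
    have := hmono _ _ h1 hi (hmax _ h1)
    rwa [h2] at this
  have hfj : x (j + 1 + 1) = x j := by
    refine le_antisymm ?_ (hmin _ (hXY _ (hYX _ hj)))
    obtain ⟨h1, h2⟩ := hback j hj
    have := hmono _ _ hj h1 (hmin _ h1)
    rwa [h2] at this
  obtain ⟨hri, -⟩ := hfix i hi hfi
  obtain ⟨hrj, -⟩ := hfix j hj hfj
  have hij : x i = x j := by
    have := hri.eq hμ hβ hrj
    linarith
  have hall : ∀ l, k l = .ofY → x l = x i := fun l hl =>
    le_antisymm (hmax l hl) (hij ▸ hmin l hl)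
  have hsnd : ∀ l, k l = .ofX → x l = 2 * lam - x i := by
    intro l hl
    have h1 := hpredX l hl
    have h2 := hXY l hl
    have := hall _ h2
    rw [(hX l hl).2.1] at this
    linarith
  have hCY : ∀ l, k l = .ofY → C l = arcY μ β (x i) (2 * lam - x i) := by
    intro l hl
    obtain ⟨-, -, -, -, -, h⟩ := hY l hl
    rw [h, hall l hl, hsnd _ (hYX l hl)]
  have hCX : ∀ l, k l = .ofX → C l = arcX lam (2 * lam - x i) := by
    intro l hl
    rw [(hX l hl).2.2, hsnd l hl]
  refine ⟨_, hri, ?_⟩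
  rw [hΓ, cycleSet, add_sub_cancel, show lam - (x i - lam) = 2 * lam - x i by ring]
  apply subset_antisymm
  · refine iUnion_subset fun l => ?_
    cases hl : k l with
    | ofX => rw [hCX l hl]; exact subset_union_right
    | ofY => rw [hCY l hl]; exact subset_union_left
    | ofSlide => exact absurd hl (hS _)
  · refine union_subset ?_ ?_
    · rw [← hCY i hi]; exact subset_iUnion C i
    · rw [← hCX _ (hYX i hi)]; exact subset_iUnion C _

theorem mem_cycleSet_iff (hμ : μ < 0) (hβ : 0 < β) {r : ℝ} (hr : IsCycleRadius lam μ β r)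
    (ht : lam - r < tangency μ β) {w : ℝ} :
    (w, (0 : ℝ)) ∈ cycleSet lam μ β r ↔ w = lam + r ∨ w = lam - r := by
  obtain ⟨h1, h2⟩ := hr.lam_mem hμ hβ
  obtain ⟨r0, ra, rb, he⟩ := hr
  have hY : (foldSaddle lam μ β).IsArc .ofY (lam + r) (lam - r) (arcY μ β (lam + r) (lam - r)) :=
    (isArcY_iff hμ hβ).2 ⟨by linarith, by linarith, by linarith, ht, he, rfl⟩
  have hX : (foldSaddle lam μ β).IsArc .ofX (lam - r) (lam + r) (arcX lam (lam - r)) :=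
    isArcX_iff.2 ⟨by linarith, by ring, rfl⟩
  rw [cycleSet, mem_union, mem_arc_iff (Or.inr rfl) hY, mem_arc_iff (Or.inl rfl) hX]
  tauto

theorem canardCycleI_cycleSet (hμ : μ < 0) (hβ : 0 < β) {r : ℝ} (hr : IsCycleRadius lam μ β r)
    (ht : lam - r < tangency μ β) : (foldSaddle lam μ β).CanardCycleI (cycleSet lam μ β r) := by
  obtain ⟨h1, h2⟩ := hr.lam_mem hμ hβ
  have hsew : ∀ w, (w, (0 : ℝ)) ∈ cycleSet lam μ β r → (foldSaddle lam μ β).Sewing w := by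
    intro w hw
    rw [sewing_iff hμ]
    rcases (mem_cycleSet_iff hμ hβ hr ht).1 hw with rfl | rfl
    · exact Or.inr ⟨by linarith [hr.1], by linarith [hr.1]⟩
    · exact Or.inl ⟨by linarith [hr.1], ht⟩
  have hs1 := hsew _ ((mem_cycleSet_iff hμ hβ hr ht).2 (Or.inl rfl))
  have hs2 := hsew _ ((mem_cycleSet_iff hμ hβ hr ht).2 (Or.inr rfl))
  refine ⟨?_, hsew⟩
  obtain ⟨r0, ra, rb, he⟩ := hr
  have hY : (foldSaddle lam μ β).IsArc .ofY (lam + r) (lam - r) (arcY μ β (lam + r) (lam - r)) :=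
    (isArcY_iff hμ hβ).2 ⟨by linarith, by linarith, by linarith, ht, he, rfl⟩
  have hX : (foldSaddle lam μ β).IsArc .ofX (lam - r) (lam + r) (arcX lam (lam - r)) :=
    isArcX_iff.2 ⟨by linarith, by ring, rfl⟩
  refine ⟨1, ![.ofY, .ofX], ![lam + r, lam - r],
    ![arcY μ β (lam + r) (lam - r), arcX lam (lam - r)], ?_, ?_, ?_, Or.inl ⟨0, 1, by simp⟩, ?_⟩
  · ext p
    simp [cycleSet, Fin.exists_fin_two]
  · intro i
    fin_cases i
    · exact hY
    · exact hX
  · intro i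
    fin_cases i
    · exact hs2
    · exact hs1
  · intro _ i hi
    fin_cases i <;> simp at hi

/-! ### Crossing orbits -/

theorem crossing_step (hμ : μ < 0) (hβ : 0 < β) {x : ℕ → ℝ}
    (h : (foldSaddle lam μ β).CrossingOrbit x) {n : ℕ} (hn : lam < x n) :
    x n < β ∧ -β < x (n + 1) ∧ x (n + 1) < tangency μ β ∧
      height μ β (x n) = height μ β (x (n + 1)) ∧ x (n + 1 + 1) = 2 * lam - x (n + 1) := by
  obtain ⟨-, C, hC | hC⟩ := h n
  · linarith [(isArcX_iff.1 hC).1]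
  obtain ⟨h1, h2, h3, h4, h5, -⟩ := (isArcY_iff hμ hβ).1 hC
  obtain ⟨-, D, hD | hD⟩ := h (n + 1)
  · exact ⟨h2, h3, h4, h5, (isArcX_iff.1 hD).2.1⟩
  · linarith [((isArcY_iff hμ hβ).1 hD).1]

/-- Read backwards, an arc that begins at a point beyond `lam ≥ tangency μ β` must be one of the
upper field, because arcs of the lower field end to the left of the tangency point. -/
theorem crossing_step_reverse (hμ : μ < 0) (hβ : 0 < β) (hlam : tangency μ β ≤ lam) {x : ℕ → ℝ}
    (h : (foldSaddle lam μ β).reverse.CrossingOrbit x) {n : ℕ} (hn : lam < x n) :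
    tangency μ β < x (n + 1 + 1) ∧ x (n + 1 + 1) < β ∧ -β < 2 * lam - x n ∧
      height μ β (x (n + 1 + 1)) = height μ β (2 * lam - x n) := by
  obtain ⟨-, C, hC | hC⟩ := h n
  swap
  · have := (isArcY_iff hμ hβ).1 (isArc_reverse (Or.inr rfl) hC)
    linarith [this.2.2.2.1]
  obtain ⟨h1, h2, -⟩ := isArcX_iff.1 (isArc_reverse (Or.inl rfl) hC)
  obtain ⟨-, D, hD | hD⟩ := h (n + 1)
  · obtain ⟨h3, h4, -⟩ := isArcX_iff.1 (isArc_reverse (Or.inl rfl) hD)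
    linarith
  · obtain ⟨e1, e2, e3, e4, e5, -⟩ := (isArcY_iff hμ hβ).1 (isArc_reverse (Or.inr rfl) hD)
    rw [show x (n + 1) = 2 * lam - x n by linarith] at e3 e5
    exact ⟨e1, e2, e3, e5⟩

theorem not_crossingOrbit (hμ : μ < 0) (hβ : β ≤ 0) (x : ℕ → ℝ) :
    ¬ (foldSaddle lam μ β).CrossingOrbit x := by
  intro h
  obtain ⟨-, C, hC | hC⟩ := h 0
  swap
  · exact not_isArcY hμ hβ hC
  obtain ⟨-, D, hD | hD⟩ := h (0 + 1)
  · have h1 := isArcX_iff.1 hC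
    have h2 := isArcX_iff.1 hD
    linarith [h1.1, h1.2.1, h2.1]
  · exact not_isArcY hμ hβ hD

theorem not_crossingOrbit_reverse (hμ : μ < 0) (hβ : β ≤ 0) (x : ℕ → ℝ) :
    ¬ (foldSaddle lam μ β).reverse.CrossingOrbit x := by
  intro h
  obtain ⟨-, C, hC | hC⟩ := h 0
  swap
  · exact not_isArcY hμ hβ (isArc_reverse (Or.inr rfl) hC)
  obtain ⟨-, D, hD | hD⟩ := h (0 + 1)
  · have h1 := isArcX_iff.1 (isArc_reverse (Or.inl rfl) hC)
    have h2 := isArcX_iff.1 (isArc_reverse (Or.inl rfl) hD)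
    linarith [h1.1, h2.2.1, h2.1]
  · exact not_isArcY hμ hβ (isArc_reverse (Or.inr rfl) hD)

/-- The union of `(lam, β)` and `(-β, τ)` is forward invariant: lower arcs go from the first
interval to the second, and the reflection goes back, staying below `β` because `lam ≤ 0`. The orbit
is an iteration of chosen successors. -/
theorem exists_crossingOrbit (hμ : μ < 0) (hβ : 0 < β) (h1 : tangency μ β ≤ lam) (h2 : lam ≤ 0)
    {z : ℝ} (hz : (lam < z ∧ z < β) ∨ (-β < z ∧ z < tangency μ β)) :
    ∃ x, (foldSaddle lam μ β).CrossingOrbit x ∧ x 0 = z := by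
  have hstep : ∀ z : {z : ℝ // (lam < z ∧ z < β) ∨ (-β < z ∧ z < tangency μ β)},
      ∃ w : {z : ℝ // (lam < z ∧ z < β) ∨ (-β < z ∧ z < tangency μ β)},
        ∃ C, (foldSaddle lam μ β).IsArc .ofX z w C ∨ (foldSaddle lam μ β).IsArc .ofY z w C := by
    rintro ⟨z, hz⟩
    rcases hz with hz | hz
    · obtain ⟨w, hw1, hw2, hw3⟩ := exists_height_eq hμ hβ (h1.trans_lt hz.1) hz.2
      exact ⟨⟨w, Or.inr ⟨hw1, hw2⟩⟩, _, Or.inr ((isArcY_iff hμ hβ).2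
        ⟨h1.trans_lt hz.1, hz.2, hw1, hw2, hw3, rfl⟩)⟩
    · exact ⟨⟨2 * lam - z, Or.inl ⟨by linarith, by linarith⟩⟩, _,
        Or.inl (isArcX_iff.2 ⟨by simp only; linarith, rfl, rfl⟩)⟩
  choose f hf using hstep
  refine ⟨fun n => (f^[n] ⟨z, hz⟩ : ℝ), fun n => ⟨?_, ?_⟩, rfl⟩
  · rw [sewing_iff hμ]
    rcases (f^[n] ⟨z, hz⟩).2 with h | h
    · exact Or.inr ⟨h.1, by linarith [h.1]⟩
    · exact Or.inl ⟨by linarith [h.2], h.2⟩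
  · simp only [Function.iterate_succ_apply']
    exact hf _

/-! ### Attraction -/

/-- The points of `Σ` between `lam` and `β` approach `L` under the first return map. -/
structure IsBasin (lam μ β L : ℝ) : Prop where
  tangency_le : tangency μ β ≤ lam
  nonpos : lam ≤ 0
  le : lam ≤ L
  le_beta : L ≤ β
  reflect_le : 2 * lam - L ≤ tangency μ β
  height_eq : height μ β L = height μ β (2 * lam - L)
  height_lt : ∀ z, lam < z → z < L → height μ β z < height μ β (2 * lam - z)
  lt_height : ∀ z, L < z → z < β → height μ β (2 * lam - z) < height μ β z

theorem isBasin_tangency (hμ : μ < 0) (hβ : 0 < β) :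
    IsBasin (tangency μ β) μ β (tangency μ β) where
  tangency_le := le_rfl
  nonpos := (tangency_neg hμ hβ).le
  le := le_rfl
  le_beta := by linarith [tangency_neg hμ hβ]
  reflect_le := by linarith
  height_eq := by congr 1; ring
  height_lt := fun z h h' => absurd h' h.not_gt
  lt_height := fun z h h' => by
    have := height_lt_of_le_tangency hμ hβ le_rfl (neg_lt_tangency hμ hβ) (sub_pos.2 h)
      (by linarith)
    rwa [add_sub_cancel, sub_sub_eq_add_sub, ← two_mul] at this

/-- For `lam = 0` the limit is the separatrix point `β` itself, whose reflection `-β` is also at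
height `0`. No points lie between `L` and `β`, so attraction is only from inside. -/
theorem isBasin_zero (hμ : μ < 0) (hβ : 0 < β) : IsBasin 0 μ β β where
  tangency_le := (tangency_neg hμ hβ).le
  nonpos := le_rfl
  le := hβ.le
  le_beta := le_rfl
  reflect_le := by linarith [neg_lt_tangency hμ hβ]
  height_eq := by rw [height_self hμ, mul_zero, zero_sub, height_neg_self]
  height_lt := fun z h h' => by
    have := height_lt_of_nonneg hμ le_rfl h (by linarith : z < β - 0)
    rwa [zero_add, zero_sub, ← zero_sub, ← mul_zero 2] at this
  lt_height := fun z h h' => absurd h' h.not_gt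

theorem exists_isBasin_cycle (hμ : μ < 0) (hβ : 0 < β) (h1 : tangency μ β < lam) (h2 : lam < 0) :
    ∃ r, IsCycleRadius lam μ β r ∧ lam - r < tangency μ β ∧ IsBasin lam μ β (lam + r) := by
  obtain ⟨r, r0, ra, he, ht, h3, h4⟩ := exists_cycle_radius hμ hβ h1 h2
  refine ⟨r, ⟨r0, ra, by linarith, he⟩, ht, h1.le, h2.le, by linarith, by linarith, by linarith,
    ?_, ?_, ?_⟩
  · rw [he]; congr 1; ring
  · intro z hz hz'
    have := h3 (z - lam) (by linarith) (by linarith)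
    rwa [add_sub_cancel, sub_sub_eq_add_sub, ← two_mul] at this
  · intro z hz hz'
    have := h4 (z - lam) (by linarith) (by linarith)
    rwa [add_sub_cancel, sub_sub_eq_add_sub, ← two_mul] at this

/-- The limit of a monotone orbit of the first return map. -/
theorem IsBasin.eq_of_tendsto {L M : ℝ} (B : IsBasin lam μ β L) (hμ : μ < 0) {y : ℕ → ℝ}
    (hy : ∀ k, height μ β (2 * lam - y (k + 1)) = height μ β (y k))
    (hl : Tendsto y atTop (𝓝 M)) (h1 : lam < M) (h2 : M < β) : M = L := by
  have hc := continuous_height (β := β) hμ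
  have hc2 : Continuous fun x => height μ β (2 * lam - x) := hc.comp (by fun_prop)
  have e1 := (hc.tendsto M).comp hl
  have e2 := (hc2.tendsto M).comp (hl.comp (tendsto_add_atTop_nat 1))
  have e3 : height μ β (2 * lam - M) = height μ β M :=
    tendsto_nhds_unique (e2.congr fun k => hy k) e1
  rcases lt_trichotomy M L with h | h | h
  · exact absurd e3 (B.height_lt M h1 h).ne'
  · exact h
  · exact absurd e3 (B.lt_height M h h2).ne

/-- The return sequence `y k = x (2 * k)` is governed by `height (2 * lam - y (k + 1)) = height (y
k)`. The point `L` is fixed and cannot be jumped over, because the return map is increasing. On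
either side the comparison of heights makes `y` monotone towards `L`, and its limit is a fixed point
in `[lam, β]`, which must be `L`. -/
theorem IsBasin.tendsto_even {L : ℝ} (B : IsBasin lam μ β L) (hμ : μ < 0) (hβ : 0 < β)
    {x : ℕ → ℝ} (h : (foldSaddle lam μ β).CrossingOrbit x) (h0 : lam < x 0) :
    Tendsto (fun k => x (2 * k)) atTop (𝓝 L) ∧
      Tendsto (fun k => x (2 * k + 1)) atTop (𝓝 (2 * lam - L)) := by
  have htl := B.tangency_le
  have hpos : ∀ k, lam < x (2 * k) := by
    intro k
    induction k with
    | zero => exact h0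
    | succ k ih =>
      obtain ⟨-, -, h3, -, h5⟩ := crossing_step hμ hβ h ih
      rw [show 2 * (k + 1) = 2 * k + 1 + 1 by ring, h5]
      linarith
  set y : ℕ → ℝ := fun k => x (2 * k)
  have hy : ∀ k, y k < β ∧ 2 * lam - y (k + 1) < tangency μ β ∧
      height μ β (2 * lam - y (k + 1)) = height μ β (y k) ∧ x (2 * k + 1) = 2 * lam - y (k + 1) := by
    intro k
    obtain ⟨h1, -, h3, h4, h5⟩ := crossing_step hμ hβ h (hpos k)
    have h6 : y (k + 1) = 2 * lam - x (2 * k + 1) := h5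
    have h7 : x (2 * k + 1) = 2 * lam - y (k + 1) := by linarith
    rw [h7] at h3 h4
    exact ⟨h1, h3, h4.symm, h7⟩
  have hheq := fun k => (hy k).2.2.1
  have hmain : Tendsto y atTop (𝓝 L) := by
    have hsm := height_strictMonoOn hμ hβ
    have hanti := height_strictAntiOn (β := β) hμ
    rcases lt_trichotomy (y 0) L with hL | hL | hL
    · have hlt : ∀ k, y k < L := by
        intro k
        induction k with
        | zero => exact hL
        | succ k ih =>
          have h1 := hanti ⟨htl.trans (hpos k).le, (hy k).1.le⟩
            ⟨htl.trans B.le, B.le_beta⟩ ih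
          rw [B.height_eq, ← hheq k, hsm.lt_iff_lt B.reflect_le (hy k).2.1.le] at h1
          linarith
      have hmono : Monotone y := monotone_nat_of_le_succ fun k => by
        have h1 := B.height_lt _ (hpos k) (hlt k)
        -- If the reflection of `y k` is on the right of the tangency point, that of `y (k + 1)` is
        -- automatically smaller; otherwise both are on the increasing branch of `height` and the
        -- heights decide.
        rcases le_total (tangency μ β) (2 * lam - y k) with h2 | h2
        · linarith [(hy k).2.1]
        · change height μ β (y k) < height μ β (2 * lam - y k) at h1
          rw [← hheq k, hsm.lt_iff_lt (hy k).2.1.le h2] at h1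
          linarith
      have hb : BddAbove (range y) := ⟨L, by rintro _ ⟨k, rfl⟩; exact (hlt k).le⟩
      have hl := tendsto_atTop_ciSup hmono hb
      have h1 : y 0 ≤ ⨆ k, y k := le_ciSup hb 0
      have h2 : ⨆ k, y k ≤ L := ciSup_le fun k => (hlt k).le
      rcases h2.eq_or_lt with h3 | h3
      · rwa [h3] at hl
      · rwa [B.eq_of_tendsto hμ hheq hl (h0.trans_le h1) (h3.trans_le B.le_beta)] at hl
    · have heq : ∀ k, y k = L := by
        intro k
        induction k with
        | zero => exact hL
        | succ k ih =>
          have h1 := hheq k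
          rw [ih, B.height_eq] at h1
          have := hsm.injOn (hy k).2.1.le B.reflect_le h1
          linarith
      exact tendsto_const_nhds.congr fun k => (heq k).symm
    · have hgt : ∀ k, L < y k := by
        intro k
        induction k with
        | zero => exact hL
        | succ k ih =>
          have h1 := hanti ⟨htl.trans B.le, B.le_beta⟩
            ⟨htl.trans (hpos k).le, (hy k).1.le⟩ ih
          rw [B.height_eq, ← hheq k, hsm.lt_iff_lt (hy k).2.1.le B.reflect_le] at h1
          linarith
      have hmono : Antitone y := antitone_nat_of_succ_le fun k => by
        have h1 := B.lt_height _ (hgt k) (hy k).1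
        rcases le_total (tangency μ β) (2 * lam - y k) with h2 | h2
        · exfalso
          have h3 := hanti ⟨h2, by linarith [hpos k, B.nonpos]⟩
            ⟨htl.trans (hpos k).le, (hy k).1.le⟩ (by linarith [hpos k] : 2 * lam - y k < y k)
          linarith
        · change height μ β (2 * lam - y k) < height μ β (y k) at h1
          rw [← hheq k, hsm.lt_iff_lt h2 (hy k).2.1.le] at h1
          linarith
      have hb : BddBelow (range y) := ⟨L, by rintro _ ⟨k, rfl⟩; exact (hgt k).le⟩
      have hl := tendsto_atTop_ciInf hmono hb
      have h1 : ⨅ k, y k ≤ y 0 := ciInf_le hb 0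
      have h2 : L ≤ ⨅ k, y k := le_ciInf fun k => (hgt k).le
      rcases h2.eq_or_lt with h3 | h3
      · rwa [← h3] at hl
      · rwa [B.eq_of_tendsto hμ hheq hl (B.le.trans_lt h3) (h1.trans_lt (hy 0).1)] at hl
  refine ⟨hmain, ?_⟩
  have h1 := (hmain.comp (tendsto_add_atTop_nat 1)).const_sub (2 * lam)
  exact h1.congr fun k => (hy k).2.2.2.symm

theorem tendsto_of_tendsto_even_odd {f : ℕ → ℝ} {a : ℝ}
    (h0 : Tendsto (fun k => f (2 * k)) atTop (𝓝 a))
    (h1 : Tendsto (fun k => f (2 * k + 1)) atTop (𝓝 a)) : Tendsto f atTop (𝓝 a) := by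
  rw [Metric.tendsto_atTop] at *
  intro ε hε
  obtain ⟨N, hN⟩ := h0 ε hε
  obtain ⟨M, hM⟩ := h1 ε hε
  refine ⟨2 * (N + M) + 1, fun n hn => ?_⟩
  rcases Nat.even_or_odd' n with ⟨k, rfl | rfl⟩
  · exact hN k (by omega)
  · exact hM k (by omega)

theorem tendsto_infDist {A : Set (ℝ × ℝ)} {y : ℕ → ℝ} {a : ℝ} (ha : (a, (0 : ℝ)) ∈ A)
    (h : Tendsto y atTop (𝓝 a)) :
    Tendsto (fun n => Metric.infDist (y n, (0 : ℝ)) A) atTop (𝓝 0) := by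
  have h1 : Tendsto (fun n => dist (y n, (0 : ℝ)) (a, 0)) atTop (𝓝 0) := by
    rw [← tendsto_iff_dist_tendsto_zero]
    exact h.prodMk_nhds tendsto_const_nhds
  exact squeeze_zero (fun _ => Metric.infDist_nonneg) (fun _ => Metric.infDist_le_dist_of_mem ha) h1

theorem IsBasin.attractedTo {L : ℝ} (B : IsBasin lam μ β L) (hμ : μ < 0) (hβ : 0 < β)
    {A : Set (ℝ × ℝ)} (hA : (L, (0 : ℝ)) ∈ A) (hA' : (2 * lam - L, (0 : ℝ)) ∈ A) {z : ℝ}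
    (hz : (lam < z ∧ z < β) ∨ (-β < z ∧ z < tangency μ β)) :
    (foldSaddle lam μ β).AttractedTo A z := by
  refine ⟨exists_crossingOrbit hμ hβ B.tangency_le B.nonpos hz, ?_⟩
  have main : ∀ x, (foldSaddle lam μ β).CrossingOrbit x → lam < x 0 →
      Tendsto (fun n => Metric.infDist (x n, (0 : ℝ)) A) atTop (𝓝 0) := by
    intro x hx h0
    obtain ⟨h1, h2⟩ := B.tendsto_even hμ hβ hx h0
    exact tendsto_of_tendsto_even_odd (tendsto_infDist hA h1) (tendsto_infDist hA' h2)
  rintro x hx rfl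
  rcases hz with hz | hz
  · exact main x hx hz.1
  · have h1 : lam < x (0 + 1) := by
      obtain ⟨-, C, hC | hC⟩ := hx 0
      · obtain ⟨h1, h2, -⟩ := isArcX_iff.1 hC
        linarith
      · linarith [((isArcY_iff hμ hβ).1 hC).1]
    have := main (fun n => x (n + 1)) (fun n => hx (n + 1)) h1
    exact (tendsto_add_atTop_iff_nat (f := fun n => Metric.infDist (x n, (0 : ℝ)) A) 1).1 this

/-- Beyond `L` the reversed return map moves points to the right while they stay below `β`. The
limit lies strictly to the right of every point of `A` on the line, so its distance from the closed
set `A` is not zero. -/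
theorem IsBasin.not_attractedTo_reverse {L : ℝ} (B : IsBasin lam μ β L) (hμ : μ < 0) (hβ : 0 < β)
    {A : Set (ℝ × ℝ)} (hA : IsClosed A) (hne : A.Nonempty)
    (hAL : ∀ w, (w, (0 : ℝ)) ∈ A → w ≤ L) {z : ℝ} (hz : L < z) :
    ¬ (foldSaddle lam μ β).reverse.AttractedTo A z := by
  rintro ⟨⟨x, hx, rfl⟩, hall⟩
  have htl := B.tangency_le
  have hl := hall x hx rfl
  set y : ℕ → ℝ := fun k => x (2 * k)
  have hstep : ∀ k, L < y k → y k < y (k + 1) := by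
    intro k hk
    obtain ⟨h1, h2, h3, h4⟩ := crossing_step_reverse hμ hβ htl hx (B.le.trans_lt hk)
    change tangency μ β < y (k + 1) at h1
    change height μ β (y (k + 1)) = height μ β (2 * lam - y k) at h4
    have hk' : y k < β := by
      have : -β < 2 * lam - y k := h3
      linarith [B.nonpos]
    by_contra! hle
    have h5 := (height_strictAntiOn hμ).antitoneOn ⟨h1.le, h2.le⟩
      ⟨htl.trans (B.le.trans hk.le), hk'.le⟩ hle
    linarith [B.lt_height _ hk hk']
  have hgt : ∀ k, L < y k := by
    intro k
    induction k with
    | zero => exact hz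
    | succ k ih => exact ih.trans (hstep k ih)
  have hmono : Monotone y := monotone_nat_of_le_succ fun k => (hstep k (hgt k)).le
  have hb : BddAbove (range y) := by
    refine ⟨β, ?_⟩
    rintro _ ⟨k, rfl⟩
    exact (hstep k (hgt k)).le.trans
      (crossing_step_reverse hμ hβ htl hx (B.le.trans_lt (hgt k))).2.1.le
  have hM := tendsto_atTop_ciSup hmono hb
  have h1 : Tendsto (fun k => Metric.infDist (y k, (0 : ℝ)) A) atTop
      (𝓝 (Metric.infDist (⨆ k, y k, (0 : ℝ)) A)) :=
    ((Metric.continuous_infDist_pt A).tendsto _).comp (hM.prodMk_nhds tendsto_const_nhds)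
  have h2 : Tendsto (fun k => Metric.infDist (y k, (0 : ℝ)) A) atTop (𝓝 0) :=
    hl.comp (tendsto_id.const_mul_atTop' two_pos)
  have h3 := tendsto_nhds_unique h1 h2
  have h4 := hAL _ ((hA.mem_iff_infDist_zero hne).2 h3)
  have h5 : y 0 ≤ ⨆ k, y k := le_ciSup hb 0
  exact (hz.trans_le h5).not_ge h4

/-! ### Tangential singularities -/

theorem tangentialAttractor_eq (hμ : μ < 0) {q : ℝ}
    (h : (foldSaddle lam μ β).TangentialAttractor q) :
    q = lam ∧ lam = tangency μ β ∧ 0 < β := by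
  obtain ⟨h1, h2, δ, hδ, h3⟩ := h
  rw [Xf_eq_zero_iff] at h1
  rw [Yf_eq_zero_iff hμ] at h2
  refine ⟨h1, h1.symm.trans h2, ?_⟩
  by_contra! hβ
  obtain ⟨⟨x, hx, -⟩, -⟩ := h3 (q + δ / 2) (by linarith) (by
    rw [add_sub_cancel_left, abs_of_pos] <;> linarith)
  exact not_crossingOrbit hμ hβ x hx

theorem tangentialAttractor_tangency (hμ : μ < 0) (hβ : 0 < β) :
    (foldSaddle (tangency μ β) μ β).TangentialAttractor (tangency μ β) := by
  have hn := neg_lt_tangency hμ hβ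
  have ht := tangency_neg hμ hβ
  refine ⟨Xf_eq_zero_iff.2 rfl, (Yf_eq_zero_iff hμ).2 rfl, tangency μ β + β, by linarith, ?_⟩
  intro z hz hz'
  rw [abs_lt] at hz'
  refine (isBasin_tangency hμ hβ).attractedTo hμ hβ (mem_singleton _)
    (by rw [two_mul, add_sub_cancel_right]; exact mem_singleton _) ?_
  rcases hz.lt_or_gt with h | h
  · exact Or.inr ⟨by linarith, h⟩
  · exact Or.inl ⟨h, by linarith⟩

theorem setOf_tangentialAttractor_of_eq (hμ : μ < 0) (hβ : 0 < β) (h : lam = tangency μ β) :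
    {q | (foldSaddle lam μ β).TangentialAttractor q} = {lam} := by
  ext q
  constructor
  · exact fun hq => (tangentialAttractor_eq hμ hq).1
  · rintro rfl
    subst h
    exact tangentialAttractor_tangency hμ hβ

theorem setOf_tangentialAttractor_of_ne (hμ : μ < 0) (h : ¬ (lam = tangency μ β ∧ 0 < β)) :
    {q | (foldSaddle lam μ β).TangentialAttractor q} = ∅ :=
  eq_empty_of_forall_notMem fun _ hq => h (tangentialAttractor_eq hμ hq).2

theorem setOf_tangentialRepeller (hμ : μ < 0) :
    {q | (foldSaddle lam μ β).reverse.TangentialAttractor q} = ∅ := by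
  refine eq_empty_of_forall_notMem fun q ⟨h1, h2, δ, hδ, h3⟩ => ?_
  have h1' : (foldSaddle lam μ β).Xf q = 0 := neg_eq_zero.1 h1
  have h2' : (foldSaddle lam μ β).Yf q = 0 := neg_eq_zero.1 h2
  rw [Xf_eq_zero_iff] at h1'
  rw [Yf_eq_zero_iff hμ] at h2'
  have h4 := h3 (q + δ / 2) (by linarith) (by
    rw [add_sub_cancel_left, abs_of_pos] <;> linarith)
  rcases le_or_gt β 0 with hβ | hβ
  · obtain ⟨⟨x, hx, -⟩, -⟩ := h4
    exact not_crossingOrbit_reverse hμ hβ x hx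
  · subst h1'
    subst h2'
    refine (isBasin_tangency hμ hβ).not_attractedTo_reverse hμ hβ isClosed_singleton
      (singleton_nonempty _) ?_ (by linarith) h4
    intro w hw
    simp at hw
    exact hw.le

/-! ### Stability of cycles -/

theorem attractingCycleI_cycleSet (hμ : μ < 0) (hβ : 0 < β) {r : ℝ}
    (hr : IsCycleRadius lam μ β r) (ht : lam - r < tangency μ β) (B : IsBasin lam μ β (lam + r)) :
    (foldSaddle lam μ β).AttractingCycleI (cycleSet lam μ β r) := by
  refine ⟨canardCycleI_cycleSet hμ hβ hr ht,
    -- Only points of `Σ` in the neighbourhood are tested, so it may be the plane without the points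
    -- of `Σ` whose orbits do not cross forever.
    (((Icc (tangency μ β) lam) ∪ Iic (-β) ∪ Ici β) ×ˢ {(0 : ℝ)})ᶜ, ?_, ?_, ?_⟩
  · exact (((isClosed_Icc.union isClosed_Iic).union isClosed_Ici).prod
      isClosed_singleton).isOpen_compl
  · rintro ⟨w, v⟩ hw ⟨h1, h2⟩
    simp only [mem_singleton_iff] at h2
    subst h2
    rw [mem_cycleSet_iff hμ hβ hr ht] at hw
    obtain ⟨hl, -⟩ := hr.lam_mem hμ hβ
    obtain ⟨r0, ra, rb, -⟩ := hr
    rcases hw with rfl | rfl <;>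
      rcases h1 with (h1 | h1) | h1 <;> simp only [mem_Icc, mem_Iic, mem_Ici] at h1 <;> linarith
  · intro z hz
    refine B.attractedTo hμ hβ ((mem_cycleSet_iff hμ hβ hr ht).2 (Or.inl rfl))
      ((mem_cycleSet_iff hμ hβ hr ht).2 (Or.inr (by ring))) ?_
    simp only [mem_compl_iff, mem_prod, mem_union, mem_Icc, mem_Iic, mem_Ici, mem_singleton_iff,
      and_true, not_or, not_and, not_le] at hz
    obtain ⟨⟨h1, h2⟩, h3⟩ := hz
    rcases lt_or_ge z (tangency μ β) with h | h
    · exact Or.inr ⟨h2, h⟩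
    · exact Or.inl ⟨h1 h, h3⟩

theorem not_repellingCycleI (hμ : μ < 0) (hlam : lam < 1) {Γ : Set (ℝ × ℝ)} :
    ¬ (foldSaddle lam μ β).RepellingCycleI Γ := by
  rintro ⟨⟨hΓ, -⟩, U, hU, hUΓ, h⟩
  rcases le_or_gt β 0 with hβ | hβ
  · exact not_canardCycle_of_nonpos hμ hβ hlam hΓ
  obtain ⟨r, hr, rfl⟩ := canardCycle_eq hμ hβ hΓ
  obtain ⟨h1, h2⟩ := hr.lam_mem hμ hβ
  obtain ⟨s, hs, ht, B⟩ := exists_isBasin_cycle hμ hβ h1 h2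
  obtain rfl := hr.eq hμ hβ hs
  have hmem := (mem_cycleSet_iff hμ hβ hr ht).2 (Or.inl rfl)
  -- A test point just outside the cycle already refutes repulsion.
  have hev : ∀ᶠ z in 𝓝[>] (lam + r), (z, (0 : ℝ)) ∈ U :=
    nhdsWithin_le_nhds ((Continuous.prodMk_left (0 : ℝ)).continuousAt (hU.mem_nhds (hUΓ hmem)))
  obtain ⟨z, hz, hz'⟩ := (hev.and self_mem_nhdsWithin).exists
  refine B.not_attractedTo_reverse hμ hβ (isCompact_of_canardCycle hΓ).isClosed ⟨_, hmem⟩ ?_ hz'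
    (h z hz)
  intro w hw
  rcases (mem_cycleSet_iff hμ hβ hr ht).1 hw with rfl | rfl <;> linarith [hr.1]

theorem setOf_repellingCycleI (hμ : μ < 0) (hlam : lam < 1) :
    {Γ | (foldSaddle lam μ β).RepellingCycleI Γ} = ∅ :=
  eq_empty_of_forall_notMem fun _ => not_repellingCycleI hμ hlam

theorem attractingCycleI_of_canardCycle (hμ : μ < 0) (hlam : lam < 1) {Γ : Set (ℝ × ℝ)}
    (h : (foldSaddle lam μ β).CanardCycle Γ) : (foldSaddle lam μ β).AttractingCycleI Γ := by
  rcases le_or_gt β 0 with hβ | hβ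
  · exact absurd h (not_canardCycle_of_nonpos hμ hβ hlam)
  obtain ⟨r, hr, rfl⟩ := canardCycle_eq hμ hβ h
  obtain ⟨h1, h2⟩ := hr.lam_mem hμ hβ
  obtain ⟨s, hs, ht, B⟩ := exists_isBasin_cycle hμ hβ h1 h2
  obtain rfl := hr.eq hμ hβ hs
  exact attractingCycleI_cycleSet hμ hβ hr ht B

theorem setOf_otherCycle (hμ : μ < 0) (hlam : lam < 1) :
    {Γ | (foldSaddle lam μ β).CanardCycle Γ ∧ ¬ (foldSaddle lam μ β).AttractingCycleI Γ ∧
      ¬ (foldSaddle lam μ β).RepellingCycleI Γ} = ∅ :=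
  eq_empty_of_forall_notMem fun _ h => h.2.1 (attractingCycleI_of_canardCycle hμ hlam h.1)

theorem setOf_attractingCycleI_of_mem (hμ : μ < 0) (hβ : 0 < β) (h1 : tangency μ β < lam)
    (h2 : lam < 0) : ∃ Γ, {Γ | (foldSaddle lam μ β).AttractingCycleI Γ} = {Γ} := by
  obtain ⟨r, hr, ht, B⟩ := exists_isBasin_cycle hμ hβ h1 h2
  refine ⟨cycleSet lam μ β r, ?_⟩
  ext Γ
  constructor
  · intro h
    obtain ⟨s, hs, rfl⟩ := canardCycle_eq hμ hβ h.1.1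
    rw [hr.eq hμ hβ hs]
    rfl
  · rintro rfl
    exact attractingCycleI_cycleSet hμ hβ hr ht B

theorem setOf_attractingCycleI_of_notMem (hμ : μ < 0) (hlam : lam < 1)
    (h : ¬ (0 < β ∧ tangency μ β < lam ∧ lam < 0)) :
    {Γ | (foldSaddle lam μ β).AttractingCycleI Γ} = ∅ := by
  refine eq_empty_of_forall_notMem fun Γ hΓ => ?_
  rcases le_or_gt β 0 with hβ | hβ
  · exact not_canardCycle_of_nonpos hμ hβ hlam hΓ.1.1
  · obtain ⟨r, hr, -⟩ := canardCycle_eq hμ hβ hΓ.1.1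
    exact h ⟨hβ, hr.lam_mem hμ hβ⟩

/-! ### Zeros of a continuous function on the line -/

theorem neg_of_ne_zero {y : ℝ → ℝ} (hc : Continuous y) {I : Set ℝ} (hI : I.OrdConnected)
    (hne : ∀ t ∈ I, y t ≠ 0) {s t : ℝ} (hs : s ∈ I) (hys : y s < 0) (ht : t ∈ I) : y t < 0 := by
  by_contra! h
  obtain ⟨r, hr, hr'⟩ := intermediate_value_uIcc (hc.continuousOn (s := uIcc s t))
    (mem_uIcc.2 (Or.inl ⟨hys.le, h⟩))
  exact hne r (hI.uIcc_subset hs ht hr) hr'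

theorem pos_of_ne_zero {y : ℝ → ℝ} (hc : Continuous y) {I : Set ℝ} (hI : I.OrdConnected)
    (hne : ∀ t ∈ I, y t ≠ 0) {s t : ℝ} (hs : s ∈ I) (hys : 0 < y s) (ht : t ∈ I) : 0 < y t := by
  have := neg_of_ne_zero hc.neg hI (fun t ht => neg_ne_zero.2 (hne t ht)) hs (neg_neg_of_pos hys) ht
  exact neg_neg_iff_pos.1 this

theorem exists_next_zero {y : ℝ → ℝ} (hc : Continuous y) {a b : ℝ} (hab : a < b) (hb : y b = 0)
    (ha : ∀ᶠ s in 𝓝[>] a, y s ≠ 0) : ∃ c, a < c ∧ c ≤ b ∧ y c = 0 ∧ ∀ t ∈ Ioo a c, y t ≠ 0 := by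
  obtain ⟨u, hu, hu'⟩ := mem_nhdsGT_iff_exists_Ioo_subset.1 ha
  have hau : a < u := hu
  have hub : u ≤ b := by
    by_contra! h
    exact hu' ⟨hab, h⟩ hb
  have hK : IsCompact (Icc u b ∩ y ⁻¹' {0}) :=
    isCompact_Icc.inter_right (isClosed_singleton.preimage hc)
  obtain ⟨c, ⟨hc1, hc2⟩, hc3⟩ := hK.exists_isLeast ⟨b, ⟨hub, le_rfl⟩, hb⟩
  refine ⟨c, hau.trans_le hc1.1, hc1.2, hc2, fun t ht ht0 => ?_⟩
  rcases lt_or_ge t u with h | h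
  · exact hu' ⟨ht.1, h⟩ ht0
  · exact (hc3 ⟨⟨h, ht.2.le.trans hc1.2⟩, ht0⟩).not_gt ht.2

theorem exists_prev_zero {y : ℝ → ℝ} (hc : Continuous y) {a b : ℝ} (hab : a < b) (ha : y a = 0)
    (hb : ∀ᶠ s in 𝓝[<] b, y s ≠ 0) : ∃ c, a ≤ c ∧ c < b ∧ y c = 0 ∧ ∀ t ∈ Ioo c b, y t ≠ 0 := by
  have h1 : ∀ᶠ s in 𝓝[>] (-b), y (-s) ≠ 0 := by
    have : Tendsto (fun s : ℝ => -s) (𝓝[>] (-b)) (𝓝[<] b) := by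
      simpa using tendsto_neg_nhdsGT (a := -b)
    exact this.eventually hb
  obtain ⟨c, h2, h3, h4, h5⟩ := exists_next_zero (y := fun s => y (-s)) (hc.comp continuous_neg)
    (neg_lt_neg hab) (by simpa using ha) h1
  refine ⟨-c, by linarith, by linarith, h4, fun t ht => ?_⟩
  have := h5 (-t) ⟨by linarith [ht.2], by linarith [ht.1]⟩
  simpa using this

theorem eventually_gt_of_hasDerivWithinAt {f : ℝ → ℝ} {f' a : ℝ}
    (h : HasDerivWithinAt f f' (Ici a) a) (h0 : f a = 0) (hf : 0 < f') :
    ∀ᶠ s in 𝓝[>] a, 0 < f s := by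
  have h1 := (hasDerivWithinAt_iff_tendsto_slope.1 h).eventually (eventually_gt_nhds hf)
  rw [Ici_sdiff_left] at h1
  filter_upwards [h1, self_mem_nhdsWithin] with s hs hs'
  rw [slope_def_field, h0, sub_zero] at hs
  have : 0 < s - a := sub_pos.2 hs'
  exact (div_pos_iff_of_pos_right this).1 hs

theorem eventually_lt_of_hasDerivWithinAt {f : ℝ → ℝ} {f' a : ℝ}
    (h : HasDerivWithinAt f f' (Iic a) a) (h0 : f a = 0) (hf : 0 < f') :
    ∀ᶠ s in 𝓝[<] a, f s < 0 := by
  have h1 := (hasDerivWithinAt_iff_tendsto_slope.1 h).eventually (eventually_gt_nhds hf)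
  rw [Iic_sdiff_right] at h1
  filter_upwards [h1, self_mem_nhdsWithin] with s hs hs'
  rw [slope_def_field, h0, sub_zero] at hs
  have : s - a < 0 := sub_neg.2 hs'
  rcases div_pos_iff.1 hs with h | h
  · linarith [h.2]
  · exact h.1

/-! ### Crossing trajectories -/

theorem continuous_of_crossingTrajectory {Z : NSVF} {γ : ℝ → ℝ × ℝ} (h : Z.CrossingTrajectory γ) :
    Continuous γ := by
  refine continuous_iff_continuousAt.2 fun t => ?_
  obtain ⟨h1, h2, h3⟩ := h t
  rcases lt_trichotomy (γ t).2 0 with h' | h' | h'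
  · exact (h2 h').continuousAt
  · rw [continuousAt_iff_continuous_left_right]
    rcases h3 h' with ⟨-, -, h4, h5⟩ | ⟨-, -, h4, h5⟩ <;>
      exact ⟨h4.continuousWithinAt, h5.continuousWithinAt⟩
  · exact (h1 h').continuousAt

theorem hasDerivWithinAt_snd_comp {γ : ℝ → ℝ × ℝ} {w : ℝ × ℝ} {s : Set ℝ} {t : ℝ}
    (h : HasDerivWithinAt γ w s t) : HasDerivWithinAt (fun t => (γ t).2) w.2 s t :=
  ((ContinuousLinearMap.snd ℝ ℝ ℝ).hasFDerivAt (x := γ t)).comp_hasDerivWithinAt t h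

theorem mk_zero_of_snd_eq_zero {p : ℝ × ℝ} (h : p.2 = 0) : p = (p.1, 0) := Prod.ext rfl h

theorem crossing_right_pos {Z : NSVF} {γ : ℝ → ℝ × ℝ} (h : Z.CrossingTrajectory γ) {t : ℝ}
    (ht : (γ t).2 = 0) (hY : 0 < Z.Yf (γ t).1) :
    0 < Z.Xf (γ t).1 ∧ (∀ᶠ s in 𝓝[>] t, 0 < (γ s).2) ∧ ∀ᶠ s in 𝓝[<] t, (γ s).2 < 0 := by
  rcases (h t).2.2 ht with ⟨h1, h2, h3, h4⟩ | ⟨-, h2, -⟩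
  · refine ⟨h1, ?_, ?_⟩
    · refine eventually_gt_of_hasDerivWithinAt (hasDerivWithinAt_snd_comp h4) ht ?_
      rw [mk_zero_of_snd_eq_zero ht]
      exact h1
    · refine eventually_lt_of_hasDerivWithinAt (hasDerivWithinAt_snd_comp h3) ht ?_
      rw [mk_zero_of_snd_eq_zero ht]
      exact h2
  · linarith

theorem crossing_right_neg {Z : NSVF} {γ : ℝ → ℝ × ℝ} (h : Z.CrossingTrajectory γ) {t : ℝ}
    (ht : (γ t).2 = 0) (hY : Z.Yf (γ t).1 < 0) :
    (∀ᶠ s in 𝓝[>] t, (γ s).2 < 0) ∧ ∀ᶠ s in 𝓝[<] t, 0 < (γ s).2 := by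
  rcases (h t).2.2 ht with ⟨-, h2, -⟩ | ⟨h1, h2, h3, h4⟩
  · linarith
  · constructor
    · have := eventually_gt_of_hasDerivWithinAt (hasDerivWithinAt_snd_comp h4).neg
        (by simpa using ht) (by rw [mk_zero_of_snd_eq_zero ht]; exact neg_pos.2 h2)
      exact this.mono fun s hs => neg_pos.1 hs
    · have := eventually_lt_of_hasDerivWithinAt (hasDerivWithinAt_snd_comp h3).neg
        (by simpa using ht) (by rw [mk_zero_of_snd_eq_zero ht]; exact neg_pos.2 h1)
      exact this.mono fun s hs => neg_neg_iff_pos.1 hs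

theorem isArc_of_crossingTrajectory {Z : NSVF} {γ : ℝ → ℝ × ℝ} (hc : Continuous γ)
    {k : NSVF.ArcKind} {a c : ℝ} (hac : a < c) (ha : (γ a).2 = 0) (hc0 : (γ c).2 = 0)
    (hk : k = .ofX ∨ k = .ofY) (hs : ∀ t ∈ Ioo a c, Z.SolvesAt γ t k) :
    ∃ C, Z.IsArc k (γ a).1 (γ c).1 C := by
  refine ⟨_, c - a, sub_pos.2 hac, fun t => γ (a + t), by fun_prop, ?_, ?_, rfl, fun t ht => ?_⟩
  · simpa using mk_zero_of_snd_eq_zero ha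
  · simpa using mk_zero_of_snd_eq_zero hc0
  · have h1 := hs (a + t) ⟨by linarith [ht.1], by linarith [ht.2]⟩
    rcases hk with rfl | rfl
    · exact ⟨h1.1, h1.2.comp_const_add a t⟩
    · exact ⟨h1.1, h1.2.comp_const_add a t⟩

/-- A sewing crossing is transversal, so its successor on `Σ` exists and the second coordinate has
one sign in between. This cuts a trajectory into arcs of the two fields, to which their
classification applies. -/
theorem exists_next_crossing {Z : NSVF} {γ : ℝ → ℝ × ℝ} (h : Z.CrossingTrajectory γ) {a b : ℝ}
    (hab : a < b) (ha : (γ a).2 = 0) (hb : (γ b).2 = 0) (hY : Z.Yf (γ a).1 ≠ 0) :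
    ∃ c, a < c ∧ c ≤ b ∧ (γ c).2 = 0 ∧
      ((0 < Z.Yf (γ a).1 ∧ ∀ t ∈ Ioo a c, Z.SolvesAt γ t .ofX) ∨
        (Z.Yf (γ a).1 < 0 ∧ ∀ t ∈ Ioo a c, Z.SolvesAt γ t .ofY)) := by
  have hc : Continuous fun t => (γ t).2 := continuous_snd.comp (continuous_of_crossingTrajectory h)
  rcases hY.lt_or_gt with hY | hY
  · have h1 := (crossing_right_neg h ha hY).1
    obtain ⟨c, h2, h3, h4, h5⟩ := exists_next_zero hc hab hb (h1.mono fun s hs => hs.ne)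
    obtain ⟨s, hs, hs'⟩ := (h1.and (Ioo_mem_nhdsGT h2)).exists
    refine ⟨c, h2, h3, h4, Or.inr ⟨hY, fun t ht => ?_⟩⟩
    have := neg_of_ne_zero hc ordConnected_Ioo h5 hs' hs ht
    exact ⟨this, (h t).2.1 this⟩
  · have h1 := (crossing_right_pos h ha hY).2.1
    obtain ⟨c, h2, h3, h4, h5⟩ := exists_next_zero hc hab hb (h1.mono fun s hs => hs.ne')
    obtain ⟨s, hs, hs'⟩ := (h1.and (Ioo_mem_nhdsGT h2)).exists
    refine ⟨c, h2, h3, h4, Or.inl ⟨hY, fun t ht => ?_⟩⟩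
    have := pos_of_ne_zero hc ordConnected_Ioo h5 hs' hs ht
    exact ⟨this, (h t).1 this⟩

theorem exists_prev_crossing {Z : NSVF} {γ : ℝ → ℝ × ℝ} (h : Z.CrossingTrajectory γ) {a b : ℝ}
    (hab : a < b) (ha : (γ a).2 = 0) (hb : (γ b).2 = 0) (hY : Z.Yf (γ b).1 ≠ 0) :
    ∃ c, a ≤ c ∧ c < b ∧ (γ c).2 = 0 ∧
      ((Z.Yf (γ b).1 < 0 ∧ ∀ t ∈ Ioo c b, Z.SolvesAt γ t .ofX) ∨
        (0 < Z.Yf (γ b).1 ∧ ∀ t ∈ Ioo c b, Z.SolvesAt γ t .ofY)) := by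
  have hc : Continuous fun t => (γ t).2 := continuous_snd.comp (continuous_of_crossingTrajectory h)
  rcases hY.lt_or_gt with hY | hY
  · have h1 := (crossing_right_neg h hb hY).2
    obtain ⟨c, h2, h3, h4, h5⟩ := exists_prev_zero hc hab ha (h1.mono fun s hs => hs.ne')
    obtain ⟨s, hs, hs'⟩ := (h1.and (Ioo_mem_nhdsLT h3)).exists
    refine ⟨c, h2, h3, h4, Or.inl ⟨hY, fun t ht => ?_⟩⟩
    have := pos_of_ne_zero hc ordConnected_Ioo h5 hs' hs ht
    exact ⟨this, (h t).1 this⟩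
  · have h1 := (crossing_right_pos h hb hY).2.2
    obtain ⟨c, h2, h3, h4, h5⟩ := exists_prev_zero hc hab ha (h1.mono fun s hs => hs.ne)
    obtain ⟨s, hs, hs'⟩ := (h1.and (Ioo_mem_nhdsLT h3)).exists
    refine ⟨c, h2, h3, h4, Or.inr ⟨hY, fun t ht => ?_⟩⟩
    have := neg_of_ne_zero hc ordConnected_Ioo h5 hs' hs ht
    exact ⟨this, (h t).2.1 this⟩

/-! ### The homoclinic loop -/

/-- The homoclinic trajectory of the saddle for `lam = 0`. -/
def loop (μ β t : ℝ) : ℝ × ℝ :=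
  if t ≤ 0 then flowY μ β 0 (-(2 * β)) t
  else if t ≤ 2 * β then flowX 0 (-β, 0) t
  else flowY μ β (2 * β) 0 (t - 2 * β)

theorem loop_of_nonpos {t : ℝ} (h : t ≤ 0) : loop μ β t = flowY μ β 0 (-(2 * β)) t := if_pos h

/-- The pieces agree at the switching times `0` and `2 * β`, the latter being the duration of the
upper arc from `-β` to `β`. So each formula holds on a closed interval and supplies the one-sided
derivatives at the crossings. -/
theorem loop_of_mem {t : ℝ} (h0 : 0 ≤ t) (h : t ≤ 2 * β) : loop μ β t = flowX 0 (-β, 0) t := by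
  rcases h0.eq_or_lt with rfl | h0
  · rw [loop_of_nonpos le_rfl]
    simp only [flowY, flowX, Real.exp_zero]
    ext <;> simp
    ring
  · rw [loop, if_neg h0.not_ge, if_pos h]

theorem loop_of_ge (hβ : 0 < β) {t : ℝ} (h : 2 * β ≤ t) :
    loop μ β t = flowY μ β (2 * β) 0 (t - 2 * β) := by
  rcases h.eq_or_lt with rfl | h
  · rw [loop_of_mem (by linarith) le_rfl]
    simp only [flowY, flowX, sub_self, mul_zero, Real.exp_zero]
    ext <;> simp <;> ring
  · rw [loop, if_neg (by linarith), if_neg h.not_ge]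

theorem loop_zero (hβ : 0 < β) : loop μ β 0 = (-β, 0) := by
  rw [loop_of_mem le_rfl (by linarith)]
  simp [flowX]

theorem loop_two_mul (hβ : 0 < β) : loop μ β (2 * β) = (β, 0) := by
  rw [loop_of_mem (by linarith) le_rfl]
  simp only [flowX]
  ext <;> simp <;> ring

theorem loop_snd_neg (hμ : μ < 0) (hβ : 0 < β) {t : ℝ} (h : t < 0 ∨ 2 * β < t) :
    (loop μ β t).2 < 0 := by
  rcases h with h | h
  · rw [loop_of_nonpos h.le, flowY]
    have : Real.exp t < 1 := Real.exp_lt_one_iff.2 h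
    simp only
    nlinarith
  · rw [loop_of_ge hβ h.le, flowY]
    have : Real.exp ((μ - 1) * (t - 2 * β)) < 1 := Real.exp_lt_one_iff.2 (by nlinarith)
    simp only
    nlinarith

theorem loop_snd_pos {t : ℝ} (h0 : 0 < t) (h : t < 2 * β) : 0 < (loop μ β t).2 := by
  rw [loop_of_mem h0.le h.le, flowX]
  have := mul_pos h0 (sub_pos.2 h)
  simp only
  linarith

theorem loop_snd_eq_zero (hμ : μ < 0) (hβ : 0 < β) {t : ℝ} (h : (loop μ β t).2 = 0) :
    t = 0 ∨ t = 2 * β := by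
  by_contra! hne
  rcases hne.1.lt_or_gt with h1 | h1
  · exact (loop_snd_neg hμ hβ (Or.inl h1)).ne h
  rcases hne.2.lt_or_gt with h2 | h2
  · exact (loop_snd_pos h1 h2).ne' h
  · exact (loop_snd_neg hμ hβ (Or.inr h2)).ne h

theorem crossingTrajectory_loop (hμ : μ < 0) (hβ : 0 < β) :
    (foldSaddle 0 μ β).CrossingTrajectory (loop μ β) := by
  have htan := tangency_neg hμ hβ
  have hn := neg_lt_tangency hμ hβ
  have hX : ∀ t, HasDerivAt (flowX 0 (-β, 0)) ((foldSaddle 0 μ β).X (flowX 0 (-β, 0) t)) t :=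
    fun t => hasDerivAt_flowX _ _
  have hY1 : ∀ t, HasDerivAt (flowY μ β 0 (-(2 * β)))
      ((foldSaddle 0 μ β).Y (flowY μ β 0 (-(2 * β)) t)) t := fun t => hasDerivAt_flowY _ _ _
  have hY2 : ∀ t, HasDerivAt (fun t => flowY μ β (2 * β) 0 (t - 2 * β))
      ((foldSaddle 0 μ β).Y (flowY μ β (2 * β) 0 (t - 2 * β))) t :=
    fun t => (hasDerivAt_flowY _ _ _).comp_sub_const t _
  intro t
  rcases lt_trichotomy t 0 with h | rfl | h
  · have hs := loop_snd_neg (μ := μ) (t := t) hμ hβ (Or.inl h)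
    refine ⟨fun h' => by linarith, fun _ => ?_, fun h' => by linarith⟩
    rw [loop_of_nonpos h.le]
    refine (hY1 t).congr_of_eventuallyEq ?_
    filter_upwards [eventually_lt_nhds h] with s hs using loop_of_nonpos hs.le
  · rw [loop_zero hβ]
    refine ⟨fun h' => absurd h' (lt_irrefl _), fun h' => absurd h' (lt_irrefl _),
      fun _ => Or.inl ⟨Xf_pos_iff.2 (by simp only; linarith), (Yf_pos_iff hμ).2 hn, ?_, ?_⟩⟩
    · rw [← loop_zero (μ := μ) hβ, loop_of_nonpos le_rfl]
      exact (hY1 0).hasDerivWithinAt.congr (fun s hs => loop_of_nonpos hs) (loop_of_nonpos le_rfl)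
    · rw [← loop_zero (μ := μ) hβ, loop_of_mem le_rfl (by linarith)]
      refine (hX 0).hasDerivWithinAt.congr_of_eventuallyEq ?_ (loop_of_mem le_rfl (by linarith))
      filter_upwards [self_mem_nhdsWithin, nhdsWithin_le_nhds
        (eventually_lt_nhds (by linarith : 0 < 2 * β))] with s hs hs' using loop_of_mem hs hs'.le
  rcases lt_trichotomy t (2 * β) with h2 | rfl | h2
  · have hs := loop_snd_pos (μ := μ) h h2
    refine ⟨fun _ => ?_, fun h' => by linarith, fun h' => by linarith⟩
    rw [loop_of_mem h.le h2.le]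
    refine (hX t).congr_of_eventuallyEq ?_
    filter_upwards [eventually_lt_nhds h2, eventually_gt_nhds h] with s hs hs'
      using loop_of_mem hs'.le hs.le
  · rw [loop_two_mul hβ]
    refine ⟨fun h' => absurd h' (lt_irrefl _), fun h' => absurd h' (lt_irrefl _),
      fun _ => Or.inr ⟨Xf_neg_iff.2 hβ, (Yf_neg_iff hμ).2 (by simp only; linarith), ?_, ?_⟩⟩
    · rw [← loop_two_mul (μ := μ) hβ, loop_of_mem h.le le_rfl]
      refine (hX _).hasDerivWithinAt.congr_of_eventuallyEq ?_ (loop_of_mem h.le le_rfl)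
      filter_upwards [self_mem_nhdsWithin, nhdsWithin_le_nhds (eventually_gt_nhds h)]
        with s hs hs' using loop_of_mem hs'.le hs
    · rw [← loop_two_mul (μ := μ) hβ, loop_of_ge hβ le_rfl]
      exact (hY2 _).hasDerivWithinAt.congr (fun s hs => loop_of_ge hβ hs) (loop_of_ge hβ le_rfl)
  · have hs := loop_snd_neg (μ := μ) (t := t) hμ hβ (Or.inr h2)
    refine ⟨fun h' => by linarith, fun _ => ?_, fun h' => by linarith⟩
    rw [loop_of_ge hβ h2.le]
    refine (hY2 t).congr_of_eventuallyEq ?_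
    filter_upwards [eventually_gt_nhds h2] with s hs using loop_of_ge hβ hs.le

theorem tendsto_loop_atBot : Tendsto (loop μ β) atBot (𝓝 (0, -β)) :=
  (tendsto_flowY_atBot _).congr' <| by
    filter_upwards [eventually_le_atBot 0] with t ht using (loop_of_nonpos ht).symm

theorem tendsto_loop_atTop (hμ : μ < 0) (hβ : 0 < β) :
    Tendsto (loop μ β) atTop (𝓝 (0, -β)) :=
  ((tendsto_flowY_atTop hμ _).comp (tendsto_atTop_add_const_right _ (-(2 * β)) tendsto_id)).congr' <|
    by filter_upwards [eventually_ge_atTop (2 * β)] with t ht using (loop_of_ge hβ ht).symm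

/-- A homoclinic trajectory of the saddle that meets the switching line, only in sewing points, is
the loop, and it exists only for `lam = 0`. -/
theorem homoclinic_eq_loop (hμ : μ < 0) (hβ : 0 < β) {γ : ℝ → ℝ × ℝ}
    (h : (foldSaddle lam μ β).CrossingTrajectory γ) (hbot : Tendsto γ atBot (𝓝 (0, -β)))
    (htop : Tendsto γ atTop (𝓝 (0, -β))) {t₀ : ℝ} (h₀ : (γ t₀).2 = 0) :
    lam = 0 ∧ ∃ a, ∀ t, γ t = loop μ β (t - a) := by
  have htan := tangency_neg hμ hβ
  have hn := neg_lt_tangency hμ hβ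
  have hγ := continuous_of_crossingTrajectory h
  have hc : Continuous fun t => (γ t).2 := continuous_snd.comp hγ
  have hbot' : ∀ᶠ t in atBot, (γ t).2 < 0 :=
    ((continuous_snd.tendsto _).comp hbot).eventually (eventually_lt_nhds (by simpa using hβ))
  have htop' : ∀ᶠ t in atTop, (γ t).2 < 0 :=
    ((continuous_snd.tendsto _).comp htop).eventually (eventually_lt_nhds (by simpa using hβ))
  obtain ⟨m, hm⟩ := eventually_atBot.1 hbot'
  obtain ⟨M, hM⟩ := eventually_atTop.1 htop'
  -- Near both ends of time the trajectory is close to the saddle, hence below the line. So there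
  -- are a first and a last crossing, and the tails beyond them are the two separatrices.
  have hK : IsCompact ((fun t => (γ t).2) ⁻¹' {0}) := by
    refine isCompact_Icc.of_isClosed_subset (isClosed_singleton.preimage hc) (s := Icc m M) ?_
    intro t ht
    have ht' : (γ t).2 = 0 := ht
    constructor <;> by_contra! hlt
    · linarith [hm t hlt.le]
    · linarith [hM t hlt.le]
  obtain ⟨t₁, ht₁, hleast⟩ := hK.exists_isLeast ⟨t₀, h₀⟩
  obtain ⟨t₂, ht₂, hgreat⟩ := hK.exists_isGreatest ⟨t₀, h₀⟩
  have ht₁ : (γ t₁).2 = 0 := ht₁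
  have ht₂ : (γ t₂).2 = 0 := ht₂
  have hneg₁ : ∀ t < t₁, (γ t).2 < 0 := fun t ht =>
    neg_of_ne_zero hc ordConnected_Iio (fun s hs hs0 => (hleast hs0).not_gt hs)
      (s := min m (t₁ - 1)) ((min_le_right _ _).trans_lt (sub_one_lt t₁))
      (hm _ (min_le_left _ _)) ht
  have hneg₂ : ∀ t > t₂, (γ t).2 < 0 := fun t ht =>
    neg_of_ne_zero hc ordConnected_Ioi (fun s hs hs0 => (hgreat hs0).not_gt hs)
      (s := max M (t₂ + 1)) ((lt_add_one t₂).trans_le (le_max_right _ _))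
      (hM _ (le_max_left _ _)) ht
  have hs₁ : ∀ t ≤ t₁, _ := fun t ht => flowY_isSolution_of_nonpos hγ.continuousOn
    (fun s hs => (h s).2.1 (hneg₁ s hs)) ht
  have hs₂ : ∀ t ≥ t₂, _ := fun t ht => flowY_isSolution_of_nonneg hγ.continuousOn
    (fun s hs => (h s).2.1 (hneg₂ s hs)) ht
  have hx₁ := eq_zero_of_tendsto_atBot hμ hs₁ hbot
  have hx₂ := eq_zero_of_tendsto_atTop hs₂ htop
  rw [ht₁] at hx₁
  rw [ht₂] at hx₂
  have hx₁' : (γ t₁).1 = -β := by linarith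
  have hx₂' : (γ t₂).1 = β := by linarith
  have h12 : t₁ < t₂ := by
    refine lt_of_le_of_ne (hleast ht₂) fun he => ?_
    rw [he] at hx₁'
    linarith
  have hY₁ : 0 < (foldSaddle lam μ β).Yf (γ t₁).1 := (Yf_pos_iff hμ).2 (by linarith)
  have hY₂ : (foldSaddle lam μ β).Yf (γ t₂).1 < 0 := (Yf_neg_iff hμ).2 (by linarith)
  -- For `lam < 0`, go back from the last crossing `β`: the upper arc starts at `2 * lam - β < -β`,
  -- where no lower arc ends. For `lam ≥ 0`, go forward from the first crossing `-β`: the upper arc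
  -- ends at `2 * lam + β ≥ β`, where no lower arc starts, so this is already the last crossing and
  -- `lam = 0`.
  rcases lt_or_ge lam 0 with hlam | hlam
  · exfalso
    obtain ⟨c, hc1, hc2, hc3, hc4⟩ := exists_prev_crossing h h12 ht₁ ht₂ hY₂.ne
    rcases hc4 with ⟨-, hc4⟩ | ⟨hc4, -⟩
    swap
    · linarith
    obtain ⟨C, hC⟩ := isArc_of_crossingTrajectory hγ hc2 hc3 ht₂ (Or.inl rfl) hc4
    have hxc := (isArcX_iff.1 hC).2.1
    have hc1' : t₁ < c := by
      refine lt_of_le_of_ne hc1 fun he => ?_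
      rw [← he] at hxc
      linarith
    have hYc : 0 < (foldSaddle lam μ β).Yf (γ c).1 := (Yf_pos_iff hμ).2 (by linarith)
    obtain ⟨d, hd1, hd2, hd3, hd4⟩ := exists_prev_crossing h hc1' ht₁ hc3 hYc.ne'
    rcases hd4 with ⟨hd4, -⟩ | ⟨-, hd4⟩
    · linarith
    obtain ⟨D, hD⟩ := isArc_of_crossingTrajectory hγ hd2 hd3 hc3 (Or.inr rfl) hd4
    linarith [((isArcY_iff hμ hβ).1 hD).2.2.1]
  · obtain ⟨c, hc1, hc2, hc3, hc4⟩ := exists_next_crossing h h12 ht₁ ht₂ hY₁.ne'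
    rcases hc4 with ⟨-, hc4⟩ | ⟨hc4, -⟩
    swap
    · linarith
    obtain ⟨C, hC⟩ := isArc_of_crossingTrajectory hγ hc1 ht₁ hc3 (Or.inl rfl) hc4
    have hxc := (isArcX_iff.1 hC).2.1
    have hc2' : c = t₂ := by
      by_contra hne
      have hYc : (foldSaddle lam μ β).Yf (γ c).1 < 0 := (Yf_neg_iff hμ).2 (by linarith)
      obtain ⟨d, hd1, hd2, hd3, hd4⟩ :=
        exists_next_crossing h (lt_of_le_of_ne hc2 hne) hc3 ht₂ hYc.ne
      rcases hd4 with ⟨hd4, -⟩ | ⟨-, hd4⟩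
      · linarith
      obtain ⟨D, hD⟩ := isArc_of_crossingTrajectory hγ hd1 hc3 hd3 (Or.inr rfl) hd4
      linarith [((isArcY_iff hμ hβ).1 hD).2.1]
    subst hc2'
    have hlam0 : lam = 0 := by linarith
    subst hlam0
    have hs : ∀ t ∈ Icc t₁ c, γ t = flowX 0 (-β, 0) (t - t₁) := by
      intro t ht
      have := eq_flowX ht.1 hγ.continuousOn fun s hs => (hc4 s ⟨hs.1, hs.2.trans_le ht.2⟩).2
      rwa [mk_zero_of_snd_eq_zero ht₁, hx₁'] at this
    have hT : c - t₁ = 2 * β := by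
      have := congrArg Prod.fst (hs c ⟨hc1.le, le_rfl⟩)
      simp only [flowX] at this
      linarith
    refine ⟨rfl, t₁, fun t => ?_⟩
    rcases le_total t t₁ with h1 | h1
    · rw [hs₁ t h1, loop_of_nonpos (by linarith), hx₁', ht₁]
      congr 1 <;> ring
    rcases le_total t c with h2 | h2
    · rw [hs t ⟨h1, h2⟩, loop_of_mem (by linarith) (by linarith)]
    · rw [hs₂ t h2, loop_of_ge hβ (by linarith), hx₂', ht₂]
      congr 1 <;> linarith

/-- A trajectory off the line that tends to the saddle in both directions has no component along
either eigendirection. Graphs may contain such constant trajectories, and they add no points. -/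
theorem homoclinic_eq_const (hμ : μ < 0) {γ : ℝ → ℝ × ℝ} (hβ : 0 < β)
    (h : (foldSaddle lam μ β).CrossingTrajectory γ) (hbot : Tendsto γ atBot (𝓝 (0, -β)))
    (htop : Tendsto γ atTop (𝓝 (0, -β))) (hne : ∀ t, (γ t).2 ≠ 0) (t : ℝ) : γ t = (0, -β) := by
  have hγ := continuous_of_crossingTrajectory h
  have hc : Continuous fun t => (γ t).2 := continuous_snd.comp hγ
  have hbot' : ∀ᶠ t in atBot, (γ t).2 < 0 :=
    ((continuous_snd.tendsto _).comp hbot).eventually (eventually_lt_nhds (by simpa using hβ))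
  obtain ⟨m, hm⟩ := hbot'.exists
  have hneg : ∀ t, (γ t).2 < 0 := fun t =>
    neg_of_ne_zero hc ordConnected_univ (fun s _ => hne s) (mem_univ m) hm (mem_univ t)
  have hs₁ : ∀ s ≤ t, _ := fun s hs => flowY_isSolution_of_nonpos hγ.continuousOn
    (fun s _ => (h s).2.1 (hneg s)) hs
  have hs₂ : ∀ s ≥ t, _ := fun s hs => flowY_isSolution_of_nonneg hγ.continuousOn
    (fun s _ => (h s).2.1 (hneg s)) hs
  have h1 := eq_zero_of_tendsto_atBot hμ hs₁ hbot
  have h2 := eq_zero_of_tendsto_atTop hs₂ htop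
  ext <;> simp <;> linarith

/-- The closed curve formed by the saddle and its homoclinic trajectory. -/
def loopSet (μ β : ℝ) : Set (ℝ × ℝ) := {(0, -β)} ∪ range (loop μ β)

theorem mem_loopSet_iff (hμ : μ < 0) (hβ : 0 < β) {w : ℝ} :
    (w, (0 : ℝ)) ∈ loopSet μ β ↔ w = -β ∨ w = β := by
  constructor
  · rintro (h | ⟨t, ht⟩)
    · simp only [mem_singleton_iff, Prod.mk.injEq] at h
      linarith [h.2]
    · rcases loop_snd_eq_zero hμ hβ (t := t) (by rw [ht]) with rfl | rfl
      · rw [loop_zero hβ, Prod.mk.injEq] at ht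
        exact Or.inl ht.1.symm
      · rw [loop_two_mul hβ, Prod.mk.injEq] at ht
        exact Or.inr ht.1.symm
  · rintro (rfl | rfl)
    · exact Or.inr ⟨0, loop_zero hβ⟩
    · exact Or.inr ⟨_, loop_two_mul hβ⟩

theorem graphI_loopSet (hμ : μ < 0) (hβ : 0 < β) :
    (foldSaddle 0 μ β).GraphI (loopSet μ β) := by
  refine ⟨⟨(β, 0), (mem_loopSet_iff hμ hβ).2 (Or.inr rfl), rfl⟩, 0, fun _ => (0, -β),
    fun _ => loop μ β, ?_, fun _ => ⟨(equilibrium_iff hμ).2 ⟨hβ, rfl⟩,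
      crossingTrajectory_loop hμ hβ, tendsto_loop_atBot, tendsto_loop_atTop hμ hβ⟩⟩
  rw [iUnion_const]
  rfl

/-- The saddle is the only equilibrium, so every trajectory of a graph is homoclinic: it is the loop
up to a shift of time, or constant. Meeting `Σ` forces at least one of them to be the loop. -/
theorem graphI_eq (hμ : μ < 0) {Δ : Set (ℝ × ℝ)} (h : (foldSaddle lam μ β).GraphI Δ) :
    0 < β ∧ lam = 0 ∧ Δ = loopSet μ β := by
  obtain ⟨⟨p, hp, hp0⟩, n, v, γ, rfl, hall⟩ := h
  have hβ : 0 < β := ((equilibrium_iff hμ).1 (hall 0).1).1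
  have hv : ∀ i, v i = (0, -β) := fun i => ((equilibrium_iff hμ).1 (hall i).1).2
  have hγ : ∀ i, (lam = 0 ∧ range (γ i) = range (loop μ β)) ∨
      ((∀ t, (γ i t).2 ≠ 0) ∧ range (γ i) ⊆ {(0, -β)}) := by
    intro i
    obtain ⟨-, h1, h2, h3⟩ := hall i
    rw [hv] at h2 h3
    by_cases hz : ∃ t, (γ i t).2 = 0
    · obtain ⟨t, ht⟩ := hz
      obtain ⟨h4, a, ha⟩ := homoclinic_eq_loop hμ hβ h1 h2 h3 ht
      refine Or.inl ⟨h4, ?_⟩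
      rw [show γ i = loop μ β ∘ Equiv.subRight a from funext ha,
        (Equiv.subRight a).surjective.range_comp]
    · push Not at hz
      refine Or.inr ⟨hz, ?_⟩
      rintro _ ⟨t, rfl⟩
      exact homoclinic_eq_const hμ hβ h1 h2 h3 hz t
  refine ⟨hβ, ?_⟩
  obtain ⟨i, hi⟩ := mem_iUnion.1 hp
  have hp0 : p.2 = 0 := hp0
  have key : lam = 0 ∧ range (γ i) = range (loop μ β) := by
    rcases hγ i with h | ⟨h, -⟩
    · exact h
    · exfalso
      rcases hi with hi | ⟨t, rfl⟩
      · rw [mem_singleton_iff.1 hi, hv] at hp0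
        simp at hp0
        linarith
      · exact h t hp0
  refine ⟨key.1, ?_⟩
  apply subset_antisymm
  · refine iUnion_subset fun j => union_subset ?_ ?_
    · rw [hv]; exact subset_union_left
    · rcases hγ j with h | h
      · rw [h.2]; exact subset_union_right
      · exact h.2.trans subset_union_left
  · refine Subset.trans ?_ (subset_iUnion _ i)
    rw [hv, key.2]
    rfl

/-- A connected unbounded piece of `Σ` that avoids the curve lies in a single component of the
complement. This replaces any appeal to the Jordan curve theorem. -/
theorem not_inside_of_ray {Δ : Set (ℝ × ℝ)} {z : ℝ} {I : Set ℝ} (hI : IsPreconnected I)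
    (hz : z ∈ I) (hΔ : ∀ w ∈ I, (w, (0 : ℝ)) ∉ Δ) (hb : ¬ Bornology.IsBounded I) :
    ¬ NSVF.Inside Δ (z, 0) := by
  rintro ⟨-, h⟩
  have h1 : (fun w : ℝ => (w, (0 : ℝ))) '' I ⊆ connectedComponentIn Δᶜ (z, 0) := by
    refine (hI.image _ (by fun_prop)).subset_connectedComponentIn ⟨z, hz, rfl⟩ ?_
    rintro _ ⟨w, hw, rfl⟩
    exact hΔ w hw
  have h2 := ((h.subset h1).image_fst)
  rw [image_image] at h2
  simp only [image_id'] at h2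
  exact hb h2

/-- Points of `Σ` outside `[-β, β]` lie on a ray that avoids the loop, so inner points are in `(-β,
β)`. Removing the closed escaping segment from the neighbourhood leaves only points of the basin. -/
theorem attractingGraphI_loopSet (hμ : μ < 0) (hβ : 0 < β) :
    (foldSaddle 0 μ β).AttractingGraphI (loopSet μ β) := by
  have htan := tangency_neg hμ hβ
  have hn := neg_lt_tangency hμ hβ
  refine ⟨graphI_loopSet hμ hβ, ((Icc (tangency μ β) 0) ×ˢ {(0 : ℝ)})ᶜ,
    (isClosed_Icc.prod isClosed_singleton).isOpen_compl, ?_, ?_⟩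
  · rintro ⟨w, v⟩ hw ⟨h1, h2⟩
    simp only [mem_singleton_iff] at h2
    subst h2
    rw [mem_loopSet_iff hμ hβ] at hw
    simp only [mem_Icc] at h1
    rcases hw with rfl | rfl <;> linarith
  · intro z hz hin
    have hz1 : z < β := by
      by_contra! h
      rcases h.eq_or_lt with rfl | h
      · exact hin.1 ((mem_loopSet_iff hμ hβ).2 (Or.inr rfl))
      refine not_inside_of_ray (isPreconnected_Ici (a := z)) self_mem_Ici (fun w hw hw' => ?_)
        (fun hb => not_bddAbove_Ici z hb.bddAbove) hin
      rcases (mem_loopSet_iff hμ hβ).1 hw' with rfl | rfl <;> linarith [mem_Ici.1 hw]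
    have hz2 : -β < z := by
      by_contra! h
      rcases h.eq_or_lt with rfl | h
      · exact hin.1 ((mem_loopSet_iff hμ hβ).2 (Or.inl rfl))
      refine not_inside_of_ray (isPreconnected_Iic (a := z)) self_mem_Iic (fun w hw hw' => ?_)
        (fun hb => not_bddBelow_Iic z hb.bddBelow) hin
      rcases (mem_loopSet_iff hμ hβ).1 hw' with rfl | rfl <;> linarith [mem_Iic.1 hw]
    refine (isBasin_zero hμ hβ).attractedTo hμ hβ ((mem_loopSet_iff hμ hβ).2 (Or.inr rfl))
      ((mem_loopSet_iff hμ hβ).2 (Or.inl (by ring))) ?_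
    simp only [mem_compl_iff, mem_prod, mem_Icc, mem_singleton_iff, and_true, not_and, not_le] at hz
    rcases lt_or_ge z (tangency μ β) with h | h
    · exact Or.inr ⟨hz2, h⟩
    · exact Or.inl ⟨hz h, hz1⟩

theorem setOf_attractingGraphI_of_zero (hμ : μ < 0) (hβ : 0 < β) :
    {Δ | (foldSaddle 0 μ β).AttractingGraphI Δ} = {loopSet μ β} := by
  ext Δ
  constructor
  · exact fun h => (graphI_eq hμ h.1).2.2
  · rintro rfl
    exact attractingGraphI_loopSet hμ hβ

theorem setOf_attractingGraphI_of_ne (hμ : μ < 0) (h : ¬ (0 < β ∧ lam = 0)) :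
    {Δ | (foldSaddle lam μ β).AttractingGraphI Δ} = ∅ :=
  eq_empty_of_forall_notMem fun _ hΔ =>
    h ⟨(graphI_eq hμ hΔ.1).1, (graphI_eq hμ hΔ.1).2.1⟩

theorem setOf_otherGraphI (hμ : μ < 0) :
    {Δ | (foldSaddle lam μ β).GraphI Δ ∧ ¬ (foldSaddle lam μ β).AttractingGraphI Δ} = ∅ := by
  refine eq_empty_of_forall_notMem fun Δ ⟨h1, h2⟩ => h2 ?_
  obtain ⟨hβ, rfl, rfl⟩ := graphI_eq hμ h1
  exact attractingGraphI_loopSet hμ hβ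

/-! ### Order isomorphisms of the line with prescribed values -/

/-- The order isomorphism that fixes the points below `c` and stretches by `k` above. -/
def stretch (c k : ℝ) (hk : 0 < k) : ℝ ≃o ℝ :=
  StrictMono.orderIsoOfSurjective (fun x => if x ≤ c then x else c + k * (x - c))
    (by
      intro x y hxy
      simp only
      split_ifs with h1 h2 h2
      · exact hxy
      · have := mul_pos hk (sub_pos.2 (not_le.1 h2)); linarith
      · linarith
      · nlinarith)
    (by
      intro y
      rcases le_or_gt y c with h | h
      · exact ⟨y, if_pos h⟩
      · refine ⟨c + (y - c) / k, ?_⟩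
        have := div_pos (sub_pos.2 h) hk
        simp only
        rw [if_neg (by linarith)]
        field_simp
        ring)

theorem stretch_of_le {c k x : ℝ} (hk : 0 < k) (h : x ≤ c) : stretch c k hk x = x := if_pos h

theorem stretch_of_gt {c k x : ℝ} (hk : 0 < k) (h : c < x) :
    stretch c k hk x = c + k * (x - c) := if_neg h.not_ge

/-- Induction on the largest point `a`: with `c` at or above the images already fixed but below `φ
a` and `g a`, stretching beyond `c` by `(g a - c) / (φ a - c)` sends `φ a` to `g a` and moves no
earlier image. -/
theorem exists_orderIso_of_strictMonoOn (s : Finset ℝ) (g : ℝ → ℝ) (hg : StrictMonoOn g s) :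
    ∃ φ : ℝ ≃o ℝ, ∀ x ∈ s, φ x = g x := by
  induction s using Finset.induction_on_max with
  | empty => exact ⟨OrderIso.refl ℝ, by simp⟩
  | insert a s ha ih =>
    obtain ⟨φ, hφ⟩ := ih (hg.mono (by simp))
    obtain ⟨c, hc1, hc2, hc3⟩ : ∃ c, (∀ x ∈ s, φ x ≤ c) ∧ c < φ a ∧ c < g a := by
      rcases s.eq_empty_or_nonempty with rfl | hs
      · exact ⟨min (φ a) (g a) - 1, by simp, by linarith [min_le_left (φ a) (g a)],
          by linarith [min_le_right (φ a) (g a)]⟩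
      · have hm := s.max'_mem hs
        refine ⟨φ (s.max' hs), fun x hx => φ.monotone (s.le_max' x hx), φ.strictMono (ha _ hm), ?_⟩
        rw [hφ _ hm]
        exact hg (by simp [hm]) (by simp) (ha _ hm)
    refine ⟨φ.trans (stretch c ((g a - c) / (φ a - c))
      (div_pos (sub_pos.2 hc3) (sub_pos.2 hc2))), fun x hx => ?_⟩
    rw [OrderIso.trans_apply]
    rcases Finset.mem_insert.1 hx with rfl | hx
    · rw [stretch_of_gt _ hc2, div_mul_cancel₀ _ (sub_pos.2 hc2).ne']
      ring
    · rw [stretch_of_le _ (hc1 x hx), hφ x hx]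

/-- The indexed form allows coincidences among the points: the hypothesis makes `g` depend only on
the value of `f`. -/
theorem exists_orderIso {ι : Type*} [Finite ι] (f g : ι → ℝ) (h : ∀ i j, f i < f j ↔ g i < g j) :
    ∃ φ : ℝ ≃o ℝ, ∀ i, φ (f i) = g i := by
  classical
  have := Fintype.ofFinite ι
  have heq : ∀ i j, f i = f j → g i = g j := by
    intro i j hij
    refine le_antisymm (not_lt.1 fun hlt => ?_) (not_lt.1 fun hlt => ?_)
    · exact ((h j i).2 hlt).ne' hij
    · exact ((h i j).2 hlt).ne hij
  let G : ℝ → ℝ := fun x => if hx : ∃ i, f i = x then g hx.choose else 0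
  have hG : ∀ i, G (f i) = g i := by
    intro i
    have hx : ∃ j, f j = f i := ⟨i, rfl⟩
    simp only [G, dif_pos hx]
    exact heq _ _ hx.choose_spec
  obtain ⟨φ, hφ⟩ := exists_orderIso_of_strictMonoOn (Finset.univ.image f) G (by
    intro x hx y hy hxy
    simp only [Finset.coe_image, Finset.coe_univ, image_univ, mem_range] at hx hy
    obtain ⟨i, rfl⟩ := hx
    obtain ⟨j, rfl⟩ := hy
    rw [hG, hG]
    exact (h i j).1 hxy)
  exact ⟨φ, fun i => (hφ _ (by simp)).trans (hG i)⟩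

/-! ### The distinguished subsets of the switching line -/

theorem unstableSet_eq (hμ : μ < 0) :
    (foldSaddle lam μ β).unstableSet = {x | 0 < β ∧ x = -β} := by
  ext x
  simp only [NSVF.unstableSet, isSaddle_Y_iff hμ, mem_ofPred_eq]
  constructor
  · rintro ⟨v, hv, rfl, h⟩
    have hβ : 0 < β := by simpa using hv
    exact ⟨hβ, (unstableHit_iff hμ hβ).1 h⟩
  · rintro ⟨hβ, h⟩
    exact ⟨(0, -β), by simpa using hβ, rfl, (unstableHit_iff hμ hβ).2 h⟩

theorem stableSet_eq (hμ : μ < 0) :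
    (foldSaddle lam μ β).stableSet = {x | 0 < β ∧ x = β} := by
  ext x
  simp only [NSVF.stableSet, isSaddle_Y_iff hμ, mem_ofPred_eq]
  constructor
  · rintro ⟨v, hv, rfl, h⟩
    have hβ : 0 < β := by simpa using hv
    exact ⟨hβ, (stableHit_iff hμ hβ).1 h⟩
  · rintro ⟨hβ, h⟩
    exact ⟨(0, -β), by simpa using hβ, rfl, (stableHit_iff hμ hβ).2 h⟩

theorem marks_sewing (hμ : μ < 0) : (foldSaddle lam μ β).marks .sewing =
    {x | (x < lam ∧ x < tangency μ β) ∨ (lam < x ∧ tangency μ β < x)} := by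
  ext x; exact sewing_iff hμ

theorem marks_escaping (hμ : μ < 0) : (foldSaddle lam μ β).marks .escaping =
    {x | tangency μ β < x ∧ x < lam} := by
  ext x; exact (escaping_iff hμ).trans and_comm

theorem marks_sliding (hμ : μ < 0) : (foldSaddle lam μ β).marks .sliding =
    {x | lam < x ∧ x < tangency μ β} := by
  ext x; exact sliding_iff hμ

theorem marks_visibleFoldX : (foldSaddle lam μ β).marks .visibleFoldX = ∅ :=
  eq_empty_of_forall_notMem not_visibleFoldX

theorem marks_invisibleFoldX : (foldSaddle lam μ β).marks .invisibleFoldX = {x | x = lam} := by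
  ext x; exact invisibleFoldX_iff

theorem marks_visibleFoldY (hμ : μ < 0) : (foldSaddle lam μ β).marks .visibleFoldY =
    {x | β < 0 ∧ x = tangency μ β} := by
  ext x; exact visibleFoldY_iff hμ

theorem marks_invisibleFoldY (hμ : μ < 0) : (foldSaddle lam μ β).marks .invisibleFoldY =
    {x | 0 < β ∧ x = tangency μ β} := by
  ext x; exact invisibleFoldY_iff hμ

/-- The equilibrium on `Σ` is `0`, written as the tangency point so that an isomorphism matching
tangency points also matches equilibria. -/
theorem marks_equilibrium (hμ : μ < 0) : (foldSaddle lam μ β).marks .equilibrium =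
    {x | β = 0 ∧ x = tangency μ β} := by
  ext x
  simp only [NSVF.marks, X_ne_zero, false_or, Y_eq_zero_iff hμ, mem_ofPred_eq, Prod.mk.injEq]
  constructor
  · rintro ⟨rfl, h⟩
    have : β = 0 := by linarith
    exact ⟨this, by rw [this, tangency_zero]⟩
  · rintro ⟨rfl, rfl⟩
    simp [tangency_zero]

theorem marks_unstable (hμ : μ < 0) : (foldSaddle lam μ β).marks .unstable =
    {x | 0 < β ∧ x = -β} := unstableSet_eq hμ

theorem marks_stable (hμ : μ < 0) : (foldSaddle lam μ β).marks .stable =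
    {x | 0 < β ∧ x = β} := stableSet_eq hμ

theorem marks_unstableNext (hμ : μ < 0) : (foldSaddle lam μ β).marks .unstableNext =
    {x | 0 < β ∧ -β < lam ∧ x = 2 * lam + β} := by
  ext z
  simp only [NSVF.marks, unstableSet_eq hμ, isArcX_iff, mem_ofPred_eq]
  constructor
  · rintro ⟨x, ⟨h, rfl⟩, C, h1, rfl, -⟩
    exact ⟨h, h1, by ring⟩
  · rintro ⟨h, h1, rfl⟩
    exact ⟨_, ⟨h, rfl⟩, _, h1, by ring, rfl⟩

theorem marks_stablePrev (hμ : μ < 0) : (foldSaddle lam μ β).marks .stablePrev =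
    {x | 0 < β ∧ lam < β ∧ x = 2 * lam - β} := by
  ext z
  simp only [NSVF.marks, stableSet_eq hμ, isArcX_iff, mem_ofPred_eq]
  constructor
  · rintro ⟨x, ⟨h, rfl⟩, C, h1, h2, -⟩
    exact ⟨h, by linarith, by linarith⟩
  · rintro ⟨h, h1, rfl⟩
    exact ⟨_, ⟨h, rfl⟩, _, by linarith, by ring, rfl⟩

/-! ### Classification of configurations -/

/-- The values of `lam` at which the order of the distinguished points changes. -/
def threshold (μ β : ℝ) : Fin 6 → ℝ :=
  ![-β, (tangency μ β - β) / 2, tangency μ β, 0, (tangency μ β + β) / 2, β]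

/-- The distinguished points of two fields of the family have the same order. -/
structure SameOrder (μ lam β lam' β' : ℝ) : Prop where
  neg : β < 0 ↔ β' < 0
  pos : 0 < β ↔ 0 < β'
  lt : lam < tangency μ β ↔ lam' < tangency μ β'
  gt : tangency μ β < lam ↔ tangency μ β' < lam'
  lt_threshold : 0 < β → ∀ k, lam < threshold μ β k ↔ lam' < threshold μ β' k
  gt_threshold : 0 < β → ∀ k, threshold μ β k < lam ↔ threshold μ β' k < lam'

theorem configuration_eq_iff_exists : (foldSaddle lam μ β).configuration =
    (foldSaddle lam' μ β').configuration ↔ ∃ φ : ℝ ≃o ℝ, ∀ m,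
      φ '' (foldSaddle lam μ β).marks m = (foldSaddle lam' μ β').marks m := by
  rw [NSVF.configuration, NSVF.configuration, Quotient.eq]
  rfl

/-- For `β > 0` an isomorphism matches the marked points one by one, and each threshold encodes an
order relation between two of them: `2 * lam + β` against the tangency point or `β`, `2 * lam - β`
against the tangency point, and `lam` against the rest. -/
theorem sameOrder_of_configuration_eq (hμ : μ < 0)
    (h : (foldSaddle lam μ β).configuration = (foldSaddle lam' μ β').configuration) :
    SameOrder μ lam β lam' β' := by
  obtain ⟨φ, hφ⟩ := configuration_eq_iff_exists.1 h
  have hne : ∀ m, ((foldSaddle lam μ β).marks m).Nonempty ↔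
      ((foldSaddle lam' μ β').marks m).Nonempty := fun m => by rw [← hφ m, image_nonempty]
  have hmem : ∀ m, ∀ x ∈ (foldSaddle lam μ β).marks m, φ x ∈ (foldSaddle lam' μ β').marks m :=
    fun m x hx => hφ m ▸ mem_image_of_mem φ hx
  have hneg : β < 0 ↔ β' < 0 := by
    have := hne .visibleFoldY
    rw [marks_visibleFoldY hμ, marks_visibleFoldY hμ] at this
    simpa [Set.Nonempty] using this
  have hpos : 0 < β ↔ 0 < β' := by
    have := hne .invisibleFoldY
    rw [marks_invisibleFoldY hμ, marks_invisibleFoldY hμ] at this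
    simpa [Set.Nonempty] using this
  have hl : φ lam = lam' := by
    have := hmem .invisibleFoldX lam (by rw [marks_invisibleFoldX]; rfl)
    rwa [marks_invisibleFoldX] at this
  refine ⟨hneg, hpos, ?_, ?_, ?_, ?_⟩
  · have := hne .sliding
    rw [marks_sliding hμ, marks_sliding hμ] at this
    change (Ioo _ _).Nonempty ↔ (Ioo _ _).Nonempty at this
    rwa [nonempty_Ioo, nonempty_Ioo] at this
  · have := hne .escaping
    rw [marks_escaping hμ, marks_escaping hμ] at this
    change (Ioo _ _).Nonempty ↔ (Ioo _ _).Nonempty at this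
    rwa [nonempty_Ioo, nonempty_Ioo] at this
  all_goals
    intro hβ
    have hβ' := hpos.1 hβ
    have ht : φ (tangency μ β) = tangency μ β' := by
      have := hmem .invisibleFoldY _ (by rw [marks_invisibleFoldY hμ]; exact ⟨hβ, rfl⟩)
      rw [marks_invisibleFoldY hμ] at this
      exact this.2
    have hu : φ (-β) = -β' := by
      have := hmem .unstable _ (by rw [marks_unstable hμ]; exact ⟨hβ, rfl⟩)
      rw [marks_unstable hμ] at this
      exact this.2
    have hs : φ β = β' := by
      have := hmem .stable _ (by rw [marks_stable hμ]; exact ⟨hβ, rfl⟩)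
      rw [marks_stable hμ] at this
      exact this.2
    -- This point is marked only if an upper arc starts at `-β`. When `lam ≤ -β`, the comparisons
    -- that would use it hold or fail for both fields alike.
    have hn : -β < lam → φ (2 * lam + β) = 2 * lam' + β' := by
      intro hlt
      have := hmem .unstableNext _ (by rw [marks_unstableNext hμ]; exact ⟨hβ, hlt, rfl⟩)
      rw [marks_unstableNext hμ] at this
      exact this.2.2
    have hp : lam < β → φ (2 * lam - β) = 2 * lam' - β' := by
      intro hlt
      have := hmem .stablePrev _ (by rw [marks_stablePrev hμ]; exact ⟨hβ, hlt, rfl⟩)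
      rw [marks_stablePrev hμ] at this
      exact this.2.2
    have hb := neg_lt_tangency hμ hβ
    have hb' := neg_lt_tangency hμ hβ'
    have ha := tangency_neg hμ hβ
    have ha' := tangency_neg hμ hβ'
    have e1 : -β < lam ↔ -β' < lam' := by rw [← φ.lt_iff_lt, hl, hu]
    have e2 : lam < β ↔ lam' < β' := by rw [← φ.lt_iff_lt, hl, hs]
    intro k
    fin_cases k
  · change lam < -β ↔ lam' < -β'
    rw [← φ.lt_iff_lt, hl, hu]
  · change lam < (tangency μ β - β) / 2 ↔ lam' < (tangency μ β' - β') / 2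
    by_cases hlt : -β < lam
    · have := φ.lt_iff_lt (x := 2 * lam + β) (y := tangency μ β)
      rw [hn hlt, ht] at this
      constructor <;> intro h
      · linarith [this.2 (by linarith)]
      · linarith [this.1 (by linarith)]
    · have := mt e1.2 hlt
      constructor <;> intro <;> linarith
  · change lam < tangency μ β ↔ lam' < tangency μ β'
    rw [← φ.lt_iff_lt, hl, ht]
  · change lam < 0 ↔ lam' < 0
    by_cases hlt : -β < lam
    · have := φ.lt_iff_lt (x := 2 * lam + β) (y := β)
      rw [hn hlt, hs] at this
      constructor <;> intro h
      · linarith [this.2 (by linarith)]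
      · linarith [this.1 (by linarith)]
    · have := mt e1.2 hlt
      constructor <;> intro <;> linarith
  · change lam < (tangency μ β + β) / 2 ↔ lam' < (tangency μ β' + β') / 2
    by_cases hlt : lam < β
    · have := φ.lt_iff_lt (x := 2 * lam - β) (y := tangency μ β)
      rw [hp hlt, ht] at this
      constructor <;> intro h
      · linarith [this.2 (by linarith)]
      · linarith [this.1 (by linarith)]
    · have := mt e2.2 hlt
      constructor <;> intro <;> linarith
  · exact e2
  · exact e1
  · change (tangency μ β - β) / 2 < lam ↔ (tangency μ β' - β') / 2 < lam'
    by_cases hlt : -β < lam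
    · have := φ.lt_iff_lt (x := tangency μ β) (y := 2 * lam + β)
      rw [hn hlt, ht] at this
      constructor <;> intro h
      · linarith [this.2 (by linarith)]
      · linarith [this.1 (by linarith)]
    · have := mt e1.2 hlt
      constructor <;> intro <;> linarith
  · change tangency μ β < lam ↔ tangency μ β' < lam'
    rw [← φ.lt_iff_lt, hl, ht]
  · change 0 < lam ↔ 0 < lam'
    by_cases hlt : -β < lam
    · have := φ.lt_iff_lt (x := β) (y := 2 * lam + β)
      rw [hn hlt, hs] at this
      constructor <;> intro h
      · linarith [this.2 (by linarith)]
      · linarith [this.1 (by linarith)]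
    · have := mt e1.2 hlt
      constructor <;> intro <;> linarith
  · change (tangency μ β + β) / 2 < lam ↔ (tangency μ β' + β') / 2 < lam'
    by_cases hlt : lam < β
    · have := φ.lt_iff_lt (x := tangency μ β) (y := 2 * lam - β)
      rw [hp hlt, ht] at this
      constructor <;> intro h
      · linarith [this.2 (by linarith)]
      · linarith [this.1 (by linarith)]
    · have := mt e2.2 hlt
      constructor <;> intro <;> linarith
  · change β < lam ↔ β' < lam'
    rw [← φ.lt_iff_lt, hl, hs]

/-- The distinguished points. -/
def points (lam μ β : ℝ) : Fin 6 → ℝ :=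
  ![lam, tangency μ β, -β, β, 2 * lam + β, 2 * lam - β]

/-- For `β > 0`, each comparison between two of the six points is linear in `lam` and reduces to a
threshold or to `-β < tangency μ β < 0 < β`. The points `2 * lam ± β` are matched even where they
are not marked, which does no harm. -/
theorem SameOrder.exists_orderIso (hμ : μ < 0) (h : SameOrder μ lam β lam' β') :
    ∃ φ : ℝ ≃o ℝ, φ lam = lam' ∧ φ (tangency μ β) = tangency μ β' ∧
      (0 < β → φ (-β) = -β' ∧ φ β = β' ∧ φ (2 * lam + β) = 2 * lam' + β' ∧
        φ (2 * lam - β) = 2 * lam' - β') := by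
  rcases lt_or_ge 0 β with hβ | hβ
  · have hβ' := h.pos.1 hβ
    have hb := neg_lt_tangency hμ hβ
    have hb' := neg_lt_tangency hμ hβ'
    have ha := tangency_neg hμ hβ
    have ha' := tangency_neg hμ hβ'
    have key : ∀ i j, points lam μ β i < points lam μ β j ↔
        points lam' μ β' i < points lam' μ β' j := by
      have h0 := h.lt_threshold hβ 0
      have h1 := h.lt_threshold hβ 1
      have h2 := h.lt_threshold hβ 2
      have h3 := h.lt_threshold hβ 3
      have h4 := h.lt_threshold hβ 4
      have h5 := h.lt_threshold hβ 5
      have g0 := h.gt_threshold hβ 0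
      have g1 := h.gt_threshold hβ 1
      have g2 := h.gt_threshold hβ 2
      have g3 := h.gt_threshold hβ 3
      have g4 := h.gt_threshold hβ 4
      have g5 := h.gt_threshold hβ 5
      simp only [threshold, Fin.isValue, Matrix.cons_val] at h0 h1 h2 h3 h4 h5 g0 g1 g2 g3 g4 g5
      clear h hμ
      intro i j
      fin_cases i <;> fin_cases j <;>
        simp only [points, Fin.isValue, Matrix.cons_val, Fin.reduceFinMk, Fin.zero_eta,
          Fin.mk_one] <;> grind
    obtain ⟨φ, hφ⟩ := FoldSaddle.exists_orderIso _ _ key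
    exact ⟨φ, hφ 0, hφ 1, fun _ => ⟨hφ 2, hφ 3, hφ 4, hφ 5⟩⟩
  · have hlt := h.lt
    have hgt := h.gt
    obtain ⟨φ, hφ⟩ := FoldSaddle.exists_orderIso ![lam, tangency μ β] ![lam', tangency μ β'] (by
      intro i j
      fin_cases i <;> fin_cases j <;> simp [hlt, hgt])
    exact ⟨φ, hφ 0, hφ 1, fun h => absurd h hβ.not_gt⟩

theorem image_setOf_iff {φ : ℝ ≃o ℝ} {p q : ℝ → Prop} (h : ∀ x, p x ↔ q (φ x)) :
    φ '' {x | p x} = {x | q x} := by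
  ext y
  constructor
  · rintro ⟨x, hx, rfl⟩
    exact (h x).1 hx
  · intro hy
    exact ⟨φ.symm y, (h _).2 (by simpa using hy), by simp⟩

theorem SameOrder.configuration_eq (hμ : μ < 0) (h : SameOrder μ lam β lam' β') :
    (foldSaddle lam μ β).configuration = (foldSaddle lam' μ β').configuration := by
  rw [configuration_eq_iff_exists]
  obtain ⟨φ, h1, h2, h3⟩ := h.exists_orderIso hμ
  have hzero : β = 0 ↔ β' = 0 := by
    have := h.neg
    have := h.pos
    grind
  refine ⟨φ, fun m => ?_⟩
  cases m
  · rw [marks_sewing hμ, marks_sewing hμ]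
    refine image_setOf_iff fun x => ?_
    rw [← h1, ← h2, φ.lt_iff_lt, φ.lt_iff_lt, φ.lt_iff_lt, φ.lt_iff_lt]
  · rw [marks_escaping hμ, marks_escaping hμ]
    refine image_setOf_iff fun x => ?_
    rw [← h1, ← h2, φ.lt_iff_lt, φ.lt_iff_lt]
  · rw [marks_sliding hμ, marks_sliding hμ]
    refine image_setOf_iff fun x => ?_
    rw [← h1, ← h2, φ.lt_iff_lt, φ.lt_iff_lt]
  · rw [marks_visibleFoldX, marks_visibleFoldX, image_empty]
  · rw [marks_invisibleFoldX, marks_invisibleFoldX]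
    refine image_setOf_iff fun x => ?_
    rw [← h1, φ.injective.eq_iff]
  · rw [marks_visibleFoldY hμ, marks_visibleFoldY hμ]
    refine image_setOf_iff fun x => ?_
    rw [← h2, φ.injective.eq_iff, h.neg]
  · rw [marks_invisibleFoldY hμ, marks_invisibleFoldY hμ]
    refine image_setOf_iff fun x => ?_
    rw [← h2, φ.injective.eq_iff, h.pos]
  · rw [marks_equilibrium hμ, marks_equilibrium hμ]
    refine image_setOf_iff fun x => ?_
    rw [← h2, φ.injective.eq_iff, hzero]
  · rw [marks_unstable hμ, marks_unstable hμ]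
    refine image_setOf_iff fun x => ?_
    rw [← h.pos]
    refine and_congr_right fun hβ => ?_
    rw [← (h3 hβ).1, φ.injective.eq_iff]
  · rw [marks_stable hμ, marks_stable hμ]
    refine image_setOf_iff fun x => ?_
    rw [← h.pos]
    refine and_congr_right fun hβ => ?_
    rw [← (h3 hβ).2.1, φ.injective.eq_iff]
  · rw [marks_unstableNext hμ, marks_unstableNext hμ]
    refine image_setOf_iff fun x => ?_
    rw [← h.pos]
    refine and_congr_right fun hβ => ?_
    rw [← (h3 hβ).2.2.1, φ.injective.eq_iff]
    exact and_congr_left fun _ => h.gt_threshold hβ 0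
  · rw [marks_stablePrev hμ, marks_stablePrev hμ]
    refine image_setOf_iff fun x => ?_
    rw [← h.pos]
    refine and_congr_right fun hβ => ?_
    rw [← (h3 hβ).2.2.2, φ.injective.eq_iff]
    exact and_congr_left fun _ => h.lt_threshold hβ 5

theorem configuration_eq_iff (hμ : μ < 0) :
    (foldSaddle lam μ β).configuration = (foldSaddle lam' μ β').configuration ↔
      SameOrder μ lam β lam' β' :=
  ⟨sameOrder_of_configuration_eq hμ, fun h => h.configuration_eq hμ⟩

/-! ### Strata -/

/-- Written as midpoints, the stratum boundaries are linear in `β` and the tangency abscissa, so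
comparing strata becomes linear arithmetic. -/
theorem lower_threshold (hμ : μ < 0) : (μ - 1) * β / (2 - μ) = (tangency μ β - β) / 2 := by
  have : (2 - μ) ≠ 0 := by linarith
  rw [tangency]
  field_simp
  ring

theorem upper_threshold (hμ : μ < 0) : β / (2 - μ) = (tangency μ β + β) / 2 := by
  have : (2 - μ) ≠ 0 := by linarith
  rw [tangency]
  field_simp
  ring

theorem exists_stratum (μ lam β : ℝ) : ∃ i, stratum μ lam β i := by
  rcases lt_trichotomy β 0 with hβ | hβ | hβ
  · rcases lt_trichotomy lam (tangency μ β) with h | h | h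
    · exact ⟨0, hβ, h⟩
    · exact ⟨1, hβ, h⟩
    · exact ⟨2, hβ, h⟩
  · rcases lt_trichotomy lam 0 with h | h | h
    · exact ⟨3, hβ, h⟩
    · exact ⟨4, hβ, h⟩
    · exact ⟨5, hβ, h⟩
  · rcases lt_trichotomy lam (-β) with h | h | h0
    · exact ⟨6, hβ, h⟩
    · exact ⟨7, hβ, h⟩
    rcases lt_trichotomy lam ((μ - 1) * β / (2 - μ)) with h | h | h1
    · exact ⟨8, hβ, h0, h⟩
    · exact ⟨9, hβ, h⟩
    rcases lt_trichotomy lam (tangency μ β) with h | h | h2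
    · exact ⟨10, hβ, h1, h⟩
    · exact ⟨11, hβ, h⟩
    rcases lt_trichotomy lam 0 with h | h | h3
    · exact ⟨12, hβ, h2, h⟩
    · exact ⟨13, hβ, h⟩
    rcases lt_trichotomy lam (β / (2 - μ)) with h | h | h4
    · exact ⟨14, hβ, h3, h⟩
    · exact ⟨15, hβ, h⟩
    rcases lt_trichotomy lam β with h | h | h5
    · exact ⟨16, hβ, h4, h⟩
    · exact ⟨17, hβ, h⟩
    · exact ⟨18, hβ, h5⟩

theorem tangency_bounds (hμ : μ < 0) :
    (0 < β → -β < tangency μ β ∧ tangency μ β < 0) ∧ (β = 0 → tangency μ β = 0) :=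
  ⟨fun h => ⟨neg_lt_tangency hμ h, tangency_neg hμ h⟩, fun h => by rw [h, tangency_zero]⟩

theorem stratum_unique (hμ : μ < 0) {i j : Fin 19} (hi : stratum μ lam β i)
    (hj : stratum μ lam β j) : i = j := by
  obtain ⟨hb, -⟩ := tangency_bounds (β := β) hμ
  by_contra hne
  wlog hij : i < j generalizing i j
  · exact this hj hi (Ne.symm hne) (lt_of_le_of_ne (not_lt.1 hij) (Ne.symm hne))
  rcases lt_or_ge 0 β with hβ | hβ
  · obtain ⟨h1, h2⟩ := hb hβ
    fin_cases i <;> fin_cases j <;> first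
      | exact absurd hij (by decide)
      | (simp only [stratum, lower_threshold hμ, upper_threshold hμ, Fin.isValue, Matrix.cons_val,
          Fin.reduceFinMk, Fin.zero_eta, Fin.mk_one] at hi hj
         linarith)
  · fin_cases i <;> fin_cases j <;> first
      | exact absurd hij (by decide)
      | (simp only [stratum, Fin.isValue, Matrix.cons_val,
          Fin.reduceFinMk, Fin.zero_eta, Fin.mk_one] at hi hj
         linarith)

theorem sameOrder_of_stratum (hμ : μ < 0) {i : Fin 19} (hi : stratum μ lam β i)
    (hj : stratum μ lam' β' i) : SameOrder μ lam β lam' β' := by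
  obtain ⟨hb, hz⟩ := tangency_bounds (β := β) hμ
  obtain ⟨hb', hz'⟩ := tangency_bounds (β := β') hμ
  fin_cases i <;>
    simp only [stratum, lower_threshold hμ, upper_threshold hμ, Fin.isValue, Matrix.cons_val,
      Fin.reduceFinMk, Fin.zero_eta, Fin.mk_one] at hi hj <;>
    clear hμ <;> constructor <;> first
      | grind
      | (intro hβ k
         fin_cases k <;> simp only [threshold, Fin.isValue, Matrix.cons_val,
           Fin.reduceFinMk, Fin.zero_eta, Fin.mk_one] <;> grind)

theorem SameOrder.stratum (hμ : μ < 0) (h : SameOrder μ lam β lam' β') {i : Fin 19}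
    (hi : stratum μ lam β i) : stratum μ lam' β' i := by
  obtain ⟨-, hz⟩ := tangency_bounds (β := β) hμ
  obtain ⟨-, hz'⟩ := tangency_bounds (β := β') hμ
  obtain ⟨hneg, hpos, hlt, hgt, h1, h2⟩ := h
  have l0 := fun hβ => h1 hβ 0
  have l1 := fun hβ => h1 hβ 1
  have l3 := fun hβ => h1 hβ 3
  have l4 := fun hβ => h1 hβ 4
  have l5 := fun hβ => h1 hβ 5
  have g0 := fun hβ => h2 hβ 0
  have g1 := fun hβ => h2 hβ 1
  have g3 := fun hβ => h2 hβ 3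
  have g4 := fun hβ => h2 hβ 4
  have g5 := fun hβ => h2 hβ 5
  clear h1 h2
  simp only [threshold, Fin.isValue, Matrix.cons_val] at l0 l1 l3 l4 l5 g0 g1 g3 g4 g5
  fin_cases i <;>
    simp only [_root_.stratum, lower_threshold hμ, upper_threshold hμ, Fin.isValue,
      Matrix.cons_val, Fin.reduceFinMk, Fin.zero_eta, Fin.mk_one] at hi ⊢ <;>
    clear hμ <;> grind

theorem configuration_eq_iff_stratum (hμ : μ < 0) {i j : Fin 19} (hi : stratum μ lam β i)
    (hj : stratum μ lam' β' j) : (foldSaddle lam μ β).configuration =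
      (foldSaddle lam' μ β').configuration ↔ i = j := by
  rw [configuration_eq_iff hμ]
  constructor
  · exact fun h => stratum_unique hμ (h.stratum hμ hi) hj
  · rintro rfl
    exact sameOrder_of_stratum hμ hi hj

theorem stratum_nonempty (hμ : μ < 0) (i : Fin 19) :
    ∃ p ∈ parameters, stratum μ p.1 p.2 i := by
  have ha := tangency_neg hμ (by norm_num : (0 : ℝ) < 1 / 2)
  have hb := neg_lt_tangency hμ (by norm_num : (0 : ℝ) < 1 / 2)
  -- Sample points are taken on `β = 1 / 2`, `0` and `-(1 / 2)`. With `-1 / 2 < t < 0` all stratum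
  -- boundaries there stay inside the square, and oddness in `β` reduces the last line to the first.
  have hodd : tangency μ (-(1 / 2)) = -tangency μ (1 / 2) := by
    simp only [tangency]; ring
  have hl := lower_threshold (β := 1 / 2) hμ
  have hu := upper_threshold (β := 1 / 2) hμ
  set t := tangency μ (1 / 2) with ht
  have key : ∀ x y : ℝ, -1 < x → x < 1 → -1 < y → y < 1 → stratum μ x y i →
      ∃ p ∈ parameters, stratum μ p.1 p.2 i := fun x y h1 h2 h3 h4 h =>
    ⟨(x, y), ⟨⟨h1, h2⟩, ⟨h3, h4⟩⟩, h⟩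
  have hβ : (0 : ℝ) < 1 / 2 := by norm_num
  have hβ' : -(1 / 2 : ℝ) < 0 := by norm_num
  fin_cases i
  · exact key (-t - 1 / 4) (-(1 / 2)) (by linarith) (by linarith) (by linarith) (by linarith)
      ⟨hβ', by rw [hodd]; linarith⟩
  · exact key (-t) (-(1 / 2)) (by linarith) (by linarith) (by linarith) (by linarith)
      ⟨hβ', by rw [hodd]⟩
  · exact key (-t + 1 / 4) (-(1 / 2)) (by linarith) (by linarith) (by linarith) (by linarith)
      ⟨hβ', by rw [hodd]; linarith⟩
  · exact key (-(1 / 2)) 0 (by linarith) (by linarith) (by linarith) (by linarith) ⟨rfl, hβ'⟩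
  · exact key 0 0 (by linarith) (by linarith) (by linarith) (by linarith) ⟨rfl, rfl⟩
  · exact key (1 / 2) 0 (by linarith) (by linarith) (by linarith) (by linarith) ⟨rfl, hβ⟩
  · exact key (-(3 / 4)) (1 / 2) (by linarith) (by linarith) (by linarith) (by linarith)
      ⟨hβ, by linarith⟩
  · exact key (-(1 / 2)) (1 / 2) (by linarith) (by linarith) (by linarith) (by linarith)
      ⟨hβ, by linarith⟩
  · exact key ((-(1 / 2) + (t - 1 / 2) / 2) / 2) (1 / 2) (by linarith) (by linarith) (by linarith)
      (by linarith) ⟨hβ, by linarith, by linarith⟩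
  · exact key ((t - 1 / 2) / 2) (1 / 2) (by linarith) (by linarith) (by linarith)
      (by linarith) ⟨hβ, by linarith⟩
  · exact key (((t - 1 / 2) / 2 + t) / 2) (1 / 2) (by linarith) (by linarith) (by linarith)
      (by linarith) ⟨hβ, by linarith, by linarith⟩
  · exact key t (1 / 2) (by linarith) (by linarith) (by linarith) (by linarith) ⟨hβ, by linarith⟩
  · exact key (t / 2) (1 / 2) (by linarith) (by linarith) (by linarith) (by linarith)
      ⟨hβ, by linarith, by linarith⟩
  · exact key 0 (1 / 2) (by linarith) (by linarith) (by linarith) (by linarith) ⟨hβ, rfl⟩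
  · exact key ((t + 1 / 2) / 4) (1 / 2) (by linarith) (by linarith) (by linarith) (by linarith)
      ⟨hβ, by linarith, by linarith⟩
  · exact key ((t + 1 / 2) / 2) (1 / 2) (by linarith) (by linarith) (by linarith) (by linarith)
      ⟨hβ, by linarith⟩
  · exact key (((t + 1 / 2) / 2 + 1 / 2) / 2) (1 / 2) (by linarith) (by linarith) (by linarith)
      (by linarith) ⟨hβ, by linarith, by linarith⟩
  · exact key (1 / 2) (1 / 2) (by linarith) (by linarith) (by linarith) (by linarith)
      ⟨hβ, by linarith⟩
  · exact key (3 / 4) (1 / 2) (by linarith) (by linarith) (by linarith) (by linarith)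
      ⟨hβ, by linarith⟩

/-! ### Topological behaviours -/

/-- The parameter values for which a critical element of the given type exists. -/
def Occurs (lam μ β : ℝ) : NSVF.Critical → Prop
  | .saddle => 0 < β
  | .boundarySaddle => β = 0
  | .sigmaAttractor => 0 < β ∧ lam < tangency μ β
  | .sigmaRepeller => 0 < β ∧ tangency μ β < lam
  | .tangentialAttractor => lam = tangency μ β ∧ 0 < β
  | .attractingCycleI => 0 < β ∧ tangency μ β < lam ∧ lam < 0
  | .attractingGraphI => 0 < β ∧ lam = 0
  | _ => False

theorem behaviour_of_occurs (hμ : μ < 0) {c : NSVF.Critical} (h : Occurs lam μ β c) :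
    (foldSaddle lam μ β).behaviour c = 1 := by
  cases c
  case saddle =>
    refine encard_eq_one.2 ⟨(0, -β), ?_⟩
    ext p
    exact (realSaddle_iff hμ).trans (and_iff_right h)
  case boundarySaddle =>
    refine encard_eq_one.2 ⟨0, ?_⟩
    ext p
    exact (boundarySaddle_iff hμ).trans (and_iff_right h)
  case sigmaAttractor => exact encard_eq_one.2 ⟨_, setOf_sigmaAttractor_of_lt hμ h.1 h.2⟩
  case sigmaRepeller => exact encard_eq_one.2 ⟨_, setOf_sigmaRepeller_of_gt hμ h.1 h.2⟩
  case tangentialAttractor =>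
    exact encard_eq_one.2 ⟨_, setOf_tangentialAttractor_of_eq hμ h.2 h.1⟩
  case attractingCycleI =>
    exact encard_eq_one.2 (setOf_attractingCycleI_of_mem hμ h.1 h.2.1 h.2.2)
  case attractingGraphI =>
    obtain ⟨hβ, rfl⟩ := h
    exact encard_eq_one.2 ⟨_, setOf_attractingGraphI_of_zero hμ hβ⟩
  all_goals exact h.elim

theorem behaviour_of_not_occurs (hμ : μ < 0) (hlam : lam < 1) {c : NSVF.Critical}
    (h : ¬ Occurs lam μ β c) : (foldSaddle lam μ β).behaviour c = 0 := by
  cases c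
  case saddle =>
    exact encard_eq_zero.2 (eq_empty_of_forall_notMem fun p hp => h ((realSaddle_iff hμ).1 hp).1)
  case boundarySaddle =>
    exact encard_eq_zero.2
      (eq_empty_of_forall_notMem fun p hp => h ((boundarySaddle_iff hμ).1 hp).1)
  case sigmaAttractor =>
    refine encard_eq_zero.2 ?_
    rcases le_or_gt β 0 with hβ | hβ
    · exact setOf_sigmaAttractor_of_nonpos hμ hβ hlam
    · exact setOf_sigmaAttractor_of_ge hμ (not_lt.1 fun h' => h ⟨hβ, h'⟩)
  case sigmaRepeller =>
    refine encard_eq_zero.2 ?_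
    rcases le_or_gt β 0 with hβ | hβ
    · exact setOf_sigmaRepeller_of_nonpos hμ hβ hlam
    · exact setOf_sigmaRepeller_of_le hμ (not_lt.1 fun h' => h ⟨hβ, h'⟩)
  case sigmaSaddle =>
    refine encard_eq_zero.2 ?_
    rcases le_or_gt β 0 with hβ | hβ
    · exact setOf_sigmaSaddle_of_nonpos hμ hβ hlam
    · exact setOf_sigmaSaddle hμ hβ
  case tangentialAttractor => exact encard_eq_zero.2 (setOf_tangentialAttractor_of_ne hμ h)
  case tangentialRepeller => exact encard_eq_zero.2 (setOf_tangentialRepeller hμ)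
  case attractingCycleI => exact encard_eq_zero.2 (setOf_attractingCycleI_of_notMem hμ hlam h)
  case repellingCycleI => exact encard_eq_zero.2 (setOf_repellingCycleI hμ hlam)
  case otherCycle => exact encard_eq_zero.2 (setOf_otherCycle hμ hlam)
  case attractingGraphI => exact encard_eq_zero.2 (setOf_attractingGraphI_of_ne hμ h)
  case otherGraphI => exact encard_eq_zero.2 (setOf_otherGraphI hμ)

/-- The parameter regions of the 7 topological behaviours. -/
def region (μ lam β : ℝ) : Fin 7 → Prop :=
  ![β < 0, β = 0, 0 < β ∧ lam < tangency μ β, 0 < β ∧ lam = tangency μ β,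
    0 < β ∧ tangency μ β < lam ∧ lam < 0, 0 < β ∧ lam = 0, 0 < β ∧ 0 < lam]

theorem region_of_stratum (hμ : μ < 0) {i : Fin 19} (hi : stratum μ lam β i) :
    region μ lam β (behaviourIndex i) := by
  obtain ⟨hb, -⟩ := tangency_bounds (β := β) hμ
  fin_cases i <;>
    simp only [stratum, lower_threshold hμ, upper_threshold hμ, Fin.isValue, Matrix.cons_val,
      Fin.reduceFinMk, Fin.zero_eta, Fin.mk_one] at hi <;>
    simp only [region, behaviourIndex, Fin.isValue, Matrix.cons_val, Fin.reduceFinMk, Fin.zero_eta,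
      Fin.mk_one] <;>
    grind

theorem occurs_iff (hμ : μ < 0) {g : Fin 7} (h : region μ lam β g) (c : NSVF.Critical) :
    Occurs lam μ β c ↔ c ∈ criticalElements g := by
  obtain ⟨hb, -⟩ := tangency_bounds (β := β) hμ
  fin_cases g <;>
    simp only [region, Fin.isValue, Matrix.cons_val, Fin.reduceFinMk, Fin.zero_eta,
      Fin.mk_one] at h <;>
    cases c <;> simp [criticalElements, Occurs] <;> grind

theorem behaviour_eq (hμ : μ < 0) (hlam : lam < 1) {i : Fin 19} (hi : stratum μ lam β i)
    (c : NSVF.Critical) : (foldSaddle lam μ β).behaviour c =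
      if c ∈ criticalElements (behaviourIndex i) then 1 else 0 := by
  have h := occurs_iff hμ (region_of_stratum hμ hi) c
  split_ifs with hc
  · exact behaviour_of_occurs hμ (h.2 hc)
  · exact behaviour_of_not_occurs hμ hlam fun h' => hc (h.1 h')

/-- The inventory of critical elements of a topological behaviour. -/
def inventory (g : Fin 7) (c : NSVF.Critical) : ℕ∞ := if c ∈ criticalElements g then 1 else 0

theorem inventory_injective : Function.Injective inventory := by
  intro g g' h
  have key : ∀ c, c ∈ criticalElements g ↔ c ∈ criticalElements g' := by
    intro c
    have := congrFun h c
    simp only [inventory] at this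
    split_ifs at this <;> simp_all
  -- These six types already tell the seven lists apart, so the comparison is a finite check.
  have main : ∀ g g' : Fin 7, (∀ c ∈ [NSVF.Critical.boundarySaddle, .sigmaAttractor,
      .tangentialAttractor, .attractingCycleI, .attractingGraphI, .saddle],
      c ∈ criticalElements g ↔ c ∈ criticalElements g') → g = g' := by decide
  exact main g g' fun c _ => key c

/-! ### Counting configurations and behaviours -/

theorem behaviourIndex_surjective : Function.Surjective behaviourIndex := by decide

theorem ncard_image_eq {α β : Type*} {n : ℕ} {s : Set α} (f : α → β) (F : Fin n → β)
    (hF : Function.Injective F) (h1 : ∀ a ∈ s, ∃ i, f a = F i) (h2 : ∀ i, ∃ a ∈ s, f a = F i) :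
    (f '' s).ncard = n := by
  have : f '' s = range F := by
    ext b
    constructor
    · rintro ⟨a, ha, rfl⟩
      obtain ⟨i, hi⟩ := h1 a ha
      exact ⟨i, hi.symm⟩
    · rintro ⟨i, rfl⟩
      obtain ⟨a, ha, h⟩ := h2 i
      exact ⟨a, ha, h⟩
  rw [this, ← image_univ, ncard_image_of_injective _ hF, ncard_univ, Nat.card_eq_fintype_card,
    Fintype.card_fin]

end FoldSaddle
end

/-! ### The bifurcation diagram assembled -/

theorem theorem3 :
    ∃ ε₀ : ℝ, 0 < ε₀ ∧ ∀ μ : ℝ, -ε₀ < μ → μ < 0 →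
      -- there are exactly 19 configurations and exactly 7 topological behaviours
      ((fun p : ℝ × ℝ => (foldSaddle p.1 μ p.2).configuration) '' parameters).ncard = 19 ∧
      ((fun p : ℝ × ℝ => (foldSaddle p.1 μ p.2).behaviour) '' parameters).ncard = 7 ∧
      -- the bifurcation diagram: the strata are non-empty and partition the parameter square
      (∀ i : Fin 19, ∃ p ∈ parameters, stratum μ p.1 p.2 i) ∧
      (∀ p ∈ parameters, ∃! i : Fin 19, stratum μ p.1 p.2 i) ∧
      -- the strata are the configuration classes, and their grouping gives the behaviours
      (∀ p ∈ parameters, ∀ q ∈ parameters, ∀ i j : Fin 19,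
        stratum μ p.1 p.2 i → stratum μ q.1 q.2 j →
        ((foldSaddle p.1 μ p.2).configuration = (foldSaddle q.1 μ q.2).configuration ↔ i = j) ∧
        ((foldSaddle p.1 μ p.2).behaviour = (foldSaddle q.1 μ q.2).behaviour ↔
          behaviourIndex i = behaviourIndex j)) ∧
      -- the critical elements on each stratum
      (∀ p ∈ parameters, ∀ i : Fin 19, stratum μ p.1 p.2 i → ∀ c : NSVF.Critical,
        (foldSaddle p.1 μ p.2).behaviour c =
          if c ∈ criticalElements (behaviourIndex i) then 1 else 0) ∧
      -- the regions of the switching line, and the Filippov field on them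
      (∀ p ∈ parameters,
        {x | (foldSaddle p.1 μ p.2).Sliding x} = Set.Ioo p.1 (tangency μ p.2) ∧
        {x | (foldSaddle p.1 μ p.2).Escaping x} = Set.Ioo (tangency μ p.2) p.1 ∧
        {x | (foldSaddle p.1 μ p.2).Sewing x} = (Set.uIcc p.1 (tangency μ p.2))ᶜ ∧
        (p.2 ≤ 0 → ∀ x, (foldSaddle p.1 μ p.2).Sliding x ∨ (foldSaddle p.1 μ p.2).Escaping x →
          0 < (foldSaddle p.1 μ p.2).slide x) ∧
        (0 < p.2 → p.1 ≠ tangency μ p.2 →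
          {x | (foldSaddle p.1 μ p.2).PseudoEq x} = {pseudoRoot p.1 μ p.2})) := by
  open FoldSaddle in
  -- All estimates depend only on the sign of `μ`, so any positive constant serves.
  refine ⟨1, one_pos, fun μ _ hμ => ?_⟩
  have hne := stratum_nonempty hμ
  have hbeh : ∀ p ∈ parameters, ∀ i : Fin 19, stratum μ p.1 p.2 i →
      (foldSaddle p.1 μ p.2).behaviour = inventory (behaviourIndex i) :=
    fun p hp i hi => funext fun c => behaviour_eq hμ hp.1.2 hi c
  refine ⟨?_, ?_, hne, fun p hp => ?_, fun p hp q hq i j hi hj => ⟨?_, ?_⟩, fun p hp i hi c => ?_,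
    fun p hp => ⟨setOf_sliding hμ, setOf_escaping hμ, setOf_sewing hμ, fun hβ x hx => ?_,
      fun hβ hlam => ?_⟩⟩
  · choose p hp hs using hne
    refine ncard_image_eq _ (fun i => (foldSaddle (p i).1 μ (p i).2).configuration) ?_ ?_ ?_
    · exact fun i j hij => (configuration_eq_iff_stratum hμ (hs i) (hs j)).1 hij
    · intro q hq
      obtain ⟨i, hi⟩ := exists_stratum μ q.1 q.2
      exact ⟨i, (configuration_eq_iff_stratum hμ hi (hs i)).2 rfl⟩
    · exact fun i => ⟨p i, hp i, rfl⟩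
  · refine ncard_image_eq _ inventory inventory_injective ?_ ?_
    · intro q hq
      obtain ⟨i, hi⟩ := exists_stratum μ q.1 q.2
      exact ⟨_, hbeh q hq i hi⟩
    · intro g
      obtain ⟨i, rfl⟩ := behaviourIndex_surjective g
      obtain ⟨p, hp, hi⟩ := hne i
      exact ⟨p, hp, hbeh p hp i hi⟩
  · obtain ⟨i, hi⟩ := exists_stratum μ p.1 p.2
    exact ⟨i, hi, fun j hj => stratum_unique hμ hj hi⟩
  · exact configuration_eq_iff_stratum hμ hi hj
  · rw [hbeh p hp i hi, hbeh q hq j hj]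
    exact inventory_injective.eq_iff
  · exact behaviour_eq hμ hp.1.2 hi c
  · exact slide_pos hμ hβ hp.1.2 hx
  · exact setOf_pseudoEq hμ hβ hlam
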